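/- Let $n\in\mathbb N$, $\sigma\ge 1$, $0<\delta_1<\sigma/2<\delta_2<\sigma$ with $\delta_1+\delta_2>\sigma$ and $n>4\delta_1$, let $s\ge 0$ and $j\in\{0,1\}$. Write $\widehat f(\xi)=\int_{\mathbb R^n}e^{-ix\cdot\xi}f(x)\,dx$, let $\mathfrak F^{-1}$ be the inverse transform, and let $|D|^s$ and $(-\Delta)^\alpha$ be the operators with symbols $|\xi|^s$ and $|\xi|^{2\alpha}$. Let $$u_0\in L^1(\mathbb R^n)\cap H^{s+2j\delta_2}(\mathbb R^n),\qquad u_1\in L^1(\mathbb R^n)\cap H^{[s+2(j-1)\delta_2]^+}(\mathbb R^n),$$ where $[r]^+=\max\{r,0\}$, be complex-valued, and put $P_1=\int_{\mathbb R^n}u_1(x)\,dx$. Let $u\in C([0,\infty);L^2(\mathbb R^n))$ be a solution of $$u_{tt}+(-\Delta)^\sigma u+(-\Delta)^{\delta_1}u_t+(-\Delta)^{\delta_2}u_t=0,\qquad u(0,\cdot)=u_0,\quad u_t(0,\cdot)=u_1,$$ in the sense of distributions in $x$: for every Schwartz function $\varphi$, the function $t\mapsto\langle u(t),\varphi\rangle$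 is differentiable on $[0,\infty)$ with derivative $v_\varphi$, $v_\varphi(0)=\langle u_1,\varphi\rangle$, and $$\frac{d}{dt}\Big(v_\varphi(t)+\big\langle u(t),(-\Delta)^{\delta_1}\varphi+(-\Delta)^{\delta_2}\varphi\big\rangle\Big)=-\big\langle u(t),(-\Delta)^\sigma\varphi\big\rangle\quad(t\ge 0).$$ Put $$G(t,\cdot)=\mathfrak F^{-1}\Big(\frac{e^{-t|\xi|^{2(\sigma-\delta_1)}}}{|\xi|^{2\delta_1}}\Big),\qquad \rho=-\frac{n}{4(\sigma-\delta_1)}-\frac{s}{2(\sigma-\delta_1)}-j+\frac{\delta_1}{\sigma-\delta_1}.$$ Then for $t>0$ the functions $|D|^su(t)$ and $|D|^s(u(t)-P_1G(t))$ belong to $L^2$ and are $j$ times continuously differentiable in $t$ with values in $L^2$, and $$\big\|\partial_t^j|D|^s\big(u(t,\cdot)-P_1G(t,\cdot)\big)\big\|_{L^2}=o\big(t^{\rho}\big)\qquad\text{as }t\to\infty.$$ Moreover, if $P_1\ne 0$, then there are constants $C_1,C_2>0$ such that for all sufficiently large $t$ $$C_1\,t^{\rho}\le\big\|\partial_t^j|D|^su(t,\cdot)\big\|_{L^2}\le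 C_2\,t^{\rho}.$$ -/

import Mathlib

open MeasureTheory FourierTransform Filter Topology Asymptotics Set
open scoped SchwartzMap ENNReal

noncomputable section

namespace DampedEvolution

/-- The space `L²(ℝⁿ; ℂ)`. -/
abbrev L2 (n : ℕ) : Type :=
  Lp ℂ 2 (volume : Measure (EuclideanSpace ℝ (Fin n)))

variable {n : ℕ}

/-! ### Fourier multipliers

Mathlib's Fourier transform is `𝓕 f η = ∫ exp (-2πi ⟨x, η⟩) f x dx`. Relative to the convention
`f̂ ξ = ∫ exp (-i ⟨x, ξ⟩) f x dx` one has `ξ = 2π η`: the operator with symbol `m ξ` is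
multiplication of `𝓕 f` by `m (2π η)`, and the inverse transform
`(2π)⁻ⁿ ∫ exp (i ⟨x, ξ⟩) g ξ dξ` is Mathlib's inverse transform of `η ↦ g (2π η)`. -/

/-- For `g ∈ L²`, the inverse Fourier transform of `g` in the convention
`(2π)⁻ⁿ ∫ exp (i ⟨x, ξ⟩) g ξ dξ`, as an element of `L²`. (It is set to `0` if `η ↦ g (2π η)` is
not in `L²`.) -/
def invFourier (g : EuclideanSpace ℝ (Fin n) → ℂ) : L2 n := by
  classical
  exact if h : MemLp (fun η => g ((2 * Real.pi) • η)) 2 volume then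
    (𝓕⁻ (h.toLp (fun η => g ((2 * Real.pi) • η))) : L2 n) else 0

/-- `f ∈ L²` belongs to the (maximal) domain of `|D|^s` in `L²`: the function `|ξ|^s f̂` is
in `L²`. -/
def MemDomAbsD (s : ℝ) (f : L2 n) : Prop :=
  MemLp (fun η => ((‖(2 * Real.pi) • η‖ ^ s : ℝ) : ℂ) * (𝓕 f : L2 n) η) 2 volume

/-- Schwartz functions lie in the domain of `|D|^s` for `s ≥ 0`. -/
theorem memDomAbsD_toLp {s : ℝ} (hs : 0 ≤ s) (φ : 𝓢(EuclideanSpace ℝ (Fin n), ℂ)) :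
    MemDomAbsD s (φ.toLp 2 : L2 n) := by
  set g : EuclideanSpace ℝ (Fin n) → ℂ := fun x => (((1 + ‖x‖ ^ 2) ^ (s / 2) : ℝ) : ℂ) with hg
  have hgt : g.HasTemperateGrowth := by fun_prop
  set ψ := SchwartzMap.smulLeftCLM ℂ g (𝓕 φ) with hψ
  have hm : MemLp (fun x => (((2 * Real.pi) ^ s : ℝ) : ℂ) * ψ x) 2 volume :=
    (ψ.memLp 2 volume).const_mul _
  unfold MemDomAbsD
  have hF : ((𝓕 (φ.toLp 2 : L2 n) : L2 n) : EuclideanSpace ℝ (Fin n) → ℂ) =ᵐ[volume] (𝓕 φ : 𝓢(EuclideanSpace ℝ (Fin n), ℂ)) := by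
    rw [SchwartzMap.toLp_fourier_eq]
    exact SchwartzMap.coeFn_toLp _ 2 volume
  refine hm.mono ?_ ?_
  · refine AEStronglyMeasurable.mul ?_ (Lp.aestronglyMeasurable _)
    have : Measurable fun η : EuclideanSpace ℝ (Fin n) =>
      ((‖(2 * Real.pi) • η‖ ^ s : ℝ) : ℂ) := by fun_prop
    exact this.aestronglyMeasurable
  · filter_upwards [hF] with x hx
    rw [hx, hψ, SchwartzMap.smulLeftCLM_apply_apply hgt]
    simp only [norm_mul, smul_eq_mul, Complex.norm_real, hg, Real.norm_eq_abs]
    rw [← mul_assoc]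
    gcongr
    rw [norm_smul, Real.norm_eq_abs, abs_of_pos Real.two_pi_pos,
      Real.mul_rpow Real.two_pi_pos.le (norm_nonneg _), abs_mul]
    gcongr
    calc ‖x‖ ^ s = (‖x‖ ^ 2) ^ (s / 2) := by
          rw [← Real.rpow_natCast, ← Real.rpow_mul (norm_nonneg _)]; congr 1; push_cast; ring
      _ ≤ _ := by gcongr; linarith

/-- The pseudo-differential operator `|D|^s` with symbol `|ξ|^s`, as an operator in `L²` with its
maximal domain (and value `0` outside that domain). -/
def absD (s : ℝ) (f : L2 n) : L2 n := by
  classical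
  exact if h : MemDomAbsD s f then (𝓕⁻ (MemLp.toLp _ h) : L2 n) else 0

/-- The fractional Laplacian `(-Δ)^α = |D|^{2α}`. -/
def fracLaplacian (α : ℝ) (f : L2 n) : L2 n := absD (2 * α) f

/-! ### The Cauchy problem -/

/-- `u` is a solution, continuous in time with values in `L²`, of
`u_tt + (-Δ)^σ u + (-Δ)^{δ₁} u_t + (-Δ)^{δ₂} u_t = 0` for `t ≥ 0`,
with `u(0) = u₀` and `u_t(0) = u₁`. The equation and the second initial condition hold in the sense
of distributions in `x`: for each Schwartz function `φ`, the function `t ↦ ⟨φ, u(t)⟩` is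
differentiable on `[0, ∞)`, its derivative `v` has `v(0) = ⟨φ, u₁⟩`, and
`d/dt (v(t) + ⟨(-Δ)^{δ₁} φ + (-Δ)^{δ₂} φ, u(t)⟩) = - ⟨(-Δ)^σ φ, u(t)⟩`.
(Values of `u` at negative times play no role.) -/
structure IsSolution (σ δ₁ δ₂ : ℝ) (u₀ u₁ : L2 n) (u : ℝ → L2 n) : Prop where
  continuousOn : ContinuousOn u (Ici 0)
  initial : u 0 = u₀
  weak : ∀ φ : 𝓢(EuclideanSpace ℝ (Fin n), ℂ), ∃ v : ℝ → ℂ,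
    v 0 = inner ℂ (φ.toLp 2 : L2 n) u₁ ∧
    (∀ t ∈ Ici (0 : ℝ),
      HasDerivWithinAt (fun τ => inner ℂ (φ.toLp 2 : L2 n) (u τ)) (v t) (Ici 0) t) ∧
    (∀ t ∈ Ici (0 : ℝ),
      HasDerivWithinAt
        (fun τ => v τ +
          inner ℂ (fracLaplacian δ₁ (φ.toLp 2) + fracLaplacian δ₂ (φ.toLp 2) : L2 n) (u τ))
        (-inner ℂ (fracLaplacian σ (φ.toLp 2) : L2 n) (u t)) (Ici 0) t)

/-- The profile `𝔉⁻¹ (exp (-t |ξ|^{2(σ-δ₁)}) / |ξ|^{2δ₁})`. -/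
def profile (n : ℕ) (σ δ₁ t : ℝ) : L2 n :=
  invFourier fun ξ =>
    ((Real.exp (-t * ‖ξ‖ ^ (2 * (σ - δ₁))) / ‖ξ‖ ^ (2 * δ₁) : ℝ) : ℂ)

/-- The exponent `-n/(4(σ-δ₁)) - s/(2(σ-δ₁)) - j + δ₁/(σ-δ₁)`. -/
def rate (n : ℕ) (σ δ₁ s : ℝ) (j : ℕ) : ℝ :=
  -(n : ℝ) / (4 * (σ - δ₁)) - s / (2 * (σ - δ₁)) - j + δ₁ / (σ - δ₁)

end DampedEvolution

end

/-! In Fourier variables the equation decouples into damped oscillators `w'' + a w' + b w = 0`, one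
for each frequency, with `a = |ξ|^(2δ₁) + |ξ|^(2δ₂)` and `b = |ξ|^(2σ)`. Because `2δ₁ ≤ σ ≤ 2δ₂`,
one has `b ≤ a²` at every frequency. Let `K` be the solution with `w(0) = 0`, `w'(0) = 1`. Then `a
|K| ≤ 22 exp (-b t / (4 a))`, uniformly across the double root `a² = 4 b` (`mul_norm_oscSin_le`),
and bounds for the other kernels follow from this one.

Low frequencies give the profile. As `ξ → 0`, `b / a² → 0`, the slow root behaves like `-b / a ≈
-|ξ|^(2(σ-δ₁))`, and `K ≈ exp (-t |ξ|^(2(σ-δ₁))) / |ξ|^(2δ₁)`, the symbol of `G`; moreover the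
transform of `u₁ ∈ L¹` is continuous with value `P₁` at the origin. Dilating frequencies by `τ =
t^(-1/(2(σ-δ₁)))` turns this into a limit: by `scaling_factor`, `t^(-ρ)` times the `L²` norm is the
`L²` norm of a rescaled function, the rescaled `G` does not depend on `t`, and the rescaled low
frequency error tends to zero pointwise (`tendsto_scaledDiff`) under a square integrable majorant
(`norm_scaledDiff_le`). The condition `n > 4δ₁` is what makes `|ξ|^(s-2δ₁)` square integrable near
the origin. The contribution of `u₀` lacks the factor `|ξ|^(-2δ₁)`, hence is smaller by `τ^(2δ₁)`.

For `|ξ| ≥ 1`, `b / a ≥ 1/2`, so everything decays exponentially once the data carry the weights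
provided by the Sobolev hypotheses (`DataWeights.tendsto_high`). Together these give
`DataWeights.tendsto_diff`. Since the norm of `G` is exactly a positive constant times `t^ρ`
(`norm_profS`), the two-sided bound is then the triangle inequality.

It remains to see that a merely distributional solution is given by these kernels. Integrating twice
in time removes all derivatives and leaves an identity almost everywhere in frequency
(`fourier_integrated`). On `|ξ| ≤ R` the symbols are bounded, so the cut-off identity is a linear
ODE with bounded operators in `L²`, which has a unique solution (`localized_solution_eq`); then `R →
∞`. -/

noncomputable section

namespace DampedEvolution

/-! ### The scalar damped oscillator `w'' + a w' + b w = 0` -/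

/-- A square root `μ` of `a² / 4 - b` with nonnegative real part; the characteristic roots of
`w'' + a w' + b w = 0` are `-a / 2 ± μ`. -/
def oscRoot (a b : ℝ) : ℂ := ((a ^ 2 / 4 - b : ℝ) : ℂ) ^ (((2 : ℕ) : ℂ)⁻¹)

theorem oscRoot_sq (a b : ℝ) : oscRoot a b ^ 2 = ((a ^ 2 / 4 - b : ℝ) : ℂ) :=
  Complex.cpow_nat_inv_pow _ two_ne_zero

/-- The principal square root halves the argument and so lands in the closed right half plane. -/
theorem oscRoot_re_nonneg (a b : ℝ) : 0 ≤ (oscRoot a b).re := by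
  rcases eq_or_ne ((a ^ 2 / 4 - b : ℝ) : ℂ) 0 with h | h
  · rw [oscRoot, h]; simp
  · rw [oscRoot, Complex.cpow_def_of_ne_zero h, Complex.exp_re]
    refine mul_nonneg (Real.exp_pos _).le (Real.cos_nonneg_of_mem_Icc ?_)
    have him : (Complex.log ((a ^ 2 / 4 - b : ℝ) : ℂ) * ((2 : ℕ) : ℂ)⁻¹).im
        = Complex.arg ((a ^ 2 / 4 - b : ℝ) : ℂ) / 2 := by
      rw [← Complex.log_im,
        show (((2 : ℕ) : ℂ)⁻¹) = ((2⁻¹ : ℝ) : ℂ) by push_cast; rfl, Complex.im_mul_ofReal]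
      ring
    rw [him]
    have h1 := Complex.neg_pi_lt_arg ((a ^ 2 / 4 - b : ℝ) : ℂ)
    have h2 := Complex.arg_le_pi ((a ^ 2 / 4 - b : ℝ) : ℂ)
    constructor <;> linarith

/-- Either `Re μ = 0`, or `μ` is real because `μ²` is real. In the second case `(a/2 - b/(2a))² =
a²/4 - b/2 + b²/(4a²)` exceeds `a²/4 - b`; `b ≤ a²` makes the base nonnegative. -/
theorem oscRoot_re_le {a b : ℝ} (ha : 0 < a) (hb : 0 < b) (hab : b ≤ a ^ 2) :
    (oscRoot a b).re ≤ a / 2 - b / (2 * a) := by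
  have hq : b / (2 * a) ≤ a / 2 := by
    rw [div_le_iff₀ (by positivity)]; nlinarith
  have hs := oscRoot_sq a b
  have hre := congrArg Complex.re hs
  have him := congrArg Complex.im hs
  rw [sq, Complex.mul_re, Complex.ofReal_re] at hre
  rw [sq, Complex.mul_im, Complex.ofReal_im] at him
  set x := (oscRoot a b).re
  set y := (oscRoot a b).im
  by_contra! hx
  have hx0 : 0 < x := by linarith
  have hy : y = 0 := by
    have : x * y = 0 := by linarith
    rcases mul_eq_zero.1 this with h | h
    · exact absurd h hx0.ne'
    · exact h
  rw [hy] at hre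
  have hd : b / (2 * a) * a = b / 2 := by field_simp
  nlinarith [mul_self_lt_mul_self (by linarith : 0 ≤ a / 2 - b / (2 * a)) hx,
    mul_self_nonneg (b / (2 * a))]

theorem measurable_oscRoot : Measurable fun q : ℝ × ℝ => oscRoot q.1 q.2 := by
  unfold oscRoot
  fun_prop

/-- `sinh (μ t) / μ`, with its limit value at `μ = 0`. -/
def sinhc (μ : ℂ) (t : ℝ) : ℂ := if μ = 0 then (t : ℂ) else Complex.sinh (μ * t) / μ

theorem mul_sinhc (μ : ℂ) (t : ℝ) : μ * sinhc μ t = Complex.sinh (μ * t) := by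
  unfold sinhc
  split_ifs with h
  · simp [h]
  · field_simp

theorem sinhc_zero (μ : ℂ) : sinhc μ 0 = 0 := by
  unfold sinhc; split_ifs <;> simp

theorem hasDerivAt_mul_ofReal (μ : ℂ) (t : ℝ) : HasDerivAt (fun t : ℝ => μ * (t : ℂ)) μ t := by
  simpa using (Complex.ofRealCLM.hasDerivAt (x := t)).const_mul μ

theorem hasDerivAt_sinhc (μ : ℂ) (t : ℝ) : HasDerivAt (sinhc μ) (Complex.cosh (μ * t)) t := by
  by_cases h : μ = 0
  · have : sinhc μ = fun t : ℝ => (t : ℂ) := by funext t; simp [sinhc, h]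
    rw [this]
    simpa [h] using hasDerivAt_mul_ofReal 1 t
  · have : sinhc μ = fun t : ℝ => Complex.sinh (μ * t) / μ := by funext t; simp [sinhc, h]
    rw [this]
    have := ((Complex.hasDerivAt_sinh (μ * t)).comp t (hasDerivAt_mul_ofReal μ t)).div_const μ
    simpa [h] using this

theorem hasDerivAt_cosh_mul (μ : ℂ) (t : ℝ) :
    HasDerivAt (fun t : ℝ => Complex.cosh (μ * t)) (μ ^ 2 * sinhc μ t) t := by
  have := (Complex.hasDerivAt_cosh (μ * t)).comp t (hasDerivAt_mul_ofReal μ t)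
  rw [sq, mul_assoc, mul_sinhc, mul_comm]
  exact this

theorem norm_exp_mul_ofReal_le {μ : ℂ} (hμ : 0 ≤ μ.re) {t : ℝ} (ht : 0 ≤ t) :
    ‖Complex.exp (μ * t)‖ = Real.exp (μ.re * t) ∧
      ‖Complex.exp (-(μ * t))‖ ≤ Real.exp (μ.re * t) := by
  simp only [Complex.norm_exp, Complex.neg_re, Complex.re_mul_ofReal, Real.exp_le_exp, true_and]
  nlinarith [mul_nonneg hμ ht]

theorem norm_cosh_le {μ : ℂ} (hμ : 0 ≤ μ.re) {t : ℝ} (ht : 0 ≤ t) :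
    ‖Complex.cosh (μ * t)‖ ≤ Real.exp (μ.re * t) := by
  obtain ⟨h1, h2⟩ := norm_exp_mul_ofReal_le hμ ht
  rw [Complex.cosh, norm_div, Complex.norm_ofNat]
  linarith [norm_add_le (Complex.exp (μ * t)) (Complex.exp (-(μ * t)))]

theorem norm_sinh_le {μ : ℂ} (hμ : 0 ≤ μ.re) {t : ℝ} (ht : 0 ≤ t) :
    ‖Complex.sinh (μ * t)‖ ≤ Real.exp (μ.re * t) := by
  obtain ⟨h1, h2⟩ := norm_exp_mul_ofReal_le hμ ht
  rw [Complex.sinh, norm_div, Complex.norm_ofNat]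
  linarith [norm_sub_le (Complex.exp (μ * t)) (Complex.exp (-(μ * t)))]

/-- The mean value inequality avoids dividing by `μ`, so the bound survives the double root `μ = 0`.
-/
theorem norm_sinhc_le {μ : ℂ} (hμ : 0 ≤ μ.re) {t : ℝ} (ht : 0 ≤ t) :
    ‖sinhc μ t‖ ≤ t * Real.exp (μ.re * t) := by
  have := norm_image_sub_le_of_norm_deriv_le_segment' (f := sinhc μ)
    (f' := fun x => Complex.cosh (μ * x)) (a := 0) (b := t) (C := Real.exp (μ.re * t))
    (fun x _ => (hasDerivAt_sinhc μ x).hasDerivWithinAt)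
    (fun x hx => (norm_cosh_le hμ hx.1).trans (Real.exp_le_exp.2
      (mul_le_mul_of_nonneg_left hx.2.le hμ))) t (right_mem_Icc.2 ht)
  rw [sinhc_zero, sub_zero, sub_zero] at this
  linarith

/-- The solution of `w'' + a w' + b w = 0` with `w(0) = 0` and `w'(0) = 1`. -/
def oscSin (a b t : ℝ) : ℂ := Complex.exp (-(a / 2) * t) * sinhc (oscRoot a b) t

/-- The derivative of `oscSin`. -/
def oscSinDeriv (a b t : ℝ) : ℂ :=
  Complex.exp (-(a / 2) * t) *
    (Complex.cosh (oscRoot a b * t) - a / 2 * sinhc (oscRoot a b) t)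

/-- The solution of `w'' + a w' + b w = 0` with `w(0) = 1` and `w'(0) = 0`. -/
def oscCos (a b t : ℝ) : ℂ := oscSinDeriv a b t + a * oscSin a b t

@[simp] theorem oscSin_zero (a b : ℝ) : oscSin a b 0 = 0 := by simp [oscSin, sinhc_zero]

@[simp] theorem oscSinDeriv_zero (a b : ℝ) : oscSinDeriv a b 0 = 1 := by
  simp [oscSinDeriv, sinhc_zero]

@[simp] theorem oscCos_zero (a b : ℝ) : oscCos a b 0 = 1 := by simp [oscCos]

theorem hasDerivAt_exp_mul_ofReal (c : ℂ) (t : ℝ) :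
    HasDerivAt (fun t : ℝ => Complex.exp (c * t)) (Complex.exp (c * t) * c) t :=
  (Complex.hasDerivAt_exp (c * t)).comp t (hasDerivAt_mul_ofReal c t)

theorem hasDerivAt_oscSin (a b t : ℝ) : HasDerivAt (oscSin a b) (oscSinDeriv a b t) t := by
  have := (hasDerivAt_exp_mul_ofReal (-(a / 2)) t).mul (hasDerivAt_sinhc (oscRoot a b) t)
  refine this.congr_deriv ?_
  unfold oscSinDeriv
  ring

theorem hasDerivAt_oscSinDeriv (a b t : ℝ) :
    HasDerivAt (oscSinDeriv a b) (-a * oscSinDeriv a b t - b * oscSin a b t) t := by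
  have := (hasDerivAt_exp_mul_ofReal (-(a / 2)) t).mul
    ((hasDerivAt_cosh_mul (oscRoot a b) t).sub
      ((hasDerivAt_sinhc (oscRoot a b) t).const_mul ((a : ℂ) / 2)))
  refine this.congr_deriv ?_
  rw [oscRoot_sq]
  unfold oscSinDeriv oscSin
  push_cast
  simp only [Pi.sub_apply]
  ring

theorem hasDerivAt_oscCos (a b t : ℝ) :
    HasDerivAt (oscCos a b) (-b * oscSin a b t) t := by
  have := (hasDerivAt_oscSinDeriv a b t).add ((hasDerivAt_oscSin a b t).const_mul (a : ℂ))
  refine this.congr_deriv ?_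
  ring

theorem measurable_sinhc (t : ℝ) : Measurable fun μ => sinhc μ t := by
  unfold sinhc
  refine Measurable.ite (measurableSet_singleton 0) measurable_const ?_
  exact (Complex.measurable_sinh.comp (measurable_id.mul_const _)).div measurable_id

theorem measurable_oscSin (t : ℝ) : Measurable fun q : ℝ × ℝ => oscSin q.1 q.2 t := by
  unfold oscSin
  exact (by fun_prop : Measurable fun q : ℝ × ℝ => Complex.exp (-((q.1 : ℂ) / 2) * t)).mul
    ((measurable_sinhc t).comp measurable_oscRoot)

theorem measurable_oscSinDeriv (t : ℝ) : Measurable fun q : ℝ × ℝ => oscSinDeriv q.1 q.2 t := by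
  unfold oscSinDeriv
  refine (by fun_prop : Measurable fun q : ℝ × ℝ => Complex.exp (-((q.1 : ℂ) / 2) * t)).mul
    (Measurable.sub ?_ (Measurable.mul (by fun_prop) ((measurable_sinhc t).comp measurable_oscRoot)))
  exact Complex.measurable_cosh.comp (measurable_oscRoot.mul_const _)

theorem measurable_oscCos (t : ℝ) : Measurable fun q : ℝ × ℝ => oscCos q.1 q.2 t := by
  unfold oscCos
  exact (measurable_oscSinDeriv t).add
    (Measurable.mul (by fun_prop) (measurable_oscSin t))

/-- The factorisation `(∂ₜ - λ₊) K = exp (λ₋ t)`, for `K` the fundamental solution. -/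
theorem oscSinDeriv_eq (a b t : ℝ) : oscSinDeriv a b t =
    (-(a / 2) + oscRoot a b) * oscSin a b t + Complex.exp (-(a / 2 + oscRoot a b) * t) := by
  have h1 := Complex.cosh_sub_sinh (oscRoot a b * t)
  rw [← mul_sinhc] at h1
  have h2 : Complex.exp (-(a / 2 + oscRoot a b) * t)
      = Complex.exp (-(a / 2) * t) * Complex.exp (-(oscRoot a b * t)) := by
    rw [← Complex.exp_add]; ring_nf
  rw [h2, ← h1]
  unfold oscSinDeriv oscSin
  ring

/-! ### Exponential decay of the oscillator kernels -/

theorem slow_root_mul (a b : ℝ) :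
    (-((a : ℂ) / 2) + oscRoot a b) * (a / 2 + oscRoot a b) = -b := by
  have := oscRoot_sq a b
  push_cast at this
  linear_combination this

theorem half_le_norm_fast_root (a b : ℝ) :
    a / 2 ≤ ‖(a : ℂ) / 2 + oscRoot a b‖ := by
  refine le_trans ?_ (Complex.re_le_norm _)
  have : ((a : ℂ) / 2 + oscRoot a b).re = a / 2 + (oscRoot a b).re := by
    rw [Complex.add_re, show (a : ℂ) / 2 = ((a / 2 : ℝ) : ℂ) by push_cast; rfl, Complex.ofReal_re]
  rw [this]
  linarith [oscRoot_re_nonneg a b]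

/-- The product of the roots has modulus `b` and the fast one has modulus at least `a / 2`; no
expansion of the square root is needed, and real and complex roots are treated alike. -/
theorem norm_slow_root_le {a b : ℝ} (ha : 0 < a) (hb : 0 < b) :
    ‖-((a : ℂ) / 2) + oscRoot a b‖ ≤ 2 * b / a := by
  have h := congrArg norm (slow_root_mul a b)
  rw [norm_mul, norm_neg, Complex.norm_real, Real.norm_of_nonneg hb.le] at h
  rw [le_div_iff₀ ha]
  nlinarith [mul_le_mul_of_nonneg_left (half_le_norm_fast_root a b)
    (norm_nonneg (-((a : ℂ) / 2) + oscRoot a b))]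

theorem norm_exp_half_le {a b t : ℝ} (ha : 0 < a) (hb : 0 < b) (hab : b ≤ a ^ 2) (ht : 0 ≤ t) :
    ‖Complex.exp (-(a / 2) * t)‖ * Real.exp ((oscRoot a b).re * t)
      ≤ Real.exp (-(b / (2 * a) * t)) := by
  have : (-((a : ℂ) / 2) * t).re = -(a / 2) * t := by
    rw [show -((a : ℂ) / 2) * t = ((-(a / 2) * t : ℝ) : ℂ) by push_cast; ring, Complex.ofReal_re]
  rw [Complex.norm_exp, this, ← Real.exp_add, Real.exp_le_exp]
  nlinarith [mul_le_mul_of_nonneg_right (oscRoot_re_le ha hb hab) ht]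

theorem norm_oscSin_le {a b t : ℝ} (ha : 0 < a) (hb : 0 < b) (hab : b ≤ a ^ 2) (ht : 0 ≤ t) :
    ‖oscSin a b t‖ ≤ t * Real.exp (-(b / (2 * a) * t)) := by
  rw [oscSin, norm_mul]
  calc _ ≤ ‖Complex.exp (-(a / 2) * t)‖ * (t * Real.exp ((oscRoot a b).re * t)) := by
        gcongr; exact norm_sinhc_le (oscRoot_re_nonneg a b) ht
    _ = t * (‖Complex.exp (-(a / 2) * t)‖ * Real.exp ((oscRoot a b).re * t)) := by ring
    _ ≤ _ := by gcongr; exact norm_exp_half_le ha hb hab ht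

theorem norm_oscSin_le_self {a b t : ℝ} (ha : 0 < a) (hb : 0 < b) (hab : b ≤ a ^ 2)
    (ht : 0 ≤ t) : ‖oscSin a b t‖ ≤ t := by
  refine (norm_oscSin_le ha hb hab ht).trans (mul_le_of_le_one_right ht ?_)
  rw [Real.exp_le_one_iff]
  have : 0 ≤ b / (2 * a) * t := by positivity
  linarith

theorem mul_exp_neg_two_mul_le (x : ℝ) : x * Real.exp (-(2 * x)) ≤ Real.exp (-x) := by
  rw [show -(2 * x) = -x + -x by ring, Real.exp_add, ← mul_assoc]
  refine mul_le_of_le_one_left (Real.exp_pos _).le ?_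
  have := Real.add_one_le_exp x
  rw [Real.exp_neg]
  rw [mul_inv_le_iff₀ (Real.exp_pos _)]
  linarith

/-- Away from the double root, `16 b ≤ 3 a²` forces `|μ| ≥ a / 4`, and one may divide by `μ`.
Otherwise `a` and `b / a` are comparable, and half of the exponential decay absorbs the factor `a t`
that comes from `|K| ≤ t exp (-b t / (2a))`. -/
theorem mul_norm_oscSin_le {a b t : ℝ} (ha : 0 < a) (hb : 0 < b) (hab : b ≤ a ^ 2)
    (ht : 0 ≤ t) : a * ‖oscSin a b t‖ ≤ 22 * Real.exp (-(b * t / (4 * a))) := by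
  by_cases h : 16 * b ≤ 3 * a ^ 2
  · have hμ : a / 4 ≤ ‖oscRoot a b‖ := by
      have := congrArg norm (oscRoot_sq a b)
      rw [norm_pow, Complex.norm_real] at this
      have h2 := Real.le_norm_self (a ^ 2 / 4 - b)
      rw [← this] at h2
      refine le_of_sq_le_sq ?_ (norm_nonneg _)
      nlinarith
    have hS : ‖oscRoot a b‖ * ‖oscSin a b t‖ ≤ Real.exp (-(b / (2 * a) * t)) := by
      rw [← norm_mul, oscSin, mul_left_comm, mul_sinhc, norm_mul]
      refine le_trans ?_ (norm_exp_half_le ha hb hab ht)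
      gcongr
      exact norm_sinh_le (oscRoot_re_nonneg a b) ht
    have hE : Real.exp (-(b / (2 * a) * t)) ≤ Real.exp (-(b * t / (4 * a))) := by
      rw [Real.exp_le_exp, show b / (2 * a) * t = 2 * (b * t / (4 * a)) by field_simp; ring]
      have : 0 ≤ b * t / (4 * a) := by positivity
      linarith
    have := mul_le_mul_of_nonneg_right hμ (norm_nonneg (oscSin a b t))
    linarith [Real.exp_pos (-(b * t / (4 * a)))]
  · push Not at h
    have h1 := norm_oscSin_le ha hb hab ht
    have h2 := mul_exp_neg_two_mul_le (b * t / (4 * a))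
    rw [show b / (2 * a) * t = 2 * (b * t / (4 * a)) by field_simp; ring] at h1
    -- From `3 a² < 16 b` one gets `a t ≤ (64/3) (b t / (4a))`, and `64/3 < 22`.
    have h3 : a * t ≤ 22 * (b * t / (4 * a)) := by
      rw [show 22 * (b * t / (4 * a)) = (22 / 4 * b / a) * t by field_simp]
      gcongr
      rw [le_div_iff₀ ha]; nlinarith
    calc a * ‖oscSin a b t‖ ≤ a * (t * Real.exp (-(2 * (b * t / (4 * a))))) := by gcongr
      _ = (a * t) * Real.exp (-(2 * (b * t / (4 * a)))) := by ring
      _ ≤ (22 * (b * t / (4 * a))) * Real.exp (-(2 * (b * t / (4 * a)))) := by gcongr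
      _ = 22 * ((b * t / (4 * a)) * Real.exp (-(2 * (b * t / (4 * a))))) := by ring
      _ ≤ _ := by gcongr

theorem norm_exp_fast_root_le {a b t : ℝ} (ht : 0 ≤ t) :
    ‖Complex.exp (-(a / 2 + oscRoot a b) * t)‖ ≤ Real.exp (-(a * t / 2)) := by
  rw [Complex.norm_exp, Real.exp_le_exp, Complex.re_mul_ofReal, Complex.neg_re, Complex.add_re,
    show (a : ℂ) / 2 = ((a / 2 : ℝ) : ℂ) by push_cast; rfl, Complex.ofReal_re]
  nlinarith [mul_nonneg (oscRoot_re_nonneg a b) ht]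

theorem norm_oscSinDeriv_le_add {a b t : ℝ} (ha : 0 < a) (hb : 0 < b) (ht : 0 ≤ t) :
    ‖oscSinDeriv a b t‖ ≤ 2 * b / a * ‖oscSin a b t‖ + Real.exp (-(a * t / 2)) := by
  rw [oscSinDeriv_eq]
  refine (norm_add_le _ _).trans (add_le_add ?_ (norm_exp_fast_root_le ht))
  rw [norm_mul]
  gcongr
  exact norm_slow_root_le ha hb

theorem norm_oscSinDeriv_le {a b t : ℝ} (ha : 0 < a) (hb : 0 < b) (hab : b ≤ a ^ 2)
    (ht : 0 ≤ t) : ‖oscSinDeriv a b t‖ ≤ 45 * Real.exp (-(b * t / (4 * a))) := by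
  have h1 := norm_oscSinDeriv_le_add ha hb ht
  have h2 := mul_norm_oscSin_le ha hb hab ht
  have h3 : 2 * b / a ≤ 2 * a := by rw [div_le_iff₀ ha]; nlinarith
  have h4 : Real.exp (-(a * t / 2)) ≤ Real.exp (-(b * t / (4 * a))) := by
    rw [Real.exp_le_exp, neg_le_neg_iff, div_le_iff₀ (by positivity)]
    nlinarith [mul_le_mul_of_nonneg_right hab ht, mul_nonneg hb.le ht]
  have h5 := mul_le_mul_of_nonneg_right h3 (norm_nonneg (oscSin a b t))
  linarith

/-- In `K' = λ₊ K + exp (λ₋ t)` the factor `t |λ₊| ≤ 2 b t / a` is absorbed by half of the decay of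
`a K`, which is why the exponent drops from `1/4` to `1/8`; the fast exponential absorbs `a t` by
itself. The constant is `16 · 22 + 4`. -/
theorem mul_mul_norm_oscSinDeriv_le {a b t : ℝ} (ha : 0 < a) (hb : 0 < b) (hab : b ≤ a ^ 2)
    (ht : 0 ≤ t) : a * (t * ‖oscSinDeriv a b t‖) ≤ 356 * Real.exp (-(b * t / (8 * a))) := by
  have h1 := norm_oscSinDeriv_le_add ha hb ht
  have h2 := mul_norm_oscSin_le ha hb hab ht
  have h3 := mul_exp_neg_two_mul_le (b * t / (8 * a))
  have h4 := mul_exp_neg_two_mul_le (a * t / 4)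
  rw [show 2 * (b * t / (8 * a)) = b * t / (4 * a) by field_simp; ring] at h3
  rw [show 2 * (a * t / 4) = a * t / 2 by ring] at h4
  have h5 : Real.exp (-(a * t / 4)) ≤ Real.exp (-(b * t / (8 * a))) := by
    rw [Real.exp_le_exp, neg_le_neg_iff, div_le_iff₀ (by positivity)]
    nlinarith [mul_le_mul_of_nonneg_right hab ht, mul_nonneg hb.le ht]
  calc a * (t * ‖oscSinDeriv a b t‖)
      ≤ a * (t * (2 * b / a * ‖oscSin a b t‖ + Real.exp (-(a * t / 2)))) := by gcongr
    _ = 16 * (b * t / (8 * a)) * (a * ‖oscSin a b t‖)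
        + 4 * (a * t / 4 * Real.exp (-(a * t / 2))) := by field_simp; ring
    _ ≤ 16 * (b * t / (8 * a)) * (22 * Real.exp (-(b * t / (4 * a))))
        + 4 * Real.exp (-(a * t / 4)) := by gcongr
    _ = 352 * ((b * t / (8 * a)) * Real.exp (-(b * t / (4 * a))))
        + 4 * Real.exp (-(a * t / 4)) := by ring
    _ ≤ _ := by linarith

theorem norm_oscCos_le {a b t : ℝ} (ha : 0 < a) (hb : 0 < b) (hab : b ≤ a ^ 2)
    (ht : 0 ≤ t) : ‖oscCos a b t‖ ≤ 67 * Real.exp (-(b * t / (4 * a))) := by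
  rw [oscCos]
  refine (norm_add_le _ _).trans ?_
  rw [norm_mul, Complex.norm_real, Real.norm_of_nonneg ha.le]
  linarith [mul_norm_oscSin_le ha hb hab ht, norm_oscSinDeriv_le ha hb hab ht]

theorem mul_norm_oscCosDeriv_le {a b t : ℝ} (ha : 0 < a) (hb : 0 < b) (hab : b ≤ a ^ 2)
    (ht : 0 ≤ t) : t * (b * ‖oscSin a b t‖) ≤ 176 * Real.exp (-(b * t / (8 * a))) := by
  have h2 := mul_norm_oscSin_le ha hb hab ht
  have h3 := mul_exp_neg_two_mul_le (b * t / (8 * a))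
  rw [show 2 * (b * t / (8 * a)) = b * t / (4 * a) by field_simp; ring] at h3
  calc t * (b * ‖oscSin a b t‖) = 8 * (b * t / (8 * a)) * (a * ‖oscSin a b t‖) := by
        field_simp
    _ ≤ 8 * (b * t / (8 * a)) * (22 * Real.exp (-(b * t / (4 * a)))) := by gcongr
    _ = 176 * ((b * t / (8 * a)) * Real.exp (-(b * t / (4 * a)))) := by ring
    _ ≤ _ := by linarith

/-! ### Limits of the kernels in the overdamped regime `b / a² → 0` -/

section Limits

variable {ι : Type*} {l : Filter ι} {a b t : ι → ℝ} {x : ℝ}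

/-- The distance of `μ / a` from `1 / 2` is the modulus of the slow root over `a`, at most `2 b /
a²`. -/
theorem tendsto_oscRoot_div (ha : ∀ᶠ i in l, 0 < a i) (hb : ∀ᶠ i in l, 0 < b i)
    (hba : Tendsto (fun i => b i / a i ^ 2) l (𝓝 0)) :
    Tendsto (fun i => oscRoot (a i) (b i) / a i) l (𝓝 (1 / 2)) := by
  rw [tendsto_iff_norm_sub_tendsto_zero]
  refine squeeze_zero' (Eventually.of_forall fun _ => norm_nonneg _) ?_
    (by simpa using hba.const_mul 2)
  filter_upwards [ha, hb] with i ha hb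
  have hac : (a i : ℂ) ≠ 0 := by exact_mod_cast ha.ne'
  have h := norm_slow_root_le ha hb
  have : oscRoot (a i) (b i) / a i - 1 / 2 = (-((a i : ℂ) / 2) + oscRoot (a i) (b i)) / a i := by
    field_simp; ring
  rw [this, norm_div, Complex.norm_real, Real.norm_of_nonneg ha.le, div_le_iff₀ ha]
  calc _ ≤ _ := h
    _ = _ := by field_simp

/-- By the product of the roots, the slow root times `t` equals `-(t b / a) / (1/2 + μ/a)`, and the
denominator tends to `1`. -/
theorem tendsto_slow_root_mul (ha : ∀ᶠ i in l, 0 < a i) (hb : ∀ᶠ i in l, 0 < b i)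
    (hba : Tendsto (fun i => b i / a i ^ 2) l (𝓝 0))
    (hx : Tendsto (fun i => t i * b i / a i) l (𝓝 x)) :
    Tendsto (fun i => (-((a i : ℂ) / 2) + oscRoot (a i) (b i)) * t i) l (𝓝 (-x)) := by
  have h1 := (tendsto_oscRoot_div ha hb hba).const_add (1 / 2)
  have h2 : Tendsto (fun i => ((t i * b i / a i : ℝ) : ℂ)) l (𝓝 (x : ℂ)) :=
    (Complex.continuous_ofReal.tendsto x).comp hx
  have h3 := (h2.div h1 (by norm_num)).neg
  have : -((x : ℂ) / (1 / 2 + 1 / 2)) = -x := by norm_num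
  rw [this] at h3
  refine h3.congr' ?_
  filter_upwards [ha] with i ha
  have hac : (a i : ℂ) ≠ 0 := by exact_mod_cast ha.ne'
  have h := slow_root_mul (a i) (b i)
  have hne : (a i : ℂ) / 2 + oscRoot (a i) (b i) ≠ 0 := by
    have := half_le_norm_fast_root (a i) (b i)
    intro h0; rw [h0, norm_zero] at this; linarith
  have h5 : (1 : ℂ) / 2 + oscRoot (a i) (b i) / a i
      = ((a i : ℂ) / 2 + oscRoot (a i) (b i)) / a i := by field_simp
  simp only [Pi.div_apply]
  rw [h5]
  push_cast
  rw [div_div_div_cancel_right₀ hac, neg_eq_iff_eq_neg, div_eq_iff hne]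
  linear_combination (t i : ℂ) * h

/-- Write `a K = (exp (λ₊ t) - exp (λ₋ t)) / (2 μ / a)`: the slow exponential converges, the fast
one dies since `a t → ∞`, and the denominator tends to `1`. -/
theorem tendsto_mul_oscSin (ha : ∀ᶠ i in l, 0 < a i) (hb : ∀ᶠ i in l, 0 < b i)
    (ht : ∀ᶠ i in l, 0 ≤ t i)
    (hba : Tendsto (fun i => b i / a i ^ 2) l (𝓝 0))
    (hx : Tendsto (fun i => t i * b i / a i) l (𝓝 x))
    (hat : Tendsto (fun i => a i * t i) l atTop) :
    Tendsto (fun i => (a i : ℂ) * oscSin (a i) (b i) (t i)) l (𝓝 (Real.exp (-x) : ℝ)) := by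
  have hμ := tendsto_oscRoot_div ha hb hba
  have h1 : Tendsto (fun i => Complex.exp ((-((a i : ℂ) / 2) + oscRoot (a i) (b i)) * t i)) l
      (𝓝 (Complex.exp (-x))) :=
    (Complex.continuous_exp.tendsto _).comp (tendsto_slow_root_mul ha hb hba hx)
  have h2 : Tendsto (fun i => Complex.exp (-(a i / 2 + oscRoot (a i) (b i)) * t i)) l (𝓝 0) := by
    refine squeeze_zero_norm' (ht.mono fun i h => norm_exp_fast_root_le h) ?_
    exact Real.tendsto_exp_neg_atTop_nhds_zero.comp (hat.atTop_div_const two_pos)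
  have h3 := (h1.sub h2).div (hμ.const_mul 2) (by norm_num)
  have h4 : (Complex.exp (-x) - 0) / (2 * (1 / 2)) = ((Real.exp (-x) : ℝ) : ℂ) := by
    push_cast; ring
  rw [h4] at h3
  have hne : ∀ᶠ i in l, oscRoot (a i) (b i) / a i ≠ 0 :=
    hμ.eventually_ne (by norm_num)
  refine h3.congr' ?_
  filter_upwards [ha, hne] with i ha hne
  have hac : (a i : ℂ) ≠ 0 := by exact_mod_cast ha.ne'
  have hμ0 : oscRoot (a i) (b i) ≠ 0 := fun h => hne (by simp [h])
  have hs := mul_sinhc (oscRoot (a i) (b i)) (t i)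
  have e1 : Complex.exp ((-((a i : ℂ) / 2) + oscRoot (a i) (b i)) * t i)
    = Complex.exp (-(a i / 2) * t i) * Complex.exp (oscRoot (a i) (b i) * t i) := by
    rw [← Complex.exp_add]; ring_nf
  have e2 : Complex.exp (-(a i / 2 + oscRoot (a i) (b i)) * t i)
    = Complex.exp (-(a i / 2) * t i) * Complex.exp (-(oscRoot (a i) (b i) * t i)) := by
    rw [← Complex.exp_add]; ring_nf
  rw [Complex.sinh] at hs
  simp only [Pi.div_apply]
  rw [e1, e2, oscSin, div_eq_iff (mul_ne_zero two_ne_zero hne)]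
  rw [show (a i : ℂ) * (Complex.exp (-(a i / 2) * t i) * sinhc (oscRoot (a i) (b i)) (t i)) *
    (2 * (oscRoot (a i) (b i) / a i)) = Complex.exp (-(a i / 2) * t i) *
      (sinhc (oscRoot (a i) (b i)) (t i)) * (2 * oscRoot (a i) (b i)) by field_simp]
  linear_combination (-2) * Complex.exp (-(a i / 2) * t i) * hs

/-- Multiplying `K' = λ₊ K + exp (λ₋ t)` by `a t` gives `(λ₊ t) (a K)` plus a remainder bounded by
`a t exp (-a t / 2)`. -/
theorem tendsto_mul_mul_oscSinDeriv (ha : ∀ᶠ i in l, 0 < a i) (hb : ∀ᶠ i in l, 0 < b i)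
    (ht : ∀ᶠ i in l, 0 ≤ t i)
    (hba : Tendsto (fun i => b i / a i ^ 2) l (𝓝 0))
    (hx : Tendsto (fun i => t i * b i / a i) l (𝓝 x))
    (hat : Tendsto (fun i => a i * t i) l atTop) :
    Tendsto (fun i => (a i : ℂ) * (t i * oscSinDeriv (a i) (b i) (t i))) l
      (𝓝 (-x * Real.exp (-x) : ℝ)) := by
  have h1 := (tendsto_slow_root_mul ha hb hba hx).mul (tendsto_mul_oscSin ha hb ht hba hx hat)
  have h2 : Tendsto (fun i => ((a i * t i : ℝ) : ℂ) *
      Complex.exp (-(a i / 2 + oscRoot (a i) (b i)) * t i)) l (𝓝 0) := by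
    have h5 : Tendsto (fun y : ℝ => y * Real.exp (-(y / 2))) atTop (𝓝 0) := by
      have := Real.tendsto_pow_mul_exp_neg_atTop_nhds_zero 1
      have := ((this.comp (tendsto_id.atTop_div_const (two_pos : (0 : ℝ) < 2))).const_mul 2)
      simp only [mul_zero] at this
      refine this.congr fun y => ?_
      simp only [Function.comp, id]
      ring
    refine squeeze_zero_norm' ?_ (h5.comp hat)
    filter_upwards [ha, ht] with i ha ht
    rw [norm_mul, Complex.norm_real, Real.norm_of_nonneg (by positivity)]
    exact mul_le_mul_of_nonneg_left (norm_exp_fast_root_le ht) (by positivity)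
  have h3 := h1.add h2
  have h4 : -(x : ℂ) * ((Real.exp (-x) : ℝ) : ℂ) + 0 = ((-x * Real.exp (-x) : ℝ) : ℂ) := by
    push_cast; ring
  rw [h4] at h3
  refine h3.congr fun i => ?_
  rw [oscSinDeriv_eq]
  push_cast
  ring

end Limits

/-! ### Curves in `L²` given by pointwise formulas -/

section L2Curves

variable {α : Type*} [MeasurableSpace α] {μ : Measure α}

variable (μ) in
/-- The class in `L²` of a function, `0` if the function is not square integrable. -/
def toL2 (f : α → ℂ) : Lp ℂ 2 μ := by
  classical
  exact if h : MemLp f 2 μ then h.toLp f else 0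

theorem toL2_eq {f : α → ℂ} (h : MemLp f 2 μ) : toL2 μ f = h.toLp f := dif_pos h

theorem coeFn_toL2 {f : α → ℂ} (h : MemLp f 2 μ) : toL2 μ f =ᵐ[μ] f := by
  rw [toL2_eq h]; exact h.coeFn_toLp

theorem toL2_congr_ae {f g : α → ℂ} (h : f =ᵐ[μ] g) : toL2 μ f = toL2 μ g := by
  by_cases hf : MemLp f 2 μ
  · have hg := hf.ae_eq h
    rw [toL2_eq hf, toL2_eq hg, MemLp.toLp_eq_toLp_iff]
    exact h
  · have hg : ¬ MemLp g 2 μ := fun hg => hf (hg.ae_eq h.symm)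
    rw [toL2, toL2, dif_neg hf, dif_neg hg]

theorem toL2_add {f g : α → ℂ} (hf : MemLp f 2 μ) (hg : MemLp g 2 μ) :
    toL2 μ (fun x => f x + g x) = toL2 μ f + toL2 μ g := by
  rw [toL2_eq hf, toL2_eq hg, ← MemLp.toLp_add]; exact toL2_eq (hf.add hg)

theorem toL2_sub {f g : α → ℂ} (hf : MemLp f 2 μ) (hg : MemLp g 2 μ) :
    toL2 μ (fun x => f x - g x) = toL2 μ f - toL2 μ g := by
  rw [toL2_eq hf, toL2_eq hg, ← MemLp.toLp_sub]; exact toL2_eq (hf.sub hg)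

theorem toL2_const_smul {f : α → ℂ} (hf : MemLp f 2 μ) (c : ℝ) :
    toL2 μ (fun x => c • f x) = c • toL2 μ f := by
  rw [toL2_eq hf, ← MemLp.toLp_const_smul]; exact toL2_eq (hf.const_smul c)

theorem norm_toL2_sq {f : α → ℂ} (hf : MemLp f 2 μ) : ‖toL2 μ f‖ ^ 2 = ∫ x, ‖f x‖ ^ 2 ∂μ := by
  rw [toL2_eq hf, Lp.norm_toLp, hf.eLpNorm_eq_integral_rpow_norm two_ne_zero ENNReal.ofNat_ne_top,
    ENNReal.toReal_ofReal (by positivity)]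
  simp only [ENNReal.toReal_ofNat, Real.rpow_ofNat]
  rw [← Real.rpow_natCast, ← Real.rpow_mul (by positivity)]
  norm_num

theorem norm_toL2_le_of_norm_le {f : α → ℂ} {g : Lp ℂ 2 μ} {c : ℝ}
    (hf : AEStronglyMeasurable f μ) (h : ∀ᵐ x ∂μ, ‖f x‖ ≤ c * ‖g x‖) :
    ‖toL2 μ f‖ ≤ c * ‖g‖ := by
  have hm : MemLp f 2 μ := (Lp.memLp g).of_le_mul hf h
  refine Lp.norm_le_mul_norm_of_ae_le_mul ?_
  filter_upwards [h, coeFn_toL2 hm] with x h1 h2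
  rw [h2]; exact h1

/-- Dominated convergence for `|f i - g|²`, with majorant `(2 M)²`. -/
theorem tendsto_toL2 {ι : Type*} {l : Filter ι} [l.IsCountablyGenerated] {f : ι → α → ℂ}
    {g : α → ℂ} {M : α → ℝ} (hM : MemLp M 2 μ) (hf : ∀ i, AEStronglyMeasurable (f i) μ)
    (hg : AEStronglyMeasurable g μ) (hfM : ∀ᶠ i in l, ∀ᵐ x ∂μ, ‖f i x‖ ≤ M x)
    (hgM : ∀ᵐ x ∂μ, ‖g x‖ ≤ M x) (hlim : ∀ᵐ x ∂μ, Tendsto (fun i => f i x) l (𝓝 (g x))) :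
    Tendsto (fun i => toL2 μ (f i)) l (𝓝 (toL2 μ g)) := by
  have hgL : MemLp g 2 μ := hM.mono' hg hgM
  have hint : Tendsto (fun i => ∫ x, ‖f i x - g x‖ ^ 2 ∂μ) l (𝓝 (∫ _, (0 : ℝ) ∂μ)) := by
    refine tendsto_integral_filter_of_dominated_convergence (fun x => (2 * M x) ^ 2) ?_ ?_ ?_ ?_
    · exact Eventually.of_forall fun i => (((hf i).sub hg).norm.pow 2)
    · filter_upwards [hfM] with i hi
      filter_upwards [hi, hgM] with x h1 h2
      rw [Real.norm_of_nonneg (by positivity)]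
      gcongr
      linarith [norm_sub_le (f i x) (g x)]
    · exact (hM.const_mul 2).integrable_sq
    · filter_upwards [hlim] with x hx
      have := (tendsto_iff_norm_sub_tendsto_zero.1 hx).pow 2
      simpa using this
  rw [integral_zero] at hint
  rw [tendsto_iff_norm_sub_tendsto_zero]
  have hsq : Tendsto (fun i => Real.sqrt (∫ x, ‖f i x - g x‖ ^ 2 ∂μ)) l (𝓝 0) := by
    simpa using hint.sqrt
  refine hsq.congr' ?_
  filter_upwards [hfM] with i hi
  have hfL : MemLp (f i) 2 μ := hM.mono' (hf i) hi
  rw [← toL2_sub hfL hgL, ← Real.sqrt_sq (norm_nonneg (toL2 μ _)),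
    norm_toL2_sq (f := fun x => f i x - g x) (hfL.sub hgL)]

/-- By the mean value inequality on the convex set `S`, the bound `M` on the derivatives also
dominates the difference quotients, so dominated convergence applies to them. -/
theorem hasDerivWithinAt_toL2 {m m' : ℝ → α → ℂ} {M : α → ℝ} {S : Set ℝ} (hS : Convex ℝ S)
    {t₀ : ℝ} (ht₀ : t₀ ∈ S) (hM : MemLp M 2 μ) (hm : ∀ t ∈ S, MemLp (m t) 2 μ)
    (hm' : AEStronglyMeasurable (m' t₀) μ)
    (hderiv : ∀ᵐ x ∂μ, ∀ t ∈ S,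
      HasDerivWithinAt (fun t => m t x) (m' t x) S t ∧ ‖m' t x‖ ≤ M x) :
    HasDerivWithinAt (fun t => toL2 μ (m t)) (toL2 μ (m' t₀)) S t₀ := by
  classical
  rw [hasDerivWithinAt_iff_tendsto_slope]
  -- The slope is replaced by `0` outside `S` because `tendsto_toL2` asks for measurability at every
  -- index, not only eventually.
  have key : Tendsto (fun t => toL2 μ (if t ∈ S then fun x => slope (fun t => m t x) t₀ t else 0))
      (𝓝[S \ {t₀}] t₀) (𝓝 (toL2 μ (m' t₀))) := by
    have hin : ∀ᶠ t in 𝓝[S \ {t₀}] t₀, t ∈ S :=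
      eventually_mem_nhdsWithin.mono fun t ht => ht.1
    refine tendsto_toL2 hM (fun t => ?_) hm' ?_ (hderiv.mono fun x hx => (hx t₀ ht₀).2) ?_
    · by_cases ht : t ∈ S
      · simp only [ht, if_true, slope_def_module]
        exact ((hm t ht).1.sub (hm t₀ ht₀).1).const_smul _
      · simp only [ht, if_false]
        exact aestronglyMeasurable_const
    · filter_upwards [hin] with t ht
      filter_upwards [hderiv] with x hx
      simp only [ht, if_true, slope_def_module, norm_smul, norm_inv]
      have hM0 : 0 ≤ M x := (norm_nonneg _).trans (hx t₀ ht₀).2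
      have := hS.norm_image_sub_le_of_norm_hasDerivWithin_le (f := fun t => m t x)
        (fun t ht => (hx t ht).1) (fun t ht => (hx t ht).2) ht₀ ht
      exact inv_mul_le_of_le_mul₀ (norm_nonneg _) hM0 (by rwa [mul_comm])
    · filter_upwards [hderiv] with x hx
      have := hasDerivWithinAt_iff_tendsto_slope.1 (hx t₀ ht₀).1
      refine this.congr' ?_
      filter_upwards [hin] with t ht
      simp [ht]
  refine key.congr' ?_
  filter_upwards [eventually_mem_nhdsWithin] with t ht
  simp only [ht.1, if_true, slope_def_module]
  rw [← toL2_sub (hm t ht.1) (hm t₀ ht₀)]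
  exact toL2_const_smul ((hm t ht.1).sub (hm t₀ ht₀)) _

/-- Multiplication by an essentially bounded function, as an operator in `L²`. -/
def mulL2 {g : α → ℂ} (hg : MemLp g ∞ μ) : Lp ℂ 2 μ →L[ℂ] Lp ℂ 2 μ :=
  (ContinuousLinearMap.mul ℂ ℂ).holderL μ ∞ 2 2 (hg.toLp g)

theorem coeFn_mulL2 {g : α → ℂ} (hg : MemLp g ∞ μ) (f : Lp ℂ 2 μ) :
    mulL2 hg f =ᵐ[μ] fun x => g x * f x := by
  filter_upwards [(ContinuousLinearMap.mul ℂ ℂ).coeFn_holder (r := 2) (hg.toLp g) f,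
    hg.coeFn_toLp] with x h1 h2
  rw [show mulL2 hg f = (ContinuousLinearMap.mul ℂ ℂ).holder 2 (hg.toLp g) f from rfl, h1, h2]
  rfl

end L2Curves

/-! ### A linear second order equation in integrated form -/

section Integrated

variable {H : Type*} [NormedAddCommGroup H]

/-- If `y' = v` and `(v + ⟨p, U⟩)' = -⟨q, U⟩` on `[0, ∞)`, where `y = ⟨ψ, U⟩`, then `⟨ψ, U⟩` is
given by an integrated formula. -/
theorem inner_eq_of_weak [InnerProductSpace ℂ H] [CompleteSpace H] {U : ℝ → H}
    (hU : Continuous U) {ψ p q U₁ : H} {v : ℝ → ℂ} (hv0 : v 0 = inner ℂ ψ U₁)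
    (hv : ∀ t ∈ Ici (0 : ℝ), HasDerivWithinAt (fun τ => inner ℂ ψ (U τ)) (v t) (Ici 0) t)
    (hw : ∀ t ∈ Ici (0 : ℝ), HasDerivWithinAt (fun τ => v τ + inner ℂ p (U τ))
      (-inner ℂ q (U t)) (Ici 0) t) {t : ℝ} (ht : 0 ≤ t) :
    inner ℂ ψ (U t - U 0 - t • U₁) = inner ℂ p (t • U 0 - ∫ τ in (0 : ℝ)..t, U τ)
      - inner ℂ q (∫ τ in (0 : ℝ)..t, ∫ τ' in (0 : ℝ)..τ, U τ') := by
  set F : ℝ → H := fun t => ∫ τ in (0 : ℝ)..t, U τ with hF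
  have hFd : ∀ t, HasDerivAt F (U t) t := fun t => hU.integral_hasStrictDerivAt 0 t |>.hasDerivAt
  have hFc : Continuous F := continuous_iff_continuousAt.2 fun t => (hFd t).continuousAt
  set FF : ℝ → H := fun t => ∫ τ in (0 : ℝ)..t, F τ with hFF
  have hFFd : ∀ t, HasDerivAt FF (F t) t :=
    fun t => hFc.integral_hasStrictDerivAt 0 t |>.hasDerivAt
  have hin : ∀ (w : H) {G : ℝ → H} {G' : H} {t : ℝ}, HasDerivAt G G' t →
      HasDerivWithinAt (fun t => (inner ℂ w (G t) : ℂ)) (inner ℂ w G') (Ici 0) t :=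
    fun w G G' t h => (((innerSL ℂ w).restrictScalars ℝ).hasFDerivAt.comp_hasDerivAt t h).hasDerivWithinAt
  have hsm : ∀ (w : H) (t : ℝ), HasDerivAt (fun t : ℝ => t • w) w t := fun w t => by
    simpa using (hasDerivAt_id t).smul_const w
  have hconst : ∀ (f : ℝ → ℂ), (∀ t ∈ Ici (0 : ℝ), HasDerivWithinAt f 0 (Ici 0) t) →
      ∀ t, 0 ≤ t → f t = f 0 := by
    intro f hf t ht
    refine constant_of_has_deriv_right_zero (f := f) (a := 0) (b := t)
      (fun x hx => ((hf x hx.1).continuousWithinAt).mono Icc_subset_Ici_self)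
      (fun x hx => (hf x hx.1).mono (Ici_subset_Ici.2 hx.1)) t (right_mem_Icc.2 ht)
  -- First time integration: this quantity has zero derivative. The next one integrates the
  -- resulting formula for `v` once more.
  have h1 : ∀ t, 0 ≤ t → v t + inner ℂ p (U t) + inner ℂ q (F t)
      = inner ℂ ψ U₁ + inner ℂ p (U 0) := by
    intro t ht
    have := hconst (fun t => v t + inner ℂ p (U t) + inner ℂ q (F t)) (fun t ht => by
      refine ((hw t ht).add (hin q (hFd t))).congr_deriv ?_
      simp) t ht
    rw [this, hv0, hF]
    simp
  have h2 := hconst (fun t => inner ℂ ψ (U t) - inner ℂ ψ (t • U₁) - inner ℂ p (t • U 0)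
      + inner ℂ p (F t) + inner ℂ q (FF t)) (fun t ht => by
    refine (((((hv t ht).sub (hin ψ (hsm U₁ t))).sub (hin p (hsm (U 0) t))).add
      (hin p (hFd t))).add (hin q (hFFd t))).congr_deriv ?_
    linear_combination h1 t ht) t ht
  have hF0 : F 0 = 0 := by simp [hF]
  have hFF0 : FF 0 = 0 := by simp [hFF]
  rw [hF0, hFF0] at h2
  simp only [zero_smul, inner_zero_right] at h2
  rw [inner_sub_right, inner_sub_right, inner_sub_right]
  linear_combination h2

/-- Uniqueness for `g(t) = g₀ + t g₁ + A (t g₀ - ∫ U) - B ∬ U`, where `A U = A g` and `B U = B g`: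
such a `g` is the first component of the solution of a linear system. -/
theorem eq_of_integrated [NormedSpace ℝ H] [CompleteSpace H] {A B : H →L[ℝ] H} {U g k p : ℝ → H}
    (hU : Continuous U) {g₀ g₁ : H}
    (hg : ∀ t, 0 ≤ t → g t = g₀ + t • g₁ + A (t • g₀ - ∫ τ in (0 : ℝ)..t, U τ)
      - B (∫ τ in (0 : ℝ)..t, ∫ τ' in (0 : ℝ)..τ, U τ'))
    (hA : ∀ t, 0 ≤ t → A (U t) = A (g t)) (hB : ∀ t, 0 ≤ t → B (U t) = B (g t))
    (hk : ∀ t ∈ Ici (0 : ℝ), HasDerivWithinAt k (p t - A (k t)) (Ici 0) t)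
    (hp : ∀ t ∈ Ici (0 : ℝ), HasDerivWithinAt p (-B (k t)) (Ici 0) t)
    (hk0 : k 0 = g₀) (hp0 : p 0 = g₁ + A g₀) {t : ℝ} (ht : 0 ≤ t) : g t = k t := by
  set F : ℝ → H := fun t => ∫ τ in (0 : ℝ)..t, U τ with hF
  have hFd : ∀ t, HasDerivAt F (U t) t := fun t => hU.integral_hasStrictDerivAt 0 t |>.hasDerivAt
  have hFc : Continuous F := continuous_iff_continuousAt.2 fun t => (hFd t).continuousAt
  set FF : ℝ → H := fun t => ∫ τ in (0 : ℝ)..t, F τ with hFF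
  have hFFd : ∀ t, HasDerivAt FF (F t) t :=
    fun t => hFc.integral_hasStrictDerivAt 0 t |>.hasDerivAt
  have hsm : ∀ (w : H) (t : ℝ), HasDerivAt (fun t : ℝ => t • w) w t := fun w t => by
    simpa using (hasDerivAt_id t).smul_const w
  set G : ℝ → H := fun t => g₀ + t • g₁ + A (t • g₀ - F t) - B (FF t) with hG
  -- With this momentum the integrated equation becomes the first order system `G' = P - A G`, `P' =
  -- -B G`, once `A U` and `B U` are replaced by `A G` and `B G`.
  set P : ℝ → H := fun t => g₁ + A g₀ - B (F t) with hP
  have hGg : ∀ t, 0 ≤ t → g t = G t := hg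
  have hGd : ∀ t, HasDerivAt G (g₁ + A (g₀ - U t) - B (F t)) t := fun t => by
    have := ((((hsm g₁ t).const_add g₀)).add (A.hasFDerivAt.comp_hasDerivAt t
      ((hsm g₀ t).sub (hFd t)))).sub (B.hasFDerivAt.comp_hasDerivAt t (hFFd t))
    exact this
  have hPd : ∀ t, HasDerivAt P (-B (U t)) t := fun t => by
    have := ((B.hasFDerivAt.comp_hasDerivAt t (hFd t))).const_sub (g₁ + A g₀)
    exact this
  let L : H × H →L[ℝ] H × H :=
    ((ContinuousLinearMap.snd ℝ H H) - A.comp (ContinuousLinearMap.fst ℝ H H)).prod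
      (-(B.comp (ContinuousLinearMap.fst ℝ H H)))
  have hL : ∀ z : H × H, L z = (z.2 - A z.1, -B z.1) := fun z => rfl
  have hsol : EqOn (fun t => (G t, P t)) (fun t => (k t, p t)) (Icc 0 t) := by
    refine ODE_solution_unique (v := fun _ z => L z) (K := ‖L‖₊) (fun _ => L.lipschitz) ?_ ?_ ?_ ?_ ?_
    · exact fun x _ => ((hGd x).continuousAt.prodMk (hPd x).continuousAt).continuousWithinAt
    · intro x hx
      have h1 : A (U x) = A (G x) := by rw [hA x hx.1, hGg x hx.1]
      have h2 : B (U x) = B (G x) := by rw [hB x hx.1, hGg x hx.1]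
      refine ((hGd x).prodMk (hPd x)).hasDerivWithinAt.congr_deriv ?_
      rw [hL]
      simp only [map_sub, h1, h2, hP]
      congr 1
      abel
    · exact fun x hx => ((hk x hx.1).continuousWithinAt.prodMk
        (hp x hx.1).continuousWithinAt).mono Icc_subset_Ici_self
    · intro x hx
      exact ((hk x hx.1).prodMk (hp x hx.1)).mono (Ici_subset_Ici.2 hx.1)
    · simp [hG, hP, hF, hFF, hk0, hp0]
  rw [hGg t ht]
  exact congrArg Prod.fst (hsol (right_mem_Icc.2 ht))

end Integrated

/-! ### The equation on the Fourier side -/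

section FourierSide

variable {n : ℕ}

/-- The frequency `|ξ|`, where `ξ = 2π η`. -/
def rad (η : EuclideanSpace ℝ (Fin n)) : ℝ := ‖(2 * Real.pi) • η‖

theorem rad_nonneg (η : EuclideanSpace ℝ (Fin n)) : 0 ≤ rad η := norm_nonneg _

theorem rad_eq (η : EuclideanSpace ℝ (Fin n)) : rad η = 2 * Real.pi * ‖η‖ := by
  rw [rad, norm_smul, Real.norm_of_nonneg Real.two_pi_pos.le]

theorem rad_smul {c : ℝ} (hc : 0 ≤ c) (η : EuclideanSpace ℝ (Fin n)) :
    rad (c • η) = c * rad η := by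
  rw [rad_eq, rad_eq, norm_smul, Real.norm_of_nonneg hc]; ring

theorem rad_pos {η : EuclideanSpace ℝ (Fin n)} (h : η ≠ 0) : 0 < rad η := by
  rw [rad_eq]; have := norm_pos_iff.2 h; have := Real.pi_pos; positivity

@[fun_prop]
theorem continuous_rad : Continuous (rad (n := n)) := by unfold rad; fun_prop

@[fun_prop]
theorem measurable_rad : Measurable (rad (n := n)) := continuous_rad.measurable

theorem ae_ne_zero (hn : 0 < n) : ∀ᵐ η : EuclideanSpace ℝ (Fin n), η ≠ 0 := by
  have : Nonempty (Fin n) := ⟨⟨0, hn⟩⟩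
  have : Nontrivial (EuclideanSpace ℝ (Fin n)) := inferInstance
  exact Measure.ae_ne volume 0

/-- The symbol `|ξ|^(2δ₁) + |ξ|^(2δ₂)` of the damping. -/
def dampingSymbol (δ₁ δ₂ : ℝ) (η : EuclideanSpace ℝ (Fin n)) : ℝ :=
  rad η ^ (2 * δ₁) + rad η ^ (2 * δ₂)

/-- The symbol `|ξ|^(2σ)` of the elastic term. -/
def elasticSymbol (σ : ℝ) (η : EuclideanSpace ℝ (Fin n)) : ℝ := rad η ^ (2 * σ)

theorem continuous_dampingSymbol {δ₁ δ₂ : ℝ} (h₁ : 0 < δ₁) (h₂ : 0 < δ₂) :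
    Continuous (dampingSymbol (n := n) δ₁ δ₂) := by
  unfold dampingSymbol
  exact (continuous_rad.rpow_const fun _ => Or.inr (by positivity)).add
    (continuous_rad.rpow_const fun _ => Or.inr (by positivity))

theorem continuous_elasticSymbol {σ : ℝ} (h : 0 < σ) :
    Continuous (elasticSymbol (n := n) σ) := by
  unfold elasticSymbol
  exact continuous_rad.rpow_const fun _ => Or.inr (by positivity)

theorem dampingSymbol_pos (δ₁ δ₂ : ℝ) {η : EuclideanSpace ℝ (Fin n)} (h : η ≠ 0) :
    0 < dampingSymbol δ₁ δ₂ η := by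
  have := rad_pos h
  unfold dampingSymbol; positivity

theorem elasticSymbol_pos (σ : ℝ) {η : EuclideanSpace ℝ (Fin n)} (h : η ≠ 0) :
    0 < elasticSymbol σ η := Real.rpow_pos_of_pos (rad_pos h) _

/-- For `|ξ| ≤ 1` the term with `δ₁` alone dominates, for `|ξ| ≥ 1` the term with `δ₂`. -/
theorem elasticSymbol_le_sq {σ δ₁ δ₂ : ℝ} (h₁ : 2 * δ₁ ≤ σ) (h₂ : σ ≤ 2 * δ₂)
    {η : EuclideanSpace ℝ (Fin n)} (h : η ≠ 0) :
    elasticSymbol σ η ≤ dampingSymbol δ₁ δ₂ η ^ 2 := by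
  have hr := rad_pos h
  unfold elasticSymbol dampingSymbol
  have e : ∀ δ : ℝ, rad η ^ (4 * δ) = (rad η ^ (2 * δ)) ^ 2 := fun δ => by
    rw [← Real.rpow_natCast, ← Real.rpow_mul hr.le]; congr 1; push_cast; ring
  have p1 : 0 < rad η ^ (2 * δ₁) := by positivity
  have p2 : 0 < rad η ^ (2 * δ₂) := by positivity
  rcases le_total (rad η) 1 with h1 | h1
  · have := Real.rpow_le_rpow_of_exponent_ge hr h1 (by linarith : 4 * δ₁ ≤ 2 * σ)
    rw [e] at this
    nlinarith
  · have := Real.rpow_le_rpow_of_exponent_le h1 (by linarith : 2 * σ ≤ 4 * δ₂)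
    rw [e] at this
    nlinarith

theorem absD_eq (s : ℝ) (f : L2 n) :
    absD s f = 𝓕⁻ (toL2 volume fun η => ((rad η ^ s : ℝ) : ℂ) * (𝓕 f : L2 n) η) := by
  unfold absD toL2
  by_cases h : MemDomAbsD s f
  · rw [dif_pos h, dif_pos (show MemLp (fun η => ((rad η ^ s : ℝ) : ℂ) * (𝓕 f : L2 n) η) 2 volume
      from h)]
    rfl
  · rw [dif_neg h, dif_neg (show ¬ MemLp (fun η => ((rad η ^ s : ℝ) : ℂ) * (𝓕 f : L2 n) η) 2 volume
      from h)]
    exact ((Lp.fourierTransformₗᵢ (EuclideanSpace ℝ (Fin n)) ℂ).symm.map_zero).symm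

theorem fourier_absD (s : ℝ) (f : L2 n) :
    𝓕 (absD s f) = toL2 volume fun η => ((rad η ^ s : ℝ) : ℂ) * (𝓕 f : L2 n) η := by
  rw [absD_eq, FourierTransform.fourier_fourierInv_eq]

theorem fourier_invFourier (g : EuclideanSpace ℝ (Fin n) → ℂ) :
    𝓕 (invFourier g) = toL2 volume fun η => g ((2 * Real.pi) • η) := by
  unfold invFourier toL2
  by_cases h : MemLp (fun η => g ((2 * Real.pi) • η)) 2 volume
  · rw [dif_pos h, dif_pos h, FourierTransform.fourier_fourierInv_eq]
  · rw [dif_neg h, dif_neg h]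
    exact (Lp.fourierTransformₗᵢ (EuclideanSpace ℝ (Fin n)) ℂ).map_zero

/-- Real weights and test functions make the conjugation in the first argument harmless, so the
pairing has the form needed by the fundamental lemma of the calculus of variations. -/
theorem inner_eq_integral_smul {w X : L2 n} {g m : EuclideanSpace ℝ (Fin n) → ℝ}
    (hw : w =ᵐ[volume] fun η => (m η : ℂ) * g η) :
    Integrable (fun η => g η • ((m η : ℂ) * X η)) ∧
      inner ℂ w X = ∫ η, g η • ((m η : ℂ) * X η) := by
  have h : (fun η => inner ℂ (w η) (X η)) =ᵐ[volume] fun η => g η • ((m η : ℂ) * X η) := by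
    filter_upwards [hw] with η h
    rw [h, RCLike.inner_apply, map_mul, Complex.conj_ofReal, Complex.conj_ofReal,
      Complex.real_smul]
    ring
  exact ⟨(L2.integrable_inner w X).congr h, by rw [L2.inner_def]; exact integral_congr_ae h⟩

theorem locallyIntegrable_mul {m : EuclideanSpace ℝ (Fin n) → ℝ} (hm : Continuous m) (X : L2 n) :
    LocallyIntegrable (fun η => (m η : ℂ) * X η) := by
  have hX : LocallyIntegrable X volume := (Lp.memLp X).locallyIntegrable (by norm_num)
  rw [← locallyIntegrableOn_univ] at hX ⊢
  exact hX.continuousOn_mul (Complex.continuous_ofReal.comp hm).continuousOn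
    isOpen_univ.isLocallyClosed

/-- The integrated form of the equation, pointwise on the Fourier side. -/
theorem fourier_integrated {σ δ₁ δ₂ : ℝ} (hσ : 0 < σ) (h₁ : 0 < δ₁) (h₂ : 0 < δ₂) {u₀ u₁ : L2 n}
    {u : ℝ → L2 n} (hu : IsSolution σ δ₁ δ₂ u₀ u₁ u) {W : ℝ → L2 n} (hWc : Continuous W)
    (hW : ∀ t, 0 ≤ t → W t = 𝓕 (u t)) {t : ℝ} (ht : 0 ≤ t) :
    ∀ᵐ η, (W t - W 0 - t • (𝓕 u₁ : L2 n) : L2 n) η =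
      (dampingSymbol δ₁ δ₂ η : ℂ) * (t • W 0 - ∫ τ in (0 : ℝ)..t, W τ : L2 n) η -
      (elasticSymbol σ η : ℂ) * (∫ τ in (0 : ℝ)..t, ∫ τ' in (0 : ℝ)..τ, W τ' : L2 n) η := by
  set X : L2 n := W t - W 0 - t • (𝓕 u₁ : L2 n)
  set Y : L2 n := t • W 0 - ∫ τ in (0 : ℝ)..t, W τ
  set Z : L2 n := ∫ τ in (0 : ℝ)..t, ∫ τ' in (0 : ℝ)..τ, W τ'
  have hloc : LocallyIntegrable (fun η => ((1 : ℝ) : ℂ) * X η - (dampingSymbol δ₁ δ₂ η : ℂ) * Y η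
      + (elasticSymbol σ η : ℂ) * Z η) volume :=
    ((locallyIntegrable_mul continuous_const X).sub
      (locallyIntegrable_mul (continuous_dampingSymbol h₁ h₂) Y)).add
      (locallyIntegrable_mul (continuous_elasticSymbol hσ) Z)
  have key := ae_eq_zero_of_integral_contDiff_smul_eq_zero (μ := volume) hloc ?_
  · filter_upwards [key] with η h
    push_cast at h
    linear_combination h
  intro g hg hgc
  have hgc' : HasCompactSupport fun η => (g η : ℂ) := hgc.comp_left Complex.ofReal_zero
  -- The weak equation is tested with the inverse transform of a function smooth and compactly
  -- supported in frequency, so that local integrability of the symbols times `L²` functions is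
  -- enough.
  let ψ : 𝓢(EuclideanSpace ℝ (Fin n), ℂ) :=
    hgc'.toSchwartzMap (Complex.ofRealCLM.contDiff.comp hg)
  have hψ' : (𝓕 ((𝓕⁻ ψ).toLp 2 : L2 n) : L2 n) = ψ.toLp 2 := by
    rw [SchwartzMap.toLp_fourier_eq, FourierTransform.fourier_fourierInv_eq]
  have hψae : (ψ.toLp 2 : L2 n) =ᵐ[volume] fun η => (g η : ℂ) := SchwartzMap.coeFn_toLp ψ 2 volume
  have hfrac : ∀ α : ℝ, 0 ≤ α → (𝓕 (fracLaplacian α ((𝓕⁻ ψ).toLp 2)) : L2 n) =ᵐ[volume]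
      fun η => ((rad η ^ (2 * α) : ℝ) : ℂ) * g η := by
    intro α hα
    have hd : MemLp (fun η => ((rad η ^ (2 * α) : ℝ) : ℂ) *
        (𝓕 ((𝓕⁻ ψ).toLp 2 : L2 n) : L2 n) η) 2 volume :=
      memDomAbsD_toLp (by positivity) (𝓕⁻ ψ)
    rw [fracLaplacian, fourier_absD]
    filter_upwards [coeFn_toL2 hd, hψae] with η h1 h2
    rw [h1, hψ', h2]
  obtain ⟨v, hv0, hv, hw⟩ := hu.weak (𝓕⁻ ψ)
  set φ : L2 n := (𝓕⁻ ψ).toLp 2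
  have hinner : ∀ (f : L2 n) (τ : ℝ), 0 ≤ τ → inner ℂ f (u τ) = inner ℂ (𝓕 f : L2 n) (W τ) := by
    intro f τ hτ
    rw [hW τ hτ, Lp.inner_fourier_eq]
  have main := inner_eq_of_weak (ψ := (𝓕 φ : L2 n))
    (p := (𝓕 (fracLaplacian δ₁ φ + fracLaplacian δ₂ φ) : L2 n))
    (q := (𝓕 (fracLaplacian σ φ) : L2 n)) (U₁ := (𝓕 u₁ : L2 n)) (v := v) hWc
    (by rw [hv0, Lp.inner_fourier_eq])
    (fun τ hτ => (hv τ hτ).congr (fun x hx => (hinner _ x hx).symm) (hinner _ τ hτ).symm)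
    (fun τ hτ => by
      rw [← hinner _ τ hτ]
      exact (hw τ hτ).congr (fun x hx => by simp only [hinner _ x hx])
        (by simp only [hinner _ τ hτ])) ht
  have i1 := inner_eq_integral_smul (w := (𝓕 φ : L2 n)) (X := X) (g := g) (m := fun _ => 1) (by
    filter_upwards [hψae] with η h
    rw [hψ', h]; simp)
  have i2 := inner_eq_integral_smul (w := (𝓕 (fracLaplacian δ₁ φ + fracLaplacian δ₂ φ) : L2 n))
    (X := Y) (g := g) (m := dampingSymbol δ₁ δ₂) (by
    rw [FourierTransform.fourier_add]
    filter_upwards [Lp.coeFn_add (𝓕 (fracLaplacian δ₁ φ)) (𝓕 (fracLaplacian δ₂ φ) : L2 n),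
      hfrac δ₁ h₁.le, hfrac δ₂ h₂.le] with η e1 e2 e3
    rw [e1, Pi.add_apply, e2, e3, dampingSymbol]
    push_cast
    ring)
  have i3 := inner_eq_integral_smul (w := (𝓕 (fracLaplacian σ φ) : L2 n)) (X := Z) (g := g)
    (m := elasticSymbol σ) (hfrac σ hσ.le)
  change inner ℂ (𝓕 φ : L2 n) X = inner ℂ (𝓕 (fracLaplacian δ₁ φ + fracLaplacian δ₂ φ) : L2 n) Y
    - inner ℂ (𝓕 (fracLaplacian σ φ) : L2 n) Z at main
  rw [i1.2, i2.2, i3.2] at main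
  simp only [smul_add, smul_sub]
  rw [integral_add (by exact i1.1.sub i2.1) i3.1, integral_sub i1.1 i2.1, main]
  ring

end FourierSide

/-! ### Representation of the solution -/

section Representation

variable {n : ℕ}

/-- The kernel multiplying the Fourier transform of `u₀`. -/
def kernel₀ (σ δ₁ δ₂ t : ℝ) (η : EuclideanSpace ℝ (Fin n)) : ℂ :=
  oscCos (dampingSymbol δ₁ δ₂ η) (elasticSymbol σ η) t

/-- The kernel multiplying the Fourier transform of `u₁`. -/
def kernel₁ (σ δ₁ δ₂ t : ℝ) (η : EuclideanSpace ℝ (Fin n)) : ℂ :=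
  oscSin (dampingSymbol δ₁ δ₂ η) (elasticSymbol σ η) t

/-- The time derivative of `kernel₀`. -/
def kernel₀' (σ δ₁ δ₂ t : ℝ) (η : EuclideanSpace ℝ (Fin n)) : ℂ :=
  -elasticSymbol σ η * oscSin (dampingSymbol δ₁ δ₂ η) (elasticSymbol σ η) t

/-- The time derivative of `kernel₁`. -/
def kernel₁' (σ δ₁ δ₂ t : ℝ) (η : EuclideanSpace ℝ (Fin n)) : ℂ :=
  oscSinDeriv (dampingSymbol δ₁ δ₂ η) (elasticSymbol σ η) t

@[fun_prop]
theorem measurable_dampingSymbol (δ₁ δ₂ : ℝ) : Measurable (dampingSymbol (n := n) δ₁ δ₂) := by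
  unfold dampingSymbol; fun_prop

@[fun_prop]
theorem measurable_elasticSymbol (σ : ℝ) : Measurable (elasticSymbol (n := n) σ) := by
  unfold elasticSymbol; fun_prop

theorem measurable_kernel₀ (σ δ₁ δ₂ t : ℝ) : Measurable (kernel₀ (n := n) σ δ₁ δ₂ t) := by
  have h : Measurable fun η : EuclideanSpace ℝ (Fin n) =>
      (dampingSymbol δ₁ δ₂ η, elasticSymbol σ η) := by fun_prop
  unfold kernel₀
  have := (measurable_oscCos t).comp h
  simp only [Function.comp_def] at this
  exact this

theorem measurable_kernel₁ (σ δ₁ δ₂ t : ℝ) : Measurable (kernel₁ (n := n) σ δ₁ δ₂ t) := by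
  have h : Measurable fun η : EuclideanSpace ℝ (Fin n) =>
      (dampingSymbol δ₁ δ₂ η, elasticSymbol σ η) := by fun_prop
  unfold kernel₁
  have := (measurable_oscSin t).comp h
  simp only [Function.comp_def] at this
  exact this

theorem measurable_kernel₁' (σ δ₁ δ₂ t : ℝ) : Measurable (kernel₁' (n := n) σ δ₁ δ₂ t) := by
  have h : Measurable fun η : EuclideanSpace ℝ (Fin n) =>
      (dampingSymbol δ₁ δ₂ η, elasticSymbol σ η) := by fun_prop
  unfold kernel₁'
  have := (measurable_oscSinDeriv t).comp h
  simp only [Function.comp_def] at this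
  exact this

theorem measurable_kernel₀' (σ δ₁ δ₂ t : ℝ) : Measurable (kernel₀' (n := n) σ δ₁ δ₂ t) := by
  have := measurable_kernel₁ (n := n) σ δ₁ δ₂ t
  unfold kernel₁ at this
  unfold kernel₀'
  fun_prop

set_option maxHeartbeats 2000000 in
/-- The solution localised to `|ξ| ≤ R`. -/
theorem localized_solution_eq {σ δ₁ δ₂ : ℝ} (hn : 0 < n) (hσ : 0 < σ) (h₁ : 0 < δ₁) (h₂ : 0 < δ₂)
    (h₁σ : 2 * δ₁ ≤ σ) (h₂σ : σ ≤ 2 * δ₂) {W₀ W₁ : L2 n} {W : ℝ → L2 n} (hWc : Continuous W)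
    (hW0 : W 0 = W₀)
    (hW : ∀ t, 0 ≤ t → ∀ᵐ η, (W t - W 0 - t • W₁ : L2 n) η =
      (dampingSymbol δ₁ δ₂ η : ℂ) * (t • W 0 - ∫ τ in (0 : ℝ)..t, W τ : L2 n) η -
      (elasticSymbol σ η : ℂ) * (∫ τ in (0 : ℝ)..t, ∫ τ' in (0 : ℝ)..τ, W τ' : L2 n) η)
    {R : ℝ} (hR : 0 ≤ R) {t : ℝ} (ht : 0 ≤ t) :
    ∀ᵐ η, rad η ≤ R → W t η = kernel₀ σ δ₁ δ₂ t η * W₀ η + kernel₁ σ δ₁ δ₂ t η * W₁ η := by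
  -- On this set both symbols are bounded, so `A` and `B` below are bounded operators; they absorb
  -- the cut-off `Pr` because `χ² = χ`.
  set D : Set (EuclideanSpace ℝ (Fin n)) := {η | rad η ≤ R} with hD
  have hDm : MeasurableSet D := measurableSet_le measurable_rad measurable_const
  set χ : EuclideanSpace ℝ (Fin n) → ℂ := D.indicator fun _ => 1 with hχ
  have hχm : Measurable χ := measurable_const.indicator hDm
  set a : EuclideanSpace ℝ (Fin n) → ℝ := dampingSymbol δ₁ δ₂ with ha
  set b : EuclideanSpace ℝ (Fin n) → ℝ := elasticSymbol σ with hb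
  set α : ℝ := R ^ (2 * δ₁) + R ^ (2 * δ₂) with hα
  have hα0 : 0 ≤ α := by positivity
  have haD : ∀ η ∈ D, a η ≤ α := fun η (hη : rad η ≤ R) => by
    have := rad_nonneg η
    rw [ha, dampingSymbol, hα]; gcongr
  have hχa : ∀ η, ‖χ η * a η‖ ≤ α := fun η => by
    have ha0 : 0 ≤ a η := by have := rad_nonneg η; rw [ha, dampingSymbol]; positivity
    by_cases h : η ∈ D
    · simp [hχ, h, abs_of_nonneg ha0, haD η h]
    · simp [hχ, h, hα0]
  have hχb : ∀ η, ‖χ η * b η‖ ≤ R ^ (2 * σ) := fun η => by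
    have hr := rad_nonneg η
    have hb0 : 0 ≤ b η := by rw [hb, elasticSymbol]; positivity
    by_cases h : η ∈ D
    · have : b η ≤ R ^ (2 * σ) := Real.rpow_le_rpow hr h (by positivity)
      simp [hχ, h, abs_of_nonneg hb0, this]
    · simp only [hχ, h, not_false_eq_true, indicator_of_notMem, zero_mul, norm_zero]; positivity
  have hχ1 : ∀ η, ‖χ η‖ ≤ 1 := fun η => by
    by_cases h : η ∈ D <;> simp [hχ, h]
  have hχL : MemLp χ ∞ volume := memLp_top_of_bound hχm.aestronglyMeasurable 1 (.of_forall hχ1)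
  have ham : Measurable a := measurable_dampingSymbol δ₁ δ₂
  have hbm : Measurable b := measurable_elasticSymbol σ
  have hχaL : MemLp (fun η => χ η * a η) ∞ volume :=
    memLp_top_of_bound (by fun_prop : Measurable _).aestronglyMeasurable _ (.of_forall hχa)
  have hχbL : MemLp (fun η => χ η * b η) ∞ volume :=
    memLp_top_of_bound (by fun_prop : Measurable _).aestronglyMeasurable _ (.of_forall hχb)
  have hχχ : ∀ η, χ η * χ η = χ η := fun η => by by_cases h : η ∈ D <;> simp [hχ, h]
  set Pr := mulL2 hχL
  set A := mulL2 hχaL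
  set B := mulL2 hχbL
  have hAP : ∀ f, A (Pr f) = A f := fun f => by
    refine Lp.ext ?_
    filter_upwards [coeFn_mulL2 hχL f, coeFn_mulL2 hχaL f, coeFn_mulL2 hχaL (Pr f)] with η e1 e2 e3
    rw [e3, e2, e1]; linear_combination (a η : ℂ) * f η * hχχ η
  have hBP : ∀ f, B (Pr f) = B f := fun f => by
    refine Lp.ext ?_
    filter_upwards [coeFn_mulL2 hχL f, coeFn_mulL2 hχbL f, coeFn_mulL2 hχbL (Pr f)] with η e1 e2 e3
    rw [e3, e2, e1]; linear_combination (b η : ℂ) * f η * hχχ η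
  set k₀ : ℝ → EuclideanSpace ℝ (Fin n) → ℂ := kernel₀ σ δ₁ δ₂ with hk₀
  set k₁ : ℝ → EuclideanSpace ℝ (Fin n) → ℂ := kernel₁ σ δ₁ δ₂ with hk₁
  have hk₀m : ∀ t, Measurable (k₀ t) := fun t => measurable_kernel₀ σ δ₁ δ₂ t
  have hk₁m : ∀ t, Measurable (k₁ t) := fun t => measurable_kernel₁ σ δ₁ δ₂ t
  have hk₁m' : ∀ t, Measurable (kernel₁' (n := n) σ δ₁ δ₂ t) :=
    fun t => measurable_kernel₁' σ δ₁ δ₂ t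
  have hW₀m := (Lp.memLp W₀).1
  have hW₁m := (Lp.memLp W₁).1
  -- pointwise bounds of the kernels
  have hbound : ∀ η, η ≠ 0 → ∀ t, 0 ≤ t → ‖k₀ t η‖ ≤ 67 ∧ ‖k₁ t η‖ ≤ t ∧ a η * ‖k₁ t η‖ ≤ 22 ∧
      ‖kernel₁' σ δ₁ δ₂ t η‖ ≤ 45 ∧ 0 < a η ∧ 0 < b η ∧ b η ≤ a η ^ 2 := by
    intro η hη t ht
    have pa := dampingSymbol_pos δ₁ δ₂ hη
    have pb := elasticSymbol_pos σ hη
    have pab := elasticSymbol_le_sq h₁σ h₂σ hη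
    have hexp : Real.exp (-(b η * t / (4 * a η))) ≤ 1 := by
      rw [Real.exp_le_one_iff, neg_nonpos]; positivity
    refine ⟨(norm_oscCos_le pa pb pab ht).trans (by linarith),
      norm_oscSin_le_self pa pb pab ht, (mul_norm_oscSin_le pa pb pab ht).trans (by linarith),
      (norm_oscSinDeriv_le pa pb pab ht).trans (by linarith), pa, pb, pab⟩
  set k : ℝ → EuclideanSpace ℝ (Fin n) → ℂ :=
    fun t η => χ η * (k₀ t η * W₀ η + k₁ t η * W₁ η) with hk
  -- This is `k' + A k`, simplified by `k₀' = -b k₁` and `k₁' + a k₁ = k₀`.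
  set p : ℝ → EuclideanSpace ℝ (Fin n) → ℂ :=
    fun t η => χ η * ((a η * k₀ t η - b η * k₁ t η) * W₀ η + k₀ t η * W₁ η) with hp
  have hM : ∀ C : ℝ, MemLp (fun η => C * (‖W₀ η‖ + ‖W₁ η‖)) 2 volume := fun C =>
    ((Lp.memLp W₀).norm.add (Lp.memLp W₁).norm).const_mul C
  have hkm : ∀ t, AEStronglyMeasurable (k t) volume := fun t =>
    hχm.aestronglyMeasurable.mul (((hk₀m t).aestronglyMeasurable.mul hW₀m).add
      ((hk₁m t).aestronglyMeasurable.mul hW₁m))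
  have hpm : ∀ t, AEStronglyMeasurable (p t) volume := fun t => by
    have : Measurable fun η => (a η : ℂ) * k₀ t η - b η * k₁ t η := by
      have := hk₀m t; have := hk₁m t; fun_prop
    exact hχm.aestronglyMeasurable.mul ((this.aestronglyMeasurable.mul hW₀m).add
      ((hk₀m t).aestronglyMeasurable.mul hW₁m))
  have hne := ae_ne_zero hn
  have hkL : ∀ t ∈ Ici (0 : ℝ), MemLp (k t) 2 volume := fun t ht => by
    refine (hM (67 + t)).mono' (hkm t) ?_
    filter_upwards [hne] with η hη
    obtain ⟨b1, b2, -⟩ := hbound η hη t ht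
    have ht' : 0 ≤ t := ht
    calc ‖k t η‖ ≤ 1 * (‖k₀ t η‖ * ‖W₀ η‖ + ‖k₁ t η‖ * ‖W₁ η‖) := by
          rw [hk, norm_mul]
          gcongr
          · exact hχ1 η
          · exact (norm_add_le _ _).trans (by simp only [norm_mul, le_refl])
      _ ≤ 1 * ((67 + t) * ‖W₀ η‖ + (67 + t) * ‖W₁ η‖) := by gcongr <;> linarith
      _ = _ := by ring
  have hpL : ∀ t ∈ Ici (0 : ℝ), MemLp (p t) 2 volume := fun t ht => by
    refine (hM (67 + 100 * α)).mono' (hpm t) ?_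
    filter_upwards [hne] with η hη
    obtain ⟨b1, b2, b3, b4, pa, pb, pab⟩ := hbound η hη t ht
    by_cases hηD : η ∈ D
    · have haα := haD η hηD
      have e1 : ‖(a η * k₀ t η - b η * k₁ t η : ℂ)‖ ≤ 67 + 100 * α := by
        refine (norm_sub_le _ _).trans ?_
        rw [norm_mul, norm_mul, Complex.norm_real, Complex.norm_real, Real.norm_of_nonneg pa.le,
          Real.norm_of_nonneg pb.le]
        have := mul_le_mul_of_nonneg_right pab (norm_nonneg (k₁ t η))
        nlinarith [norm_nonneg (k₁ t η), norm_nonneg (k₀ t η)]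
      calc ‖p t η‖ ≤ 1 * (‖(a η * k₀ t η - b η * k₁ t η : ℂ)‖ * ‖W₀ η‖ + ‖k₀ t η‖ * ‖W₁ η‖) := by
            rw [hp, norm_mul]
            gcongr
            · exact hχ1 η
            · exact (norm_add_le _ _).trans (by simp only [norm_mul, le_refl])
        _ ≤ 1 * ((67 + 100 * α) * ‖W₀ η‖ + (67 + 100 * α) * ‖W₁ η‖) := by gcongr; linarith
        _ = _ := by ring
    · simp only [hp, hχ, hηD, not_false_eq_true, indicator_of_notMem, zero_mul, norm_zero]
      positivity
  have hkd : ∀ t ∈ Ici (0 : ℝ), HasDerivWithinAt (fun t => toL2 volume (k t))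
      (toL2 volume (p t) - A (toL2 volume (k t))) (Ici 0) t := by
    intro t ht
    have := hasDerivWithinAt_toL2 (μ := volume) (m := k) (m' := fun t η =>
      χ η * (-b η * k₁ t η * W₀ η + kernel₁' σ δ₁ δ₂ t η * W₁ η)) (convex_Ici 0) ht
      (hM (45 + 22 * α)) hkL ?_ ?_
    · refine this.congr_deriv (Lp.ext ?_)
      have hm : MemLp (fun η => p t η - (χ η * a η) * k t η) 2 volume :=
        (hpL t ht).sub ((hkL t ht).mul hχaL)
      filter_upwards [Lp.coeFn_sub (toL2 volume (p t)) (A (toL2 volume (k t))),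
        coeFn_toL2 (hpL t ht), coeFn_toL2 (hkL t ht), coeFn_mulL2 hχaL (toL2 volume (k t)),
        coeFn_toL2 (f := fun η => χ η * (-b η * k₁ t η * W₀ η + kernel₁' σ δ₁ δ₂ t η * W₁ η))
          (hm.ae_eq (.of_forall fun η => by
            simp only [hp, hk, hk₀, hk₁, kernel₀, kernel₁, kernel₁', oscCos]
            linear_combination (-(a η : ℂ) *
              ((oscSinDeriv (a η) (b η) t + a η * oscSin (a η) (b η) t) * W₀ η
                + oscSin (a η) (b η) t * W₁ η)) * hχχ η))]
        with η e1 e2 e3 e4 e5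
      rw [e1, e5, Pi.sub_apply, e2, e4, e3]
      simp only [hp, hk, hk₀, hk₁, kernel₀, kernel₁, kernel₁', oscCos]
      linear_combination ((a η : ℂ) *
              ((oscSinDeriv (a η) (b η) t + a η * oscSin (a η) (b η) t) * W₀ η
                + oscSin (a η) (b η) t * W₁ η)) * hχχ η
    · have : Measurable fun η => -(b η : ℂ) * k₁ t η := by have := hk₁m t; fun_prop
      exact hχm.aestronglyMeasurable.mul ((this.aestronglyMeasurable.mul hW₀m).add
        ((hk₁m' t).aestronglyMeasurable.mul hW₁m))
    · filter_upwards [hne] with η hη t ht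
      obtain ⟨b1, b2, b3, b4, pa, pb, pab⟩ := hbound η hη t ht
      refine ⟨((((hasDerivAt_oscCos (a η) (b η) t).mul_const (W₀ η)).add
        ((hasDerivAt_oscSin (a η) (b η) t).mul_const (W₁ η))).const_mul (χ η)).hasDerivWithinAt, ?_⟩
      by_cases hηD : η ∈ D
      · have haα := haD η hηD
        have e1 : ‖(-b η * k₁ t η : ℂ)‖ ≤ 45 + 22 * α := by
          rw [norm_mul, norm_neg, Complex.norm_real, Real.norm_of_nonneg pb.le]
          have := mul_le_mul_of_nonneg_right pab (norm_nonneg (k₁ t η))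
          nlinarith [norm_nonneg (k₁ t η)]
        rw [norm_mul]
        calc _ ≤ 1 * (‖(-b η * k₁ t η : ℂ)‖ * ‖W₀ η‖ + ‖kernel₁' σ δ₁ δ₂ t η‖ * ‖W₁ η‖) := by
              gcongr
              · exact hχ1 η
              · exact (norm_add_le _ _).trans (by simp only [norm_mul, le_refl])
          _ ≤ 1 * ((45 + 22 * α) * ‖W₀ η‖ + (45 + 22 * α) * ‖W₁ η‖) := by gcongr; linarith
          _ = _ := by ring
      · simp only [hχ, hηD, not_false_eq_true, indicator_of_notMem, zero_mul, norm_zero]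
        positivity
  have hpd : ∀ t ∈ Ici (0 : ℝ), HasDerivWithinAt (fun t => toL2 volume (p t))
      (-B (toL2 volume (k t))) (Ici 0) t := by
    intro t ht
    have := hasDerivWithinAt_toL2 (μ := volume) (m := p) (m' := fun t η =>
      -(χ η * b η) * k t η) (convex_Ici 0) ht
      (hM (22 * α + 67 * α ^ 2)) hpL ?_ ?_
    · refine this.congr_deriv (Lp.ext ?_)
      filter_upwards [Lp.coeFn_neg (B (toL2 volume (k t))), coeFn_toL2 (hkL t ht),
        coeFn_mulL2 hχbL (toL2 volume (k t)),
        coeFn_toL2 (f := fun η => -(χ η * b η) * k t η) ((hkL t ht).mul hχbL.neg)]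
        with η e1 e2 e3 e4
      rw [e4, e1, Pi.neg_apply, e3, e2]
      ring
    · exact (by fun_prop : Measurable fun η => -(χ η * b η)).aestronglyMeasurable.mul (hkm t)
    · filter_upwards [hne] with η hη t ht
      obtain ⟨b1, b2, b3, b4, pa, pb, pab⟩ := hbound η hη t ht
      constructor
      · refine ((((((hasDerivAt_oscCos (a η) (b η) t).const_mul (a η : ℂ)).sub
          ((hasDerivAt_oscSin (a η) (b η) t).const_mul (b η : ℂ))).mul_const (W₀ η)).add
          ((hasDerivAt_oscCos (a η) (b η) t).mul_const (W₁ η))).const_mul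
            (χ η)).hasDerivWithinAt.congr_deriv ?_
        simp only [hk, hk₀, hk₁, kernel₀, kernel₁, oscCos]
        linear_combination (b η : ℂ) * ((oscSinDeriv (a η) (b η) t + a η * oscSin (a η) (b η) t) * W₀ η
                + oscSin (a η) (b η) t * W₁ η) * hχχ η
      · by_cases hηD : η ∈ D
        · have haα := haD η hηD
          have e1 : b η * ‖k₁ t η‖ ≤ 22 * α + 67 * α ^ 2 := by
            have := mul_le_mul_of_nonneg_right pab (norm_nonneg (k₁ t η))
            nlinarith [norm_nonneg (k₁ t η)]
          have e2 : b η * ‖k₀ t η‖ ≤ 22 * α + 67 * α ^ 2 := by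
            have : b η ≤ α ^ 2 := pab.trans (by gcongr)
            nlinarith [norm_nonneg (k₀ t η)]
          have e3 : ‖-(χ η * b η)‖ ≤ b η := by
            simp [hχ, hηD, abs_of_pos pb]
          have e4 : ‖k t η‖ ≤ 1 * (‖k₀ t η‖ * ‖W₀ η‖ + ‖k₁ t η‖ * ‖W₁ η‖) := by
            rw [hk, norm_mul]
            gcongr
            · exact hχ1 η
            · exact (norm_add_le _ _).trans (by simp only [norm_mul, le_refl])
          rw [norm_mul]
          calc _ ≤ b η * (1 * (‖k₀ t η‖ * ‖W₀ η‖ + ‖k₁ t η‖ * ‖W₁ η‖)) := by gcongr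
            _ = (b η * ‖k₀ t η‖) * ‖W₀ η‖ + (b η * ‖k₁ t η‖) * ‖W₁ η‖ := by ring
            _ ≤ (22 * α + 67 * α ^ 2) * ‖W₀ η‖ + (22 * α + 67 * α ^ 2) * ‖W₁ η‖ := by gcongr
            _ = _ := by ring
        · simp only [hχ, hηD, not_false_eq_true, indicator_of_notMem, zero_mul, norm_zero, neg_zero]
          positivity
  -- The cut-off is applied to the integrated equation; inside `A` the datum `W₀` may be replaced by
  -- `Pr W₀`.
  have hg : ∀ t, 0 ≤ t → Pr (W t) = Pr W₀ + t • Pr W₁ + A (t • Pr W₀ - ∫ τ in (0 : ℝ)..t, W τ)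
      - B (∫ τ in (0 : ℝ)..t, ∫ τ' in (0 : ℝ)..τ, W τ') := by
    intro t ht
    set X : L2 n := W t - W 0 - t • W₁ with hX
    set Y : L2 n := t • W 0 - ∫ τ in (0 : ℝ)..t, W τ with hY
    set Z : L2 n := ∫ τ in (0 : ℝ)..t, ∫ τ' in (0 : ℝ)..τ, W τ'
    have h1 : Pr X = A Y - B Z := by
      refine Lp.ext ?_
      filter_upwards [hW t ht, coeFn_mulL2 hχL X, coeFn_mulL2 hχaL Y, coeFn_mulL2 hχbL Z,
        Lp.coeFn_sub (A Y) (B Z)] with η e1 e2 e3 e4 e5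
      rw [e2, e5, Pi.sub_apply, e3, e4, e1]
      ring
    have h2 : A (t • Pr W₀ - ∫ τ in (0 : ℝ)..t, W τ) = A Y := by
      rw [hY, map_sub, map_sub, hW0, ContinuousLinearMap.map_smul_of_tower,
        ContinuousLinearMap.map_smul_of_tower, hAP]
    rw [h2, add_sub_assoc, ← h1, hX, hW0, map_sub, map_sub,
      ContinuousLinearMap.map_smul_of_tower]
    abel
  have main := eq_of_integrated (A := A.restrictScalars ℝ) (B := B.restrictScalars ℝ) (U := W)
    (g := fun t => Pr (W t)) (k := fun t => toL2 volume (k t)) (p := fun t => toL2 volume (p t))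
    hWc hg (fun t _ => (hAP _).symm) (fun t _ => (hBP _).symm) hkd hpd ?_ ?_ ht
  · filter_upwards [coeFn_toL2 (hkL t ht), coeFn_mulL2 hχL (W t)] with η e1 e2 hη
    have hηD : η ∈ D := hη
    have e3 : Pr (W t) η = toL2 volume (k t) η := by rw [main]
    rw [e1, e2] at e3
    simpa [hk, hχ, hηD] using e3
  · refine Lp.ext ?_
    filter_upwards [coeFn_toL2 (hkL 0 (mem_Ici.2 le_rfl)), coeFn_mulL2 hχL W₀] with η e1 e2
    rw [e1, e2]
    simp [hk, hk₀, hk₁, kernel₀, kernel₁]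
  · refine Lp.ext ?_
    filter_upwards [coeFn_toL2 (hpL 0 (mem_Ici.2 le_rfl)), coeFn_mulL2 hχL W₁,
      coeFn_mulL2 hχaL (Pr W₀), coeFn_mulL2 hχL W₀,
      Lp.coeFn_add (Pr W₁) (A (Pr W₀))] with η e1 e2 e3 e4 e5
    rw [e1, show (A.restrictScalars ℝ) (Pr W₀) = A (Pr W₀) from rfl, e5, Pi.add_apply, e2, e3, e4]
    simp only [hp, hk₀, hk₁, kernel₀, kernel₁, oscCos_zero, oscSin_zero]
    linear_combination (-(a η : ℂ) * W₀ η) * hχχ η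

theorem fourier_solution {σ δ₁ δ₂ : ℝ} (hn : 0 < n) (hσ : 0 < σ) (h₁ : 0 < δ₁) (h₂ : 0 < δ₂)
    (h₁σ : 2 * δ₁ ≤ σ) (h₂σ : σ ≤ 2 * δ₂) {u₀ u₁ : L2 n} {u : ℝ → L2 n}
    (hu : IsSolution σ δ₁ δ₂ u₀ u₁ u) {t : ℝ} (ht : 0 ≤ t) :
    (𝓕 (u t) : L2 n) =ᵐ[volume] fun η =>
      kernel₀ σ δ₁ δ₂ t η * (𝓕 u₀ : L2 n) η + kernel₁ σ δ₁ δ₂ t η * (𝓕 u₁ : L2 n) η := by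
  -- The curve is frozen for negative times, where `u` is arbitrary, so that it is continuous on the
  -- whole line.
  set W : ℝ → L2 n := fun t => 𝓕 (u (max t 0)) with hW
  have hWc : Continuous W := by
    have : Continuous fun t : ℝ => u (max t 0) :=
      hu.continuousOn.comp_continuous (by fun_prop) fun t => mem_Ici.2 (le_max_right _ _)
    exact (Lp.fourierTransformₗᵢ (EuclideanSpace ℝ (Fin n)) ℂ).continuous.comp this
  have hWt : ∀ t, 0 ≤ t → W t = 𝓕 (u t) := fun t ht => by simp only [hW, max_eq_left ht]
  have hW0 : W 0 = 𝓕 u₀ := by rw [hWt 0 le_rfl, hu.initial]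
  -- Integer radii suffice, and countably many null sets have a null union.
  have key : ∀ N : ℕ, ∀ᵐ η, rad η ≤ N → W t η =
      kernel₀ σ δ₁ δ₂ t η * (𝓕 u₀ : L2 n) η + kernel₁ σ δ₁ δ₂ t η * (𝓕 u₁ : L2 n) η := fun N =>
    localized_solution_eq hn hσ h₁ h₂ h₁σ h₂σ hWc hW0
      (fun t ht => fourier_integrated hσ h₁ h₂ hu hWc hWt ht) (Nat.cast_nonneg N) ht
  filter_upwards [ae_all_iff.2 key] with η h
  obtain ⟨N, hN⟩ := exists_nat_ge (rad η)
  rw [← hWt t ht]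
  exact h N hN

end Representation

/-! ### Integrable and Sobolev functions on the Fourier side, radial weights, scaling -/

section Data

variable {n : ℕ}

theorem ae_eq_of_forall_schwartz {f g : EuclideanSpace ℝ (Fin n) → ℂ}
    (hf : LocallyIntegrable f) (hg : LocallyIntegrable g)
    (h : ∀ ψ : 𝓢(EuclideanSpace ℝ (Fin n), ℂ), ∫ x, ψ x • f x = ∫ x, ψ x • g x) :
    f =ᵐ[volume] g := by
  refine ae_eq_of_integral_contDiff_smul_eq hf hg fun φ hφ hφc => ?_
  have hφc' : HasCompactSupport fun η => (φ η : ℂ) := hφc.comp_left Complex.ofReal_zero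
  have := h (hφc'.toSchwartzMap (Complex.ofRealCLM.contDiff.comp hφ))
  exact this

/-- On `L¹ ∩ L²` the Fourier transform of `L²` is given by the Fourier integral. -/
theorem fourier_ae_eq_of_integrable {f : L2 n} (hf : Integrable f volume) :
    (𝓕 f : L2 n) =ᵐ[volume] 𝓕 (f : EuclideanSpace ℝ (Fin n) → ℂ) := by
  have hc : Continuous (𝓕 (f : EuclideanSpace ℝ (Fin n) → ℂ)) :=
    VectorFourier.fourierIntegral_continuous Real.continuous_fourierChar continuous_inner hf
  refine ae_eq_of_forall_schwartz ((Lp.memLp _).locallyIntegrable (by norm_num))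
    hc.locallyIntegrable fun ψ => ?_
  have h1 := DFunLike.congr_fun (Lp.fourier_toTemperedDistribution_eq f) ψ
  rw [TemperedDistribution.fourier_apply, Lp.toTemperedDistribution_apply,
    Lp.toTemperedDistribution_apply] at h1
  rw [← h1]
  have := VectorFourier.integral_fourierIntegral_smul_eq_flip (L := innerₗ _)
    (μ := volume) (ν := volume) Real.continuous_fourierChar
    continuous_inner (ψ.integrable (μ := volume)) hf
  simpa using! this

theorem memLp_weight_of_memSobolev {s : ℝ} {f : L2 n}
    (hf : TemperedDistribution.MemSobolev s 2 (f : 𝓢'(EuclideanSpace ℝ (Fin n), ℂ))) :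
    MemLp (fun η => (((1 + ‖η‖ ^ 2) ^ (s / 2) : ℝ) : ℂ) * (𝓕 f : L2 n) η) 2 volume := by
  obtain ⟨g, hg⟩ := TemperedDistribution.memSobolev_iff_exists_smulLeftCLM_fourier.1 hf
  refine (Lp.memLp g).ae_eq (ae_eq_of_forall_schwartz
    ((Lp.memLp _).locallyIntegrable (by norm_num)) ?_ fun ψ => ?_)
  · refine locallyIntegrable_mul (m := fun η => (1 + ‖η‖ ^ 2) ^ (s / 2)) ?_ (𝓕 f)
    exact (by fun_prop : Continuous fun η : EuclideanSpace ℝ (Fin n) => 1 + ‖η‖ ^ 2).rpow_const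
      fun η => Or.inl (by positivity)
  · have h1 := DFunLike.congr_fun hg ψ
    rw [TemperedDistribution.smulLeftCLM_apply_apply, Lp.fourier_toTemperedDistribution_eq,
      Lp.toTemperedDistribution_apply, Lp.toTemperedDistribution_apply] at h1
    rw [← h1]
    refine integral_congr_ae (.of_forall fun η => ?_)
    simp only []
    rw [SchwartzMap.smulLeftCLM_apply_apply (by fun_prop)]
    simp only [smul_eq_mul]
    ring

/-- The Sobolev weight is written in `η = ξ / (2π)`; the constant `8` exceeds `1 + 2π`. -/
theorem one_add_rad_le (η : EuclideanSpace ℝ (Fin n)) :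
    1 + rad η ≤ 8 * (1 + ‖η‖ ^ 2) ^ (1 / 2 : ℝ) := by
  rw [← Real.sqrt_eq_rpow, rad_eq]
  have h1 : 1 ≤ √(1 + ‖η‖ ^ 2) := Real.one_le_sqrt.2 (by nlinarith [norm_nonneg η])
  have h2 : ‖η‖ ≤ √(1 + ‖η‖ ^ 2) := Real.le_sqrt_of_sq_le (by linarith)
  nlinarith [Real.pi_pos, Real.pi_lt_d2, norm_nonneg η]

theorem memLp_one_add_rad_rpow {s : ℝ} (hs : 0 ≤ s) {f : L2 n}
    (hf : TemperedDistribution.MemSobolev s 2 (f : 𝓢'(EuclideanSpace ℝ (Fin n), ℂ))) :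
    MemLp (fun η => (((1 + rad η) ^ s : ℝ) : ℂ) * (𝓕 f : L2 n) η) 2 volume := by
  refine (memLp_weight_of_memSobolev hf).of_le_mul (c := 8 ^ s) ?_ (.of_forall fun η => ?_)
  · exact (by fun_prop : Measurable fun η : EuclideanSpace ℝ (Fin n) =>
      (((1 + rad η) ^ s : ℝ) : ℂ)).aestronglyMeasurable.mul (Lp.memLp _).1
  · have := rad_nonneg η
    rw [norm_mul, norm_mul, ← mul_assoc, Complex.norm_real, Complex.norm_real,
      Real.norm_of_nonneg (by positivity), Real.norm_of_nonneg (by positivity)]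
    gcongr
    calc (1 + rad η) ^ s ≤ (8 * (1 + ‖η‖ ^ 2) ^ (1 / 2 : ℝ)) ^ s := by
          gcongr; exact one_add_rad_le η
      _ = _ := by
          rw [Real.mul_rpow (by norm_num) (by positivity), ← Real.rpow_mul (by positivity)]
          ring_nf

theorem memLp_two_of_integrable_sq {f : EuclideanSpace ℝ (Fin n) → ℂ}
    (hf : AEStronglyMeasurable f volume) (h : Integrable (fun η => ‖f η‖ ^ 2)) :
    MemLp f 2 volume := (memLp_two_iff_integrable_sq_norm hf).2 h

/-- Square integrability of `|ξ|^k exp (-c |ξ|^p)`. -/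
theorem memLp_rad_rpow_mul_exp (hn : 0 < n) {k c p : ℝ} (hk : -(n : ℝ) < 2 * k) (hc : 0 < c)
    (hp : 0 < p) :
    MemLp (fun η : EuclideanSpace ℝ (Fin n) => rad η ^ k * Real.exp (-c * rad η ^ p)) 2 volume := by
  have : Nonempty (Fin n) := ⟨⟨0, hn⟩⟩
  have hm : Measurable fun η : EuclideanSpace ℝ (Fin n) =>
      rad η ^ k * Real.exp (-c * rad η ^ p) := by fun_prop
  rw [memLp_two_iff_integrable_sq hm.aestronglyMeasurable]
  have hpi := Real.two_pi_pos
  set c' := 2 * c * (2 * Real.pi) ^ p with hc'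
  -- In polar coordinates the square has the radial power `n - 1 + 2k`, which exceeds `-1` exactly
  -- under `hk`.
  have h1 : IntegrableOn (fun x : ℝ => x ^ ((n : ℝ) - 1 + 2 * k) * Real.exp (-c' * x ^ p)) (Ioi 0) :=
    integrableOn_rpow_mul_exp_neg_mul_rpow (by linarith) hp (by positivity)
  have h2 := (integrable_fun_norm_addHaar (volume : Measure (EuclideanSpace ℝ (Fin n)))
    (f := fun x : ℝ => (((2 * Real.pi) * x) ^ k * Real.exp (-c * ((2 * Real.pi) * x) ^ p)) ^ 2)).2 ?_
  · simpa only [rad_eq] using h2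
  · refine IntegrableOn.congr_fun (Integrable.const_mul h1 ((2 * Real.pi) ^ (2 * k)))
      (fun x hx => ?_) measurableSet_Ioi
    have hx : 0 < x := hx
    simp only [finrank_euclideanSpace, Fintype.card_fin, smul_eq_mul]
    rw [mul_pow, Real.mul_rpow hpi.le hx.le, Real.mul_rpow hpi.le hx.le, mul_pow,
      ← Real.exp_nat_mul, ← Real.rpow_mul_natCast hpi.le, ← Real.rpow_mul_natCast hx.le,
      Real.rpow_add hx, Real.rpow_sub_one hx.ne', Real.rpow_natCast, hc']
    have : x ^ (n - 1) = x ^ n / x := by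
      rw [eq_div_iff hx.ne', ← pow_succ, Nat.sub_add_cancel hn]
    rw [this, mul_comm k]
    push_cast
    ring_nf

/-- The `L²` norm under dilations. -/
theorem norm_toL2_dilate {f : EuclideanSpace ℝ (Fin n) → ℂ} (hfm : Measurable f)
    (hf : MemLp f 2 volume) {τ : ℝ} (hτ : 0 < τ) :
    ‖toL2 volume fun η => ((τ ^ ((n : ℝ) / 2) : ℝ) : ℂ) * f (τ • η)‖ = ‖toL2 volume f‖ := by
  have hcomp : Measurable fun η : EuclideanSpace ℝ (Fin n) => τ • η := by fun_prop
  have hm : MemLp (fun η => f (τ • η)) 2 volume := by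
    refine memLp_two_of_integrable_sq (hfm.comp hcomp).aestronglyMeasurable ?_
    exact (((memLp_two_iff_integrable_sq_norm hf.1).1 hf).comp_smul hτ.ne')
  refine (sq_eq_sq₀ (norm_nonneg _) (norm_nonneg _)).1 ?_
  rw [norm_toL2_sq hf, norm_toL2_sq (hm.const_mul _)]
  have h1 := Measure.integral_comp_smul_of_nonneg volume (fun η => ‖f η‖ ^ 2) τ (hR := hτ.le)
  simp only [norm_mul, mul_pow, Complex.norm_real]
  rw [integral_const_mul, h1, finrank_euclideanSpace, Fintype.card_fin, smul_eq_mul,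
    Real.norm_of_nonneg (by positivity), ← Real.rpow_mul_natCast hτ.le]
  rw [show (n : ℝ) / 2 * (2 : ℕ) = n by push_cast; ring, Real.rpow_natCast, ← mul_assoc,
    mul_inv_cancel₀ (by positivity), one_mul]

end Data

/-! ### Bounds and limits of the kernels -/

section KernelBounds

variable {n : ℕ}

/-- `∂ₜʲ` of `kernel₀`, for `j = 0, 1`. -/
def kerD₀ (j : ℕ) (σ δ₁ δ₂ t : ℝ) (η : EuclideanSpace ℝ (Fin n)) : ℂ :=
  if j = 0 then kernel₀ σ δ₁ δ₂ t η else kernel₀' σ δ₁ δ₂ t η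

/-- `∂ₜʲ` of `kernel₁`, for `j = 0, 1`. -/
def kerD₁ (j : ℕ) (σ δ₁ δ₂ t : ℝ) (η : EuclideanSpace ℝ (Fin n)) : ℂ :=
  if j = 0 then kernel₁ σ δ₁ δ₂ t η else kernel₁' σ δ₁ δ₂ t η

theorem measurable_kerD₀ (j : ℕ) (σ δ₁ δ₂ t : ℝ) :
    Measurable (kerD₀ (n := n) j σ δ₁ δ₂ t) := by
  unfold kerD₀
  split_ifs
  · exact measurable_kernel₀ σ δ₁ δ₂ t
  · exact measurable_kernel₀' σ δ₁ δ₂ t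

theorem measurable_kerD₁ (j : ℕ) (σ δ₁ δ₂ t : ℝ) :
    Measurable (kerD₁ (n := n) j σ δ₁ δ₂ t) := by
  unfold kerD₁
  split_ifs
  · exact measurable_kernel₁ σ δ₁ δ₂ t
  · exact measurable_kernel₁' σ δ₁ δ₂ t

theorem hasDerivAt_kerD₀ (σ δ₁ δ₂ t : ℝ) (η : EuclideanSpace ℝ (Fin n)) :
    HasDerivAt (fun t => kerD₀ 0 σ δ₁ δ₂ t η) (kerD₀ 1 σ δ₁ δ₂ t η) t :=
  hasDerivAt_oscCos (dampingSymbol δ₁ δ₂ η) (elasticSymbol σ η) t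

theorem hasDerivAt_kerD₁ (σ δ₁ δ₂ t : ℝ) (η : EuclideanSpace ℝ (Fin n)) :
    HasDerivAt (fun t => kerD₁ 0 σ δ₁ δ₂ t η) (kerD₁ 1 σ δ₁ δ₂ t η) t :=
  hasDerivAt_oscSin (dampingSymbol δ₁ δ₂ η) (elasticSymbol σ η) t

theorem continuous_kerD₀ (j : ℕ) (σ δ₁ δ₂ : ℝ) (η : EuclideanSpace ℝ (Fin n)) :
    Continuous fun t => kerD₀ j σ δ₁ δ₂ t η := by
  refine continuous_iff_continuousAt.2 fun t => ?_
  unfold kerD₀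
  split_ifs
  · exact (hasDerivAt_oscCos (dampingSymbol δ₁ δ₂ η) (elasticSymbol σ η) t).continuousAt
  · exact ((hasDerivAt_oscSin (dampingSymbol δ₁ δ₂ η) (elasticSymbol σ η) t).const_mul
      (-(elasticSymbol σ η : ℂ))).continuousAt

theorem continuous_kerD₁ (j : ℕ) (σ δ₁ δ₂ : ℝ) (η : EuclideanSpace ℝ (Fin n)) :
    Continuous fun t => kerD₁ j σ δ₁ δ₂ t η := by
  refine continuous_iff_continuousAt.2 fun t => ?_
  unfold kerD₁
  split_ifs
  · exact (hasDerivAt_oscSin (dampingSymbol δ₁ δ₂ η) (elasticSymbol σ η) t).continuousAt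
  · exact (hasDerivAt_oscSinDeriv (dampingSymbol δ₁ δ₂ η) (elasticSymbol σ η) t).continuousAt

/-! ### Low and high frequency bounds, and the diffusive limit -/

variable {σ δ₁ δ₂ : ℝ} {η : EuclideanSpace ℝ (Fin n)} {t : ℝ}

theorem low_frequency_symbols (h₁₂ : δ₁ ≤ δ₂) (hη : η ≠ 0) (hr : rad η ≤ 1) :
    rad η ^ (2 * δ₁) ≤ dampingSymbol δ₁ δ₂ η ∧ dampingSymbol δ₁ δ₂ η ≤ 2 * rad η ^ (2 * δ₁) ∧
      rad η ^ (2 * (σ - δ₁)) / 2 ≤ elasticSymbol σ η / dampingSymbol δ₁ δ₂ η := by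
  have hr0 := rad_pos hη
  have h := Real.rpow_le_rpow_of_exponent_ge hr0 hr (by linarith : 2 * δ₁ ≤ 2 * δ₂)
  have p1 : 0 < rad η ^ (2 * δ₁) := by positivity
  have p2 : 0 < rad η ^ (2 * δ₂) := by positivity
  unfold dampingSymbol elasticSymbol
  refine ⟨by linarith, by linarith, ?_⟩
  rw [div_le_div_iff₀ two_pos (by positivity)]
  have : rad η ^ (2 * σ) = rad η ^ (2 * (σ - δ₁)) * rad η ^ (2 * δ₁) := by
    rw [← Real.rpow_add hr0]; ring_nf
  rw [this]
  nlinarith [Real.rpow_pos_of_pos hr0 (2 * (σ - δ₁))]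

theorem high_frequency_symbols (h₁₂ : δ₁ ≤ δ₂) (h₂σ : δ₂ ≤ σ) (hr : 1 ≤ rad η) :
    rad η ^ (2 * δ₂) ≤ dampingSymbol δ₁ δ₂ η ∧ dampingSymbol δ₁ δ₂ η ≤ 2 * rad η ^ (2 * δ₂) ∧
      1 / 2 ≤ elasticSymbol σ η / dampingSymbol δ₁ δ₂ η := by
  have hr0 : 0 < rad η := by linarith
  have h := Real.rpow_le_rpow_of_exponent_le hr (by linarith : 2 * δ₁ ≤ 2 * δ₂)
  have h' := Real.rpow_le_rpow_of_exponent_le hr (by linarith : 2 * δ₂ ≤ 2 * σ)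
  have p1 : 0 < rad η ^ (2 * δ₁) := by positivity
  have p2 : 0 < rad η ^ (2 * δ₂) := by positivity
  unfold dampingSymbol elasticSymbol
  refine ⟨by linarith, by linarith, ?_⟩
  rw [div_le_div_iff₀ two_pos (by positivity)]
  linarith

theorem low_frequency_exp (h₁₂ : δ₁ ≤ δ₂) (hη : η ≠ 0) (hr : rad η ≤ 1) (ht : 0 ≤ t) :
    Real.exp (-(elasticSymbol σ η * t / (8 * dampingSymbol δ₁ δ₂ η))) ≤
      Real.exp (-(rad η ^ (2 * (σ - δ₁)) * t / 16)) := by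
  obtain ⟨-, -, h⟩ := low_frequency_symbols (σ := σ) h₁₂ hη hr
  have := mul_le_mul_of_nonneg_right h ht
  rw [Real.exp_le_exp, neg_le_neg_iff]
  calc _ = rad η ^ (2 * (σ - δ₁)) / 2 * t / 8 := by ring
    _ ≤ elasticSymbol σ η / dampingSymbol δ₁ δ₂ η * t / 8 := by gcongr
    _ = _ := by ring

theorem high_frequency_exp (h₁₂ : δ₁ ≤ δ₂) (h₂σ : δ₂ ≤ σ) (hr : 1 ≤ rad η) (ht : 0 ≤ t) :
    Real.exp (-(elasticSymbol σ η * t / (4 * dampingSymbol δ₁ δ₂ η))) ≤ Real.exp (-(t / 8)) := by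
  obtain ⟨-, -, h⟩ := high_frequency_symbols h₁₂ h₂σ hr
  have := mul_le_mul_of_nonneg_right h ht
  rw [Real.exp_le_exp, neg_le_neg_iff]
  calc _ = 1 / 2 * t / 4 := by ring
    _ ≤ elasticSymbol σ η / dampingSymbol δ₁ δ₂ η * t / 4 := by gcongr
    _ = _ := by ring

theorem rpow_le_one_add_rpow {r k l : ℝ} (hr : 1 ≤ r) (hkl : k ≤ l) (hl : 0 ≤ l) :
    r ^ k ≤ (1 + r) ^ l :=
  (Real.rpow_le_rpow_of_exponent_le hr hkl).trans
    (Real.rpow_le_rpow (by linarith) (by linarith) hl)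

/-- Since `b ≤ a²`, this is `a` times the bound for `a |K|`: a time derivative on the `u₀` kernel
costs one factor `a`. -/
theorem elastic_mul_norm_oscSin_le {a b t : ℝ} (ha : 0 < a) (hb : 0 < b) (hab : b ≤ a ^ 2)
    (ht : 0 ≤ t) : b * ‖oscSin a b t‖ ≤ a * (22 * Real.exp (-(b * t / (4 * a)))) := by
  have h1 := mul_norm_oscSin_le ha hb hab ht
  have h2 := mul_le_mul_of_nonneg_left h1 ha.le
  have h3 := mul_le_mul_of_nonneg_right hab (norm_nonneg (oscSin a b t))
  nlinarith

theorem norm_kernel₀' (hη : η ≠ 0) : ‖kernel₀' σ δ₁ δ₂ t η‖ =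
    elasticSymbol σ η * ‖oscSin (dampingSymbol δ₁ δ₂ η) (elasticSymbol σ η) t‖ := by
  rw [kernel₀', norm_mul, norm_neg, Complex.norm_real,
    Real.norm_of_nonneg (elasticSymbol_pos σ hη).le]

/-- Here `a` is of size `|ξ|^(2δ₂)`, so the time derivative costs `2δ₂` derivatives of `u₀`, and `b
/ a ≥ 1/2` turns the decay rate into `1/8`. -/
theorem high_frequency_kerD₀ {j : ℕ} (hj : j = 0 ∨ j = 1) {s : ℝ} (hs : 0 ≤ s) (h₁ : 0 < δ₁)
    (h₁σ : 2 * δ₁ ≤ σ) (hσ₂ : σ ≤ 2 * δ₂) (h₂σ : δ₂ ≤ σ) (hη : η ≠ 0) (hr : 1 ≤ rad η)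
    (ht : 0 ≤ t) : rad η ^ s * ‖kerD₀ j σ δ₁ δ₂ t η‖ ≤
      100 * Real.exp (-(t / 8)) * (1 + rad η) ^ (s + 2 * j * δ₂) := by
  have h₁₂ : δ₁ ≤ δ₂ := by linarith
  have pa := dampingSymbol_pos δ₁ δ₂ hη
  have pb := elasticSymbol_pos σ hη
  have pab := elasticSymbol_le_sq h₁σ hσ₂ hη
  have he := high_frequency_exp h₁₂ h₂σ hr ht
  have hr0 := rad_pos hη
  rcases hj with rfl | rfl
  · have h := norm_oscCos_le pa pb pab ht
    have hw := rpow_le_one_add_rpow hr le_rfl hs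
    simp only [kerD₀, if_true, kernel₀, Nat.cast_zero, mul_zero, zero_mul, add_zero]
    rw [mul_comm]
    gcongr
    linarith [Real.exp_pos (-(t / 8))]
  · have h := elastic_mul_norm_oscSin_le pa pb pab ht
    have hw := rpow_le_one_add_rpow (k := s + 2 * δ₂) (l := s + 2 * δ₂) hr le_rfl (by linarith)
    obtain ⟨-, ha, -⟩ := high_frequency_symbols h₁₂ h₂σ hr
    simp only [kerD₀, one_ne_zero, if_false, norm_kernel₀' hη, Nat.cast_one, mul_one]
    calc _ ≤ rad η ^ s * (dampingSymbol δ₁ δ₂ η *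
          (22 * Real.exp (-(elasticSymbol σ η * t / (4 * dampingSymbol δ₁ δ₂ η))))) := by gcongr
      _ ≤ rad η ^ s * ((2 * rad η ^ (2 * δ₂)) * (22 * Real.exp (-(t / 8)))) := by gcongr
      _ = 44 * Real.exp (-(t / 8)) * rad η ^ (s + 2 * δ₂) := by
          rw [Real.rpow_add hr0]; ring
      _ ≤ _ := by gcongr; norm_num

/-- Dividing by `a` gains `2δ₂` derivatives of `u₁` when `j = 0`; for `j = 1` gain and loss cancel.
A negative order is replaced by `0`, as in the hypothesis on `u₁`. -/
theorem high_frequency_kerD₁ {j : ℕ} (hj : j = 0 ∨ j = 1) {s : ℝ} (hs : 0 ≤ s)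
    (h₁σ : 2 * δ₁ ≤ σ) (hσ₂ : σ ≤ 2 * δ₂) (h₂σ : δ₂ ≤ σ) (hη : η ≠ 0) (hr : 1 ≤ rad η)
    (ht : 0 ≤ t) : rad η ^ s * ‖kerD₁ j σ δ₁ δ₂ t η‖ ≤
      100 * Real.exp (-(t / 8)) * (1 + rad η) ^ max (s + 2 * ((j : ℝ) - 1) * δ₂) 0 := by
  have h₁₂ : δ₁ ≤ δ₂ := by linarith
  have pa := dampingSymbol_pos δ₁ δ₂ hη
  have pb := elasticSymbol_pos σ hη
  have pab := elasticSymbol_le_sq h₁σ hσ₂ hη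
  have he := high_frequency_exp h₁₂ h₂σ hr ht
  have hr0 := rad_pos hη
  rcases hj with rfl | rfl
  · have h := mul_norm_oscSin_le pa pb pab ht
    have hw := rpow_le_one_add_rpow (k := s - 2 * δ₂) (l := max (s - 2 * δ₂) 0) hr
      (le_max_left _ _) (le_max_right _ _)
    obtain ⟨ha, -, -⟩ := high_frequency_symbols h₁₂ h₂σ hr
    have hK : dampingSymbol δ₁ δ₂ η * ‖oscSin (dampingSymbol δ₁ δ₂ η) (elasticSymbol σ η) t‖ ≤
        22 * Real.exp (-(t / 8)) := by linarith
    simp only [kerD₁, if_true, kernel₁, Nat.cast_zero, zero_sub]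
    rw [show s + 2 * (-1) * δ₂ = s - 2 * δ₂ by ring]
    calc _ = rad η ^ (s - 2 * δ₂) * (rad η ^ (2 * δ₂) *
          ‖oscSin (dampingSymbol δ₁ δ₂ η) (elasticSymbol σ η) t‖) := by
          rw [← mul_assoc, ← Real.rpow_add hr0]; ring_nf
      _ ≤ rad η ^ (s - 2 * δ₂) * (dampingSymbol δ₁ δ₂ η *
          ‖oscSin (dampingSymbol δ₁ δ₂ η) (elasticSymbol σ η) t‖) := by gcongr
      _ ≤ (1 + rad η) ^ max (s - 2 * δ₂) 0 * (22 * Real.exp (-(t / 8))) := by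
          exact mul_le_mul hw hK (by positivity) (by positivity)
      _ ≤ _ := by
          rw [mul_comm]; gcongr; norm_num
  · have h := norm_oscSinDeriv_le pa pb pab ht
    have hw := rpow_le_one_add_rpow hr le_rfl hs
    simp only [kerD₁, one_ne_zero, if_false, kernel₁', Nat.cast_one, sub_self, mul_zero, zero_mul,
      add_zero, max_eq_left hs]
    rw [mul_comm]
    gcongr
    linarith [Real.exp_pos (-(t / 8))]

/-- This bound, and the next, serve as majorants on bounded time intervals, for regularity in time;
they give no decay. -/
theorem local_kerD₀ {j : ℕ} (hj : j = 0 ∨ j = 1) {s : ℝ} (hs : 0 ≤ s) (h₁ : 0 < δ₁)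
    (h₁σ : 2 * δ₁ ≤ σ) (hσ₂ : σ ≤ 2 * δ₂) (h₂σ : δ₂ ≤ σ) (hη : η ≠ 0) (ht : 0 ≤ t) :
    rad η ^ s * ‖kerD₀ j σ δ₁ δ₂ t η‖ ≤ (100 + t) * (1 + rad η) ^ (s + 2 * j * δ₂) := by
  have hr0 := rad_pos hη
  rcases le_total 1 (rad η) with hr | hr
  · refine (high_frequency_kerD₀ hj hs h₁ h₁σ hσ₂ h₂σ hη hr ht).trans ?_
    have : Real.exp (-(t / 8)) ≤ 1 := by rw [Real.exp_le_one_iff]; linarith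
    gcongr
    linarith
  · have hδ₂ : 0 < δ₂ := by linarith
    have h₁₂ : δ₁ ≤ δ₂ := by linarith
    have pa := dampingSymbol_pos δ₁ δ₂ hη
    have pb := elasticSymbol_pos σ hη
    have pab := elasticSymbol_le_sq h₁σ hσ₂ hη
    have hexp : Real.exp (-(elasticSymbol σ η * t / (4 * dampingSymbol δ₁ δ₂ η))) ≤ 1 := by
      rw [Real.exp_le_one_iff, neg_nonpos]; positivity
    have hrs : rad η ^ s ≤ 1 := Real.rpow_le_one hr0.le hr hs
    have hw : 1 ≤ (1 + rad η) ^ (s + 2 * j * δ₂) :=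
      Real.one_le_rpow (by linarith) (by positivity)
    have key : ‖kerD₀ j σ δ₁ δ₂ t η‖ ≤ 100 + t := by
      rcases hj with rfl | rfl
      · have h := norm_oscCos_le pa pb pab ht
        simp only [kerD₀, if_true, kernel₀]
        linarith
      · have h := elastic_mul_norm_oscSin_le pa pb pab ht
        obtain ⟨-, ha, -⟩ := low_frequency_symbols (σ := σ) h₁₂ hη hr
        have : rad η ^ (2 * δ₁) ≤ 1 := Real.rpow_le_one hr0.le hr (by positivity)
        simp only [kerD₀, one_ne_zero, if_false, norm_kernel₀' hη]
        nlinarith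
    calc _ ≤ 1 * (100 + t) := by gcongr
      _ ≤ _ := by nlinarith

theorem local_kerD₁ {j : ℕ} (hj : j = 0 ∨ j = 1) {s : ℝ} (hs : 0 ≤ s)
    (h₁σ : 2 * δ₁ ≤ σ) (hσ₂ : σ ≤ 2 * δ₂) (h₂σ : δ₂ ≤ σ) (hη : η ≠ 0) (ht : 0 ≤ t) :
    rad η ^ s * ‖kerD₁ j σ δ₁ δ₂ t η‖ ≤
      (100 + t) * (1 + rad η) ^ max (s + 2 * ((j : ℝ) - 1) * δ₂) 0 := by
  have hr0 := rad_pos hη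
  rcases le_total 1 (rad η) with hr | hr
  · refine (high_frequency_kerD₁ hj hs h₁σ hσ₂ h₂σ hη hr ht).trans ?_
    have : Real.exp (-(t / 8)) ≤ 1 := by rw [Real.exp_le_one_iff]; linarith
    gcongr
    linarith
  · have pa := dampingSymbol_pos δ₁ δ₂ hη
    have pb := elasticSymbol_pos σ hη
    have pab := elasticSymbol_le_sq h₁σ hσ₂ hη
    have hexp : Real.exp (-(elasticSymbol σ η * t / (4 * dampingSymbol δ₁ δ₂ η))) ≤ 1 := by
      rw [Real.exp_le_one_iff, neg_nonpos]; positivity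
    have hrs : rad η ^ s ≤ 1 := Real.rpow_le_one hr0.le hr hs
    have hw : 1 ≤ (1 + rad η) ^ max (s + 2 * ((j : ℝ) - 1) * δ₂) 0 :=
      Real.one_le_rpow (by linarith) (le_max_right _ _)
    have key : ‖kerD₁ j σ δ₁ δ₂ t η‖ ≤ 100 + t := by
      rcases hj with rfl | rfl
      · have h := norm_oscSin_le_self pa pb pab ht
        simp only [kerD₁, if_true, kernel₁]
        linarith
      · have h := norm_oscSinDeriv_le pa pb pab ht
        simp only [kerD₁, one_ne_zero, if_false, kernel₁']
        linarith
    calc _ ≤ 1 * (100 + t) := by gcongr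
      _ ≤ _ := by nlinarith

theorem exp_quarter_le_exp_eighth {a b t : ℝ} (ha : 0 < a) (hb : 0 < b) (ht : 0 ≤ t) :
    Real.exp (-(b * t / (4 * a))) ≤ Real.exp (-(b * t / (8 * a))) := by
  rw [Real.exp_le_exp, neg_le_neg_iff]
  gcongr
  norm_num

theorem low_frequency_kerD₀ {j : ℕ} (hj : j = 0 ∨ j = 1) (h₁σ : 2 * δ₁ ≤ σ) (hσ₂ : σ ≤ 2 * δ₂)
    (hη : η ≠ 0) (hr : rad η ≤ 1) (ht : 0 ≤ t) :
    t ^ j * ‖kerD₀ j σ δ₁ δ₂ t η‖ ≤ 400 * Real.exp (-(rad η ^ (2 * (σ - δ₁)) * t / 16)) := by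
  have pa := dampingSymbol_pos δ₁ δ₂ hη
  have pb := elasticSymbol_pos σ hη
  have pab := elasticSymbol_le_sq h₁σ hσ₂ hη
  refine le_trans ?_ (mul_le_mul_of_nonneg_left
    (low_frequency_exp (δ₂ := δ₂) (by linarith) hη hr ht) (by norm_num))
  have := Real.exp_pos (-(elasticSymbol σ η * t / (8 * dampingSymbol δ₁ δ₂ η)))
  rcases hj with rfl | rfl
  · have h := norm_oscCos_le pa pb pab ht
    have := exp_quarter_le_exp_eighth pa pb ht
    simp only [kerD₀, if_true, kernel₀, pow_zero, one_mul]
    linarith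
  · have h := mul_norm_oscCosDeriv_le pa pb pab ht
    simp only [kerD₀, one_ne_zero, if_false, norm_kernel₀' hη, pow_one]
    linarith

/-- The weight is at most `a`, so the `a`-weighted oscillator bounds apply. The factor `t ^ j` is
available because each time derivative gains `1 / t`. -/
theorem low_frequency_kerD₁ {j : ℕ} (hj : j = 0 ∨ j = 1) (h₁σ : 2 * δ₁ ≤ σ) (hσ₂ : σ ≤ 2 * δ₂)
    (hη : η ≠ 0) (hr : rad η ≤ 1) (ht : 0 ≤ t) :
    rad η ^ (2 * δ₁) * (t ^ j * ‖kerD₁ j σ δ₁ δ₂ t η‖) ≤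
      400 * Real.exp (-(rad η ^ (2 * (σ - δ₁)) * t / 16)) := by
  have pa := dampingSymbol_pos δ₁ δ₂ hη
  have pb := elasticSymbol_pos σ hη
  have pab := elasticSymbol_le_sq h₁σ hσ₂ hη
  have h₁₂ : δ₁ ≤ δ₂ := by linarith
  obtain ⟨ha, -, -⟩ := low_frequency_symbols (σ := σ) h₁₂ hη hr
  refine le_trans ?_ (mul_le_mul_of_nonneg_left
    (low_frequency_exp h₁₂ hη hr ht) (by norm_num))
  refine le_trans (mul_le_mul_of_nonneg_right ha (by positivity)) ?_
  have := Real.exp_pos (-(elasticSymbol σ η * t / (8 * dampingSymbol δ₁ δ₂ η)))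
  rcases hj with rfl | rfl
  · have h := mul_norm_oscSin_le pa pb pab ht
    have := exp_quarter_le_exp_eighth pa pb ht
    simp only [kerD₁, if_true, kernel₁, pow_zero, one_mul]
    linarith
  · have h := mul_mul_norm_oscSinDeriv_le pa pb pab ht
    simp only [kerD₁, one_ne_zero, if_false, kernel₁', pow_one]
    linarith

/-- `∂ₜʲ` of the Fourier transform of the profile. -/
def profD (j : ℕ) (σ δ₁ t : ℝ) (η : EuclideanSpace ℝ (Fin n)) : ℝ :=
  (-rad η ^ (2 * (σ - δ₁))) ^ j * (Real.exp (-t * rad η ^ (2 * (σ - δ₁))) / rad η ^ (2 * δ₁))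

@[fun_prop]
theorem measurable_profD (j : ℕ) (σ δ₁ t : ℝ) : Measurable (profD (n := n) j σ δ₁ t) := by
  unfold profD; fun_prop

/-- The diffusive length scale `t^(-1 / (2 (σ - δ₁)))` on the Fourier side. -/
def scale (σ δ₁ t : ℝ) : ℝ := t ^ (-(1 / (2 * (σ - δ₁))))

theorem scale_pos (ht : 0 < t) : 0 < scale σ δ₁ t := Real.rpow_pos_of_pos ht _

theorem scale_rpow (h : δ₁ < σ) (ht : 0 < t) : scale σ δ₁ t ^ (2 * (σ - δ₁)) = t⁻¹ := by
  rw [scale, ← Real.rpow_mul ht.le, ← Real.rpow_neg_one]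
  congr 1
  have : σ - δ₁ ≠ 0 := by linarith
  field_simp

theorem tendsto_scale (h : δ₁ < σ) : Tendsto (scale σ δ₁) atTop (𝓝 0) :=
  tendsto_rpow_neg_atTop (one_div_pos.2 (by linarith))

/-- Along `r = τ |ξ|` with `|ξ|` fixed, the frequency tends to zero while `t r^(2(σ-δ₁))` stays
constant. This puts the oscillator in the overdamped regime with limit parameter `x =
|ξ|^(2(σ-δ₁))`. -/
theorem tendsto_scale_mul_kerD₁ {j : ℕ} (hj : j = 0 ∨ j = 1) (h₁ : 0 < δ₁)
    (h₁σ : 2 * δ₁ < σ) (hσ₂ : σ ≤ 2 * δ₂) (hη : η ≠ 0) :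
    Tendsto (fun t => ((scale σ δ₁ t ^ (2 * δ₁) * t ^ j : ℝ) : ℂ) *
      kerD₁ j σ δ₁ δ₂ t (scale σ δ₁ t • η)) atTop (𝓝 (profD j σ δ₁ 1 η : ℂ)) := by
  have hR := rad_pos hη
  have hlt : δ₁ < σ := by linarith
  set τ := scale σ δ₁ with hτ
  have hτ0 : Tendsto τ atTop (𝓝 0) := tendsto_scale hlt
  have hpos : ∀ᶠ t : ℝ in atTop, 0 < t := eventually_gt_atTop 0
  set r : ℝ → ℝ := fun t => τ t * rad η with hr
  have hr0 : Tendsto r atTop (𝓝 0) := by simpa using hτ0.mul_const (rad η)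
  have hrpos : ∀ᶠ t in atTop, 0 < r t := hpos.mono fun t ht => mul_pos (scale_pos ht) hR
  have hrη : ∀ᶠ t in atTop, rad (τ t • η) = r t :=
    hpos.mono fun t ht => rad_smul (scale_pos ht).le η
  have hrpow : ∀ k : ℝ, 0 < k → Tendsto (fun t => r t ^ k) atTop (𝓝 0) := fun k hk => by
    simpa [Real.zero_rpow hk.ne'] using hr0.rpow_const (p := k) (Or.inr hk.le)
  have htr : ∀ᶠ t in atTop, t * r t ^ (2 * (σ - δ₁)) = rad η ^ (2 * (σ - δ₁)) :=
    hpos.mono fun t ht => by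
      change t * (scale σ δ₁ t * rad η) ^ (2 * (σ - δ₁)) = _
      rw [Real.mul_rpow (scale_pos ht).le hR.le, scale_rpow hlt ht, ← mul_assoc,
        mul_inv_cancel₀ ht.ne', one_mul]
  set a : ℝ → ℝ := fun t => r t ^ (2 * δ₁) + r t ^ (2 * δ₂) with ha
  set b : ℝ → ℝ := fun t => r t ^ (2 * σ) with hb
  have hapos : ∀ᶠ t in atTop, 0 < a t := hrpos.mono fun t ht => by positivity
  have hbpos : ∀ᶠ t in atTop, 0 < b t := hrpos.mono fun t ht => by positivity
  -- The relative correction to the leading damping: `a = r^(2δ₁) q` with `q → 1` since `δ₁ < δ₂`.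
  set q : ℝ → ℝ := fun t => 1 + r t ^ (2 * (δ₂ - δ₁)) with hq
  have hq1 : Tendsto q atTop (𝓝 1) := by
    simpa using (hrpow (2 * (δ₂ - δ₁)) (by linarith)).const_add 1
  have haq : ∀ᶠ t in atTop, a t = r t ^ (2 * δ₁) * q t := hrpos.mono fun t ht => by
    simp only [ha, hq]
    rw [mul_add, mul_one, ← Real.rpow_add ht]; ring_nf
  have hba : Tendsto (fun t => b t / a t ^ 2) atTop (𝓝 0) := by
    have h := (hrpow (2 * (σ - 2 * δ₁)) (by linarith)).div (hq1.pow 2) (by norm_num)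
    rw [one_pow, div_one] at h
    refine h.congr' ?_
    filter_upwards [hrpos, haq] with t ht e
    have e2 : b t = r t ^ (2 * (σ - 2 * δ₁)) * (r t ^ (2 * δ₁)) ^ 2 := by
      rw [← Real.rpow_mul_natCast ht.le, ← Real.rpow_add ht]
      simp only [hb]; push_cast; ring_nf
    have : 0 < r t ^ (2 * δ₁) := by positivity
    have : 0 < q t := by simp only [hq]; positivity
    simp only [Pi.div_apply]
    rw [e, e2]
    field_simp
  have hx : Tendsto (fun t => t * b t / a t) atTop (𝓝 (rad η ^ (2 * (σ - δ₁)))) := by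
    have h := (tendsto_const_nhds (x := rad η ^ (2 * (σ - δ₁))) (f := atTop)).div hq1 (by norm_num)
    rw [div_one] at h
    refine h.congr' ?_
    filter_upwards [hrpos, haq, htr] with t ht e e1
    have e2 : b t = r t ^ (2 * (σ - δ₁)) * r t ^ (2 * δ₁) := by
      rw [← Real.rpow_add ht]
      simp only [hb]; ring_nf
    have : 0 < r t ^ (2 * δ₁) := by positivity
    have : 0 < q t := by simp only [hq]; positivity
    simp only [Pi.div_apply]
    rw [← e1, e, e2]
    field_simp
  -- Indeed `t a ≥ t r^(2δ₁) = |ξ|^(2(σ-δ₁)) r^(-2(σ-2δ₁))`, which diverges because `2δ₁ < σ`.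
  have hat : Tendsto (fun t => a t * t) atTop atTop := by
    have h := ((hrpow (2 * (σ - 2 * δ₁)) (by linarith)))
    have h' : Tendsto (fun t => r t ^ (2 * (σ - 2 * δ₁))) atTop (𝓝[>] 0) :=
      tendsto_nhdsWithin_iff.2 ⟨h, hrpos.mono fun t ht => Real.rpow_pos_of_pos ht _⟩
    have hinv := h'.inv_tendsto_nhdsGT_zero.const_mul_atTop
      (Real.rpow_pos_of_pos hR (2 * (σ - δ₁)))
    refine tendsto_atTop_mono' _ ?_ hinv
    filter_upwards [hrpos, htr, hpos] with t ht e1 ht0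
    have : r t ^ (2 * (σ - δ₁)) * (r t ^ (2 * (σ - 2 * δ₁)))⁻¹ = r t ^ (2 * δ₁) := by
      rw [← Real.rpow_neg ht.le, ← Real.rpow_add ht]; ring_nf
    simp only [Pi.inv_apply]
    rw [← e1, mul_assoc, this, mul_comm]
    gcongr
    simp only [ha]
    have : 0 < r t ^ (2 * δ₂) := by positivity
    linarith
  have ht0 : ∀ᶠ t : ℝ in atTop, 0 ≤ t := eventually_ge_atTop 0
  have hfac : Tendsto (fun t => ((rad η ^ (2 * δ₁) * q t : ℝ) : ℂ)⁻¹) atTop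
      (𝓝 ((rad η ^ (2 * δ₁) : ℝ) : ℂ)⁻¹) := by
    have h := hq1.const_mul (rad η ^ (2 * δ₁))
    rw [mul_one] at h
    refine ((Complex.continuous_ofReal.tendsto _).comp h).inv₀ ?_
    have : 0 < rad η ^ (2 * δ₁) := by positivity
    exact_mod_cast this.ne'
  have hfac' : ∀ᶠ t in atTop, ((τ t ^ (2 * δ₁) : ℝ) : ℂ) =
      ((rad η ^ (2 * δ₁) * q t : ℝ) : ℂ)⁻¹ * (a t : ℂ) := by
    filter_upwards [hpos, hrpos, haq] with t ht hrt e
    have e1 : r t ^ (2 * δ₁) = τ t ^ (2 * δ₁) * rad η ^ (2 * δ₁) :=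
      Real.mul_rpow (scale_pos ht).le hR.le
    have h1 : 0 < rad η ^ (2 * δ₁) := by positivity
    have h2 : 0 < q t := by simp only [hq]; positivity
    rw [← Complex.ofReal_inv, ← Complex.ofReal_mul, e, e1]
    congr 1
    field_simp
  rcases hj with rfl | rfl
  · have h := hfac.mul (tendsto_mul_oscSin hapos hbpos ht0 hba hx hat)
    have e : ((rad η ^ (2 * δ₁) : ℝ) : ℂ)⁻¹ * ((Real.exp (-rad η ^ (2 * (σ - δ₁))) : ℝ) : ℂ)
        = (profD 0 σ δ₁ 1 η : ℂ) := by
      rw [profD, pow_zero, one_mul, neg_one_mul, div_eq_inv_mul]; push_cast; rfl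
    rw [e] at h
    refine h.congr' ?_
    filter_upwards [hfac', hrη] with t e1 e2
    simp only [kerD₁, if_true, kernel₁, dampingSymbol, elasticSymbol, e2, pow_zero, mul_one, e1]
    ring
  · have h := hfac.mul (tendsto_mul_mul_oscSinDeriv hapos hbpos ht0 hba hx hat)
    have e : ((rad η ^ (2 * δ₁) : ℝ) : ℂ)⁻¹ * ((-rad η ^ (2 * (σ - δ₁)) *
        Real.exp (-rad η ^ (2 * (σ - δ₁))) : ℝ) : ℂ) = (profD 1 σ δ₁ 1 η : ℂ) := by
      rw [profD, pow_one, neg_one_mul, div_eq_inv_mul]; push_cast; ring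
    rw [e] at h
    refine h.congr' ?_
    filter_upwards [hfac', hrη] with t e1 e2
    simp only [kerD₁, one_ne_zero, if_false, kernel₁', dampingSymbol, elasticSymbol, e2, pow_one]
    rw [Complex.ofReal_mul (τ t ^ (2 * δ₁)), e1]
    ring

end KernelBounds

/-! ### Regularity and asymptotics of the solution and of the profile in `L²` -/

section Asymptotic

variable {n : ℕ}

/-- `|ξ|^s ∂ₜʲ` of the Fourier transform of the solution with transformed data `V₀`, `V₁`. -/
def solD (j : ℕ) (σ δ₁ δ₂ s : ℝ) (V₀ V₁ : EuclideanSpace ℝ (Fin n) → ℂ) (t : ℝ)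
    (η : EuclideanSpace ℝ (Fin n)) : ℂ :=
  ((rad η ^ s : ℝ) : ℂ) * (kerD₀ j σ δ₁ δ₂ t η * V₀ η + kerD₁ j σ δ₁ δ₂ t η * V₁ η)

/-- `|ξ|^s ∂ₜʲ` of the Fourier transform of the profile. -/
def profS (j : ℕ) (σ δ₁ s t : ℝ) (η : EuclideanSpace ℝ (Fin n)) : ℂ :=
  ((rad η ^ s * profD j σ δ₁ t η : ℝ) : ℂ)

/-- The weighted square integrability of the transformed data needed for `j` time derivatives. -/
structure DataWeights (j : ℕ) (δ₂ s : ℝ) (V₀ V₁ : EuclideanSpace ℝ (Fin n) → ℂ) : Prop where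
  measurable₀ : Measurable V₀
  measurable₁ : Measurable V₁
  memLp₀ : MemLp (fun η => (1 + rad η) ^ (s + 2 * j * δ₂) * ‖V₀ η‖) 2 volume
  memLp₁ : MemLp (fun η => (1 + rad η) ^ max (s + 2 * ((j : ℝ) - 1) * δ₂) 0 * ‖V₁ η‖) 2 volume

/-- The weight dominating `solD`. -/
def dataBound (j : ℕ) (δ₂ s : ℝ) (V₀ V₁ : EuclideanSpace ℝ (Fin n) → ℂ)
    (η : EuclideanSpace ℝ (Fin n)) : ℝ :=
  (1 + rad η) ^ (s + 2 * j * δ₂) * ‖V₀ η‖ +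
    (1 + rad η) ^ max (s + 2 * ((j : ℝ) - 1) * δ₂) 0 * ‖V₁ η‖

variable {σ δ₁ δ₂ s : ℝ} {j : ℕ} {V₀ V₁ : EuclideanSpace ℝ (Fin n) → ℂ}

theorem DataWeights.memLp_dataBound (hV : DataWeights j δ₂ s V₀ V₁) :
    MemLp (dataBound j δ₂ s V₀ V₁) 2 volume := hV.memLp₀.add hV.memLp₁

theorem DataWeights.measurable_solD (hV : DataWeights j δ₂ s V₀ V₁) (t : ℝ) :
    Measurable (solD j σ δ₁ δ₂ s V₀ V₁ t) := by
  have h0 := hV.measurable₀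
  have h1 := hV.measurable₁
  have k0 := measurable_kerD₀ (n := n) j σ δ₁ δ₂ t
  have k1 := measurable_kerD₁ (n := n) j σ δ₁ δ₂ t
  unfold solD
  fun_prop

theorem norm_solD_le {C t : ℝ} {η : EuclideanSpace ℝ (Fin n)}
    (h0 : rad η ^ s * ‖kerD₀ j σ δ₁ δ₂ t η‖ ≤ C * (1 + rad η) ^ (s + 2 * j * δ₂))
    (h1 : rad η ^ s * ‖kerD₁ j σ δ₁ δ₂ t η‖ ≤
      C * (1 + rad η) ^ max (s + 2 * ((j : ℝ) - 1) * δ₂) 0) :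
    ‖solD j σ δ₁ δ₂ s V₀ V₁ t η‖ ≤ C * dataBound j δ₂ s V₀ V₁ η := by
  have hr := rad_nonneg η
  rw [solD, norm_mul, Complex.norm_real, Real.norm_of_nonneg (by positivity)]
  calc _ ≤ rad η ^ s * (‖kerD₀ j σ δ₁ δ₂ t η‖ * ‖V₀ η‖ + ‖kerD₁ j σ δ₁ δ₂ t η‖ * ‖V₁ η‖) := by
        gcongr; exact (norm_add_le _ _).trans (by simp only [norm_mul, le_refl])
    _ = (rad η ^ s * ‖kerD₀ j σ δ₁ δ₂ t η‖) * ‖V₀ η‖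
        + (rad η ^ s * ‖kerD₁ j σ δ₁ δ₂ t η‖) * ‖V₁ η‖ := by ring
    _ ≤ (C * (1 + rad η) ^ (s + 2 * j * δ₂)) * ‖V₀ η‖
        + (C * (1 + rad η) ^ max (s + 2 * ((j : ℝ) - 1) * δ₂) 0) * ‖V₁ η‖ := by gcongr
    _ = _ := by rw [dataBound]; ring

theorem norm_solD_le_local (hj : j = 0 ∨ j = 1) (hs : 0 ≤ s) (h₁ : 0 < δ₁)
    (h₁σ : 2 * δ₁ ≤ σ) (hσ₂ : σ ≤ 2 * δ₂) (h₂σ : δ₂ ≤ σ) {η : EuclideanSpace ℝ (Fin n)}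
    (hη : η ≠ 0) {t T : ℝ} (ht : 0 ≤ t) (hT : t ≤ T) :
    ‖solD j σ δ₁ δ₂ s V₀ V₁ t η‖ ≤ (100 + T) * dataBound j δ₂ s V₀ V₁ η := by
  have hr := rad_nonneg η
  refine norm_solD_le ((local_kerD₀ hj hs h₁ h₁σ hσ₂ h₂σ hη ht).trans ?_)
    ((local_kerD₁ hj hs h₁σ hσ₂ h₂σ hη ht).trans ?_) <;> gcongr

theorem DataWeights.memLp_solD (hV : DataWeights j δ₂ s V₀ V₁) (hn : 0 < n)
    (hj : j = 0 ∨ j = 1) (hs : 0 ≤ s) (h₁ : 0 < δ₁)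
    (h₁σ : 2 * δ₁ ≤ σ) (hσ₂ : σ ≤ 2 * δ₂) (h₂σ : δ₂ ≤ σ) {t : ℝ} (ht : 0 ≤ t) :
    MemLp (solD j σ δ₁ δ₂ s V₀ V₁ t) 2 volume := by
  refine (hV.memLp_dataBound.const_mul (100 + t)).mono'
    (hV.measurable_solD t).aestronglyMeasurable ?_
  filter_upwards [ae_ne_zero hn] with η hη
  exact norm_solD_le_local hj hs h₁ h₁σ hσ₂ h₂σ hη ht le_rfl

theorem DataWeights.continuousOn_solD (hV : DataWeights j δ₂ s V₀ V₁) (hn : 0 < n)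
    (hj : j = 0 ∨ j = 1) (hs : 0 ≤ s) (h₁ : 0 < δ₁)
    (h₁σ : 2 * δ₁ ≤ σ) (hσ₂ : σ ≤ 2 * δ₂) (h₂σ : δ₂ ≤ σ) :
    ContinuousOn (fun t => toL2 volume (solD j σ δ₁ δ₂ s V₀ V₁ t)) (Ioi 0) := by
  intro t₀ ht₀
  refine ContinuousAt.continuousWithinAt ?_
  have ht₀ : 0 < t₀ := ht₀
  refine tendsto_toL2 (hV.memLp_dataBound.const_mul (100 + (t₀ + 1)))
    (fun t => (hV.measurable_solD t).aestronglyMeasurable)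
    (hV.measurable_solD t₀).aestronglyMeasurable ?_ ?_ ?_
  · filter_upwards [Ioo_mem_nhds ht₀ (lt_add_one t₀)] with t ht
    filter_upwards [ae_ne_zero hn] with η hη
    exact norm_solD_le_local hj hs h₁ h₁σ hσ₂ h₂σ hη ht.1.le ht.2.le
  · filter_upwards [ae_ne_zero hn] with η hη
    exact norm_solD_le_local hj hs h₁ h₁σ hσ₂ h₂σ hη ht₀.le (by linarith)
  · refine .of_forall fun η => Continuous.tendsto ?_ t₀
    have := continuous_kerD₀ j σ δ₁ δ₂ η
    have := continuous_kerD₁ j σ δ₁ δ₂ η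
    unfold solD
    fun_prop

theorem DataWeights.hasDerivAt_solD (hV : DataWeights 0 δ₂ s V₀ V₁) (hV' : DataWeights 1 δ₂ s V₀ V₁)
    (hn : 0 < n) (hs : 0 ≤ s) (h₁ : 0 < δ₁)
    (h₁σ : 2 * δ₁ ≤ σ) (hσ₂ : σ ≤ 2 * δ₂) (h₂σ : δ₂ ≤ σ) {t₀ : ℝ} (ht₀ : 0 < t₀) :
    HasDerivAt (fun t => toL2 volume (solD 0 σ δ₁ δ₂ s V₀ V₁ t))
      (toL2 volume (solD 1 σ δ₁ δ₂ s V₀ V₁ t₀)) t₀ := by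
  have hmem : Ioo 0 (t₀ + 1) ∈ 𝓝 t₀ := Ioo_mem_nhds ht₀ (lt_add_one t₀)
  refine HasDerivWithinAt.hasDerivAt ?_ hmem
  refine hasDerivWithinAt_toL2 (m' := solD 1 σ δ₁ δ₂ s V₀ V₁) (convex_Ioo _ _)
    (mem_of_mem_nhds hmem)
    (hV'.memLp_dataBound.const_mul (100 + (t₀ + 1)))
    (fun t ht => hV.memLp_solD hn (.inl rfl) hs h₁ h₁σ hσ₂ h₂σ ht.1.le)
    (hV'.measurable_solD t₀).aestronglyMeasurable ?_
  filter_upwards [ae_ne_zero hn] with η hη t ht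
  refine ⟨HasDerivAt.hasDerivWithinAt ?_,
    norm_solD_le_local (.inr rfl) hs h₁ h₁σ hσ₂ h₂σ hη ht.1.le ht.2.le⟩
  exact (((hasDerivAt_kerD₀ σ δ₁ δ₂ t η).mul_const (V₀ η)).add
    ((hasDerivAt_kerD₁ σ δ₁ δ₂ t η).mul_const (V₁ η))).const_mul ((rad η ^ s : ℝ) : ℂ)

@[fun_prop]
theorem measurable_profS (j : ℕ) (σ δ₁ s t : ℝ) : Measurable (profS (n := n) j σ δ₁ s t) := by
  unfold profS; fun_prop

/-- Monotone in time, so one majorant serves all times `t ≥ ε`; positivity of `ε` will give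
integrability at infinity. -/
theorem norm_profS_le {ε t : ℝ} (ht : ε ≤ t) {η : EuclideanSpace ℝ (Fin n)} (hη : η ≠ 0) :
    ‖profS j σ δ₁ s t η‖ ≤ rad η ^ (s - 2 * δ₁ + 2 * (σ - δ₁) * j) *
      Real.exp (-ε * rad η ^ (2 * (σ - δ₁))) := by
  have hr := rad_pos hη
  rw [profS, profD, Complex.norm_real, norm_mul, norm_mul, norm_pow, norm_neg,
    Real.norm_of_nonneg (by positivity), Real.norm_of_nonneg (by positivity),
    Real.norm_of_nonneg (by positivity), Real.rpow_add hr, Real.rpow_sub hr,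
    Real.rpow_mul_natCast hr.le]
  calc _ = rad η ^ s / rad η ^ (2 * δ₁) * (rad η ^ (2 * (σ - δ₁))) ^ j *
        Real.exp (-t * rad η ^ (2 * (σ - δ₁))) := by ring
    _ ≤ _ := by
      gcongr

/-- The worst case at the origin is the power `-2δ₁`, square integrable precisely when `n > 4δ₁`. -/
theorem memLp_profS_bound (hn : 4 * δ₁ < n) (hs : 0 ≤ s) (h₁ : 0 < δ₁) (h₁σ : δ₁ < σ) (j : ℕ)
    {ε : ℝ} (hε : 0 < ε) :
    MemLp (fun η : EuclideanSpace ℝ (Fin n) => rad η ^ (s - 2 * δ₁ + 2 * (σ - δ₁) * j) *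
      Real.exp (-ε * rad η ^ (2 * (σ - δ₁)))) 2 volume := by
  have h : 0 < σ - δ₁ := by linarith
  have h' : 0 ≤ (σ - δ₁) * j := by positivity
  have hn0 : 0 < n := by
    have : (0 : ℝ) < n := by linarith
    exact_mod_cast this
  exact memLp_rad_rpow_mul_exp hn0 (by linarith) hε (by positivity)

theorem pos_of_four_mul_lt (hn : 4 * δ₁ < n) (h₁ : 0 < δ₁) : 0 < n := by
  have : (0 : ℝ) < n := by linarith
  exact_mod_cast this

theorem memLp_profS (hn : 4 * δ₁ < n) (hs : 0 ≤ s) (h₁ : 0 < δ₁) (h₁σ : δ₁ < σ) (j : ℕ)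
    {t : ℝ} (ht : 0 < t) : MemLp (profS (n := n) j σ δ₁ s t) 2 volume := by
  refine (memLp_profS_bound hn hs h₁ h₁σ j ht).mono'
    (measurable_profS j σ δ₁ s t).aestronglyMeasurable ?_
  filter_upwards [ae_ne_zero (pos_of_four_mul_lt hn h₁)] with η hη
  exact norm_profS_le le_rfl hη

theorem continuousOn_profS (hn : 4 * δ₁ < n) (hs : 0 ≤ s) (h₁ : 0 < δ₁) (h₁σ : δ₁ < σ) (j : ℕ) :
    ContinuousOn (fun t => toL2 volume (profS (n := n) j σ δ₁ s t)) (Ioi 0) := by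
  intro t₀ ht₀
  refine ContinuousAt.continuousWithinAt ?_
  have ht₀ : 0 < t₀ := ht₀
  refine tendsto_toL2 (memLp_profS_bound hn hs h₁ h₁σ j (half_pos ht₀))
    (fun t => (measurable_profS j σ δ₁ s t).aestronglyMeasurable)
    (measurable_profS j σ δ₁ s t₀).aestronglyMeasurable ?_ ?_ ?_
  · filter_upwards [Ioi_mem_nhds (half_lt_self ht₀)] with t ht
    filter_upwards [ae_ne_zero (pos_of_four_mul_lt hn h₁)] with η hη
    exact norm_profS_le (le_of_lt ht) hη
  · filter_upwards [ae_ne_zero (pos_of_four_mul_lt hn h₁)] with η hη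
    exact norm_profS_le (half_le_self ht₀.le) hη
  · refine .of_forall fun η => Continuous.tendsto ?_ t₀
    unfold profS profD
    fun_prop

theorem hasDerivAt_profS (hn : 4 * δ₁ < n) (hs : 0 ≤ s) (h₁ : 0 < δ₁) (h₁σ : δ₁ < σ)
    {t₀ : ℝ} (ht₀ : 0 < t₀) :
    HasDerivAt (fun t => toL2 volume (profS (n := n) 0 σ δ₁ s t))
      (toL2 volume (profS 1 σ δ₁ s t₀)) t₀ := by
  have hmem : Ioi (t₀ / 2) ∈ 𝓝 t₀ := Ioi_mem_nhds (half_lt_self ht₀)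
  refine HasDerivWithinAt.hasDerivAt ?_ hmem
  refine hasDerivWithinAt_toL2 (m' := profS 1 σ δ₁ s) (convex_Ioi _) (mem_of_mem_nhds hmem)
    (memLp_profS_bound hn hs h₁ h₁σ 1 (half_pos ht₀))
    (fun t ht => memLp_profS hn hs h₁ h₁σ 0 ((half_pos ht₀).trans ht))
    (measurable_profS 1 σ δ₁ s t₀).aestronglyMeasurable ?_
  filter_upwards [ae_ne_zero (pos_of_four_mul_lt hn h₁)] with η hη t ht
  refine ⟨HasDerivAt.hasDerivWithinAt ?_, norm_profS_le (le_of_lt ht) hη⟩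
  have h := (((((hasDerivAt_id t).neg.mul_const (rad η ^ (2 * (σ - δ₁)))).exp).div_const
    (rad η ^ (2 * δ₁))).const_mul (rad η ^ s)).ofReal_comp
  simp only [profS, profD, pow_zero, one_mul, pow_one]
  refine h.congr_deriv ?_
  congr 1
  simp only [Pi.neg_apply, id]
  ring

/-! ### Self-similarity and diffusive scaling -/

theorem scale_rpow_eq {t : ℝ} (h0 : 0 < t) (x : ℝ) :
    scale σ δ₁ t ^ x = t ^ (-(x / (2 * (σ - δ₁)))) := by
  rw [scale, ← Real.rpow_mul h0.le]
  ring_nf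

/-- The origin of the exponent `ρ`: `τ^(n/2)` comes from the `L²` dilation, `τ^s` from `|D|^s`,
`τ^(2δ₁)` from the singularity of the profile, and `t ^ j` from the time derivatives. -/
theorem scaling_factor (h₁σ : δ₁ < σ) {t : ℝ} (ht : 0 < t) :
    t ^ (-rate n σ δ₁ s j) * scale σ δ₁ t ^ ((n : ℝ) / 2) * scale σ δ₁ t ^ s =
      scale σ δ₁ t ^ (2 * δ₁) * t ^ j := by
  have h : σ - δ₁ ≠ 0 := by linarith
  rw [scale_rpow_eq ht, scale_rpow_eq ht, scale_rpow_eq ht, ← Real.rpow_natCast,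
    ← Real.rpow_add ht, ← Real.rpow_add ht, ← Real.rpow_add ht, rate]
  congr 1
  field_simp
  ring

theorem profD_dilate (h₁σ : δ₁ < σ) {t : ℝ} (ht : 0 < t) (η : EuclideanSpace ℝ (Fin n)) :
    scale σ δ₁ t ^ (2 * δ₁) * t ^ j * profD j σ δ₁ t (scale σ δ₁ t • η) = profD j σ δ₁ 1 η := by
  have hτ := scale_pos (σ := σ) (δ₁ := δ₁) ht
  have hr := rad_nonneg η
  have h2 : 0 < scale σ δ₁ t ^ (2 * δ₁) := by positivity
  rw [profD, profD, rad_smul hτ.le, Real.mul_rpow hτ.le hr, Real.mul_rpow hτ.le hr,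
    scale_rpow h₁σ ht]
  rw [show -t * (t⁻¹ * rad η ^ (2 * (σ - δ₁))) = -1 * rad η ^ (2 * (σ - δ₁)) by field_simp,
    show -(t⁻¹ * rad η ^ (2 * (σ - δ₁))) = t⁻¹ * (-rad η ^ (2 * (σ - δ₁))) by ring, mul_pow]
  rw [inv_pow, mul_comm (scale σ δ₁ t ^ (2 * δ₁)) (rad η ^ (2 * δ₁)), ← div_div]
  field_simp

theorem norm_scaled_toL2 {f : EuclideanSpace ℝ (Fin n) → ℂ} (hfm : Measurable f)
    (hf : MemLp f 2 volume) {t c : ℝ} (ht : 0 < t) (hc : 0 ≤ c) :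
    ‖toL2 volume fun η =>
      ((c * scale σ δ₁ t ^ ((n : ℝ) / 2) : ℝ) : ℂ) * f (scale σ δ₁ t • η)‖
      = c * ‖toL2 volume f‖ := by
  have hτ := scale_pos (σ := σ) (δ₁ := δ₁) ht
  have h := norm_toL2_dilate (hfm.const_mul (c : ℂ)) (hf.const_mul (c : ℂ)) hτ
  have e : (fun η : EuclideanSpace ℝ (Fin n) =>
      ((c * scale σ δ₁ t ^ ((n : ℝ) / 2) : ℝ) : ℂ) * f (scale σ δ₁ t • η)) = fun η =>
      ((scale σ δ₁ t ^ ((n : ℝ) / 2) : ℝ) : ℂ) * ((c : ℂ) * f (scale σ δ₁ t • η)) := by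
    funext η; push_cast; ring
  rw [e, h]
  have := toL2_const_smul hf c
  simp only [Complex.real_smul] at this
  rw [this, norm_smul, Real.norm_of_nonneg hc]

theorem profS_dilate (h₁σ : δ₁ < σ) {t : ℝ} (ht : 0 < t) (η : EuclideanSpace ℝ (Fin n)) :
    ((t ^ (-rate n σ δ₁ s j) * scale σ δ₁ t ^ ((n : ℝ) / 2) : ℝ) : ℂ) *
      profS j σ δ₁ s t (scale σ δ₁ t • η) = profS j σ δ₁ s 1 η := by
  have hτ := scale_pos (σ := σ) (δ₁ := δ₁) ht
  rw [profS, profS, ← Complex.ofReal_mul, rad_smul hτ.le, Real.mul_rpow hτ.le (rad_nonneg η),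
    ← profD_dilate h₁σ ht η, ← scaling_factor (n := n) (s := s) h₁σ ht]
  congr 1
  ring

/-- After the norm preserving dilation the profile is the one at time `1`, so its norm is an exact
power of `t`. -/
theorem norm_profS (hn : 4 * δ₁ < n) (hs : 0 ≤ s) (h₁ : 0 < δ₁) (h₁σ : δ₁ < σ) (j : ℕ)
    {t : ℝ} (ht : 0 < t) : ‖toL2 volume (profS (n := n) j σ δ₁ s t)‖ =
      ‖toL2 volume (profS (n := n) j σ δ₁ s 1)‖ * t ^ rate n σ δ₁ s j := by
  have h := norm_scaled_toL2 (σ := σ) (δ₁ := δ₁) (measurable_profS (n := n) j σ δ₁ s t)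
    (memLp_profS hn hs h₁ h₁σ j ht) ht (Real.rpow_nonneg ht.le (-rate n σ δ₁ s j))
  simp only [profS_dilate h₁σ ht] at h
  rw [h, Real.rpow_neg ht.le]
  have : 0 < t ^ rate n σ δ₁ s j := by positivity
  field_simp

theorem norm_profS_one_pos (hn : 4 * δ₁ < n) (hs : 0 ≤ s) (h₁ : 0 < δ₁) (h₁σ : δ₁ < σ) (j : ℕ) :
    0 < ‖toL2 volume (profS (n := n) j σ δ₁ s 1)‖ := by
  rw [norm_pos_iff]
  intro h0
  have h := coeFn_toL2 (memLp_profS (n := n) hn hs h₁ h₁σ j one_pos)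
  rw [h0] at h
  have hF : ∀ᵐ η : EuclideanSpace ℝ (Fin n), False := by
    filter_upwards [h, ae_ne_zero (pos_of_four_mul_lt hn h₁),
      Lp.coeFn_zero ℂ 2 (volume : Measure (EuclideanSpace ℝ (Fin n)))] with η e1 e2 e3
    rw [e3, Pi.zero_apply, profS, profD] at e1
    have hr := rad_pos e2
    have h1 : rad η ^ (2 * (σ - δ₁)) ≠ 0 := by positivity
    have : rad η ^ s * ((-rad η ^ (2 * (σ - δ₁))) ^ j *
        (Real.exp (-1 * rad η ^ (2 * (σ - δ₁))) / rad η ^ (2 * δ₁))) ≠ 0 :=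
      mul_ne_zero (by positivity) (mul_ne_zero (pow_ne_zero _ (neg_ne_zero.2 h1)) (by positivity))
    exact this (by exact_mod_cast e1.symm)
  exact hF.exists.elim fun _ h => h

/-- The high frequency part of the solution decays exponentially. -/
theorem DataWeights.tendsto_high (hV : DataWeights j δ₂ s V₀ V₁) (hn : 0 < n)
    (hj : j = 0 ∨ j = 1) (hs : 0 ≤ s) (h₁ : 0 < δ₁)
    (h₁σ : 2 * δ₁ ≤ σ) (hσ₂ : σ ≤ 2 * δ₂) (h₂σ : δ₂ ≤ σ) (k : ℝ) :
    Tendsto (fun t : ℝ => t ^ k *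
      ‖toL2 volume ({η | rad η ≤ 1}ᶜ.indicator (solD j σ δ₁ δ₂ s V₀ V₁ t))‖) atTop (𝓝 0) := by
  have hDm : MeasurableSet {η : EuclideanSpace ℝ (Fin n) | rad η ≤ 1} :=
    measurableSet_le measurable_rad measurable_const
  set g : L2 n := toL2 volume fun η => (dataBound j δ₂ s V₀ V₁ η : ℂ)
  have hg : g =ᵐ[volume] fun η => (dataBound j δ₂ s V₀ V₁ η : ℂ) :=
    coeFn_toL2 (hV.memLp_dataBound.ofReal (K := ℂ))
  -- Exponential decay beats every power, in particular `t^(-ρ)`.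
  have hlim := (tendsto_rpow_mul_exp_neg_mul_atTop_nhds_zero k (1 / 8) (by norm_num)).mul_const
    (100 * ‖g‖)
  rw [zero_mul] at hlim
  refine squeeze_zero' ((eventually_ge_atTop 0).mono fun t ht => by positivity) ?_ hlim
  filter_upwards [eventually_ge_atTop 0] with t ht
  have hb : ‖toL2 volume ({η | rad η ≤ 1}ᶜ.indicator (solD j σ δ₁ δ₂ s V₀ V₁ t))‖
      ≤ (100 * Real.exp (-(t / 8))) * ‖g‖ := by
    refine norm_toL2_le_of_norm_le
      ((hV.measurable_solD t).indicator hDm.compl).aestronglyMeasurable ?_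
    filter_upwards [ae_ne_zero hn, hg] with η hη e
    have hd : 0 ≤ dataBound j δ₂ s V₀ V₁ η := by
      have := rad_nonneg η; unfold dataBound; positivity
    rw [e]
    rw [Complex.norm_real, Real.norm_of_nonneg hd]
    by_cases hr : rad η ≤ 1
    · rw [indicator_of_notMem (by simpa using hr), norm_zero]; positivity
    · rw [indicator_of_mem (by simpa using hr)]
      push Not at hr
      exact norm_solD_le (high_frequency_kerD₀ hj hs h₁ h₁σ hσ₂ h₂σ hη hr.le ht)
        (high_frequency_kerD₁ hj hs h₁σ hσ₂ h₂σ hη hr.le ht)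
  calc _ ≤ t ^ k * ((100 * Real.exp (-(t / 8))) * ‖g‖) := by gcongr
    _ = _ := by rw [show -(t / 8) = -(1 / 8) * t by ring]; ring

/-- The low frequency part of the solution, minus its profile, in diffusive variables. -/
def scaledDiff (j : ℕ) (σ δ₁ δ₂ s : ℝ) (V₀ V₁ : EuclideanSpace ℝ (Fin n) → ℂ) (t : ℝ)
    (η : EuclideanSpace ℝ (Fin n)) : ℂ :=
  ((rad η ^ s : ℝ) : ℂ) * ({η | rad η ≤ 1}.indicator (fun η =>
    ((scale σ δ₁ t ^ (2 * δ₁) * t ^ j : ℝ) : ℂ) * (kerD₀ j σ δ₁ δ₂ t η * V₀ η +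
      kerD₁ j σ δ₁ δ₂ t η * V₁ η)) (scale σ δ₁ t • η) - V₁ 0 * profD j σ δ₁ 1 η)

theorem scaledDiff_eq (h₁σ : δ₁ < σ) {t : ℝ} (ht : 0 < t) (η : EuclideanSpace ℝ (Fin n)) :
    ((t ^ (-rate n σ δ₁ s j) * scale σ δ₁ t ^ ((n : ℝ) / 2) : ℝ) : ℂ) *
      ({η | rad η ≤ 1}.indicator (solD j σ δ₁ δ₂ s V₀ V₁ t) (scale σ δ₁ t • η) -
        V₁ 0 * profS j σ δ₁ s t (scale σ δ₁ t • η)) = scaledDiff j σ δ₁ δ₂ s V₀ V₁ t η := by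
  have hτ := scale_pos (σ := σ) (δ₁ := δ₁) ht
  have hp := profS_dilate (n := n) (s := s) (j := j) h₁σ ht η
  rw [mul_sub, mul_left_comm, hp, scaledDiff, mul_sub, profS]
  congr 1
  · by_cases h : rad (scale σ δ₁ t • η) ≤ 1
    · rw [indicator_of_mem (by exact h), indicator_of_mem (by exact h), solD, rad_smul hτ.le,
        Real.mul_rpow hτ.le (rad_nonneg η), ← scaling_factor (n := n) (s := s) h₁σ ht]
      push_cast
      ring
    · rw [indicator_of_notMem (by exact h), indicator_of_notMem (by exact h), mul_zero, mul_zero]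
  · push_cast; ring

/-- In diffusive variables the low frequency decay factor no longer depends on `t`. The two kernels
contribute `400 K` each, and the second summand bounds the profile at time `1`. -/
theorem norm_scaledDiff_le (hj : j = 0 ∨ j = 1) (h₁ : 0 < δ₁) (h₁σ : 2 * δ₁ < σ)
    (hσ₂ : σ ≤ 2 * δ₂) {K : ℝ} (hK₀ : ∀ η, ‖V₀ η‖ ≤ K) (hK₁ : ∀ η, ‖V₁ η‖ ≤ K) {t : ℝ}
    (ht : 0 < t) {η : EuclideanSpace ℝ (Fin n)} (hη : η ≠ 0) :
    ‖scaledDiff j σ δ₁ δ₂ s V₀ V₁ t η‖ ≤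
      800 * K * (rad η ^ (s - 2 * δ₁ + 2 * (σ - δ₁) * (0 : ℕ)) *
        Real.exp (-(1 / 16) * rad η ^ (2 * (σ - δ₁)))) +
      ‖V₁ 0‖ * (rad η ^ (s - 2 * δ₁ + 2 * (σ - δ₁) * j) *
        Real.exp (-1 * rad η ^ (2 * (σ - δ₁)))) := by
  have hτ := scale_pos (σ := σ) (δ₁ := δ₁) ht
  have hr := rad_pos hη
  have hK : 0 ≤ K := (norm_nonneg _).trans (hK₀ 0)
  set τ := scale σ δ₁ t with hτd
  have hlt : δ₁ < σ := by linarith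
  have hprof := norm_profS_le (j := j) (σ := σ) (δ₁ := δ₁) (s := s) (le_refl (1 : ℝ)) hη
  have hsol : ‖((rad η ^ s : ℝ) : ℂ) * {η | rad η ≤ 1}.indicator (fun η =>
      ((τ ^ (2 * δ₁) * t ^ j : ℝ) : ℂ) * (kerD₀ j σ δ₁ δ₂ t η * V₀ η +
      kerD₁ j σ δ₁ δ₂ t η * V₁ η)) (τ • η)‖ ≤
      800 * K * (rad η ^ (s - 2 * δ₁ + 2 * (σ - δ₁) * (0 : ℕ)) *
        Real.exp (-(1 / 16) * rad η ^ (2 * (σ - δ₁)))) := by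
    by_cases h : rad (τ • η) ≤ 1
    · have hτη : τ • η ≠ 0 := smul_ne_zero hτ.ne' hη
      have b0 := low_frequency_kerD₀ hj h₁σ.le hσ₂ hτη h ht.le
      have b1 := low_frequency_kerD₁ hj h₁σ.le hσ₂ hτη h ht.le
      have hle : rad (τ • η) ^ (2 * δ₁) ≤ 1 :=
        Real.rpow_le_one (rad_nonneg _) h (by positivity)
      have hexp : Real.exp (-(rad (τ • η) ^ (2 * (σ - δ₁)) * t / 16)) =
          Real.exp (-(1 / 16) * rad η ^ (2 * (σ - δ₁))) := by
        rw [rad_smul hτ.le, Real.mul_rpow hτ.le hr.le, hτd, scale_rpow hlt ht]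
        congr 1
        field_simp
      rw [hexp] at b0 b1
      set e := Real.exp (-(1 / 16) * rad η ^ (2 * (σ - δ₁)))
      set k0 := t ^ j * ‖kerD₀ j σ δ₁ δ₂ t (τ • η)‖ with hk0
      set k1 := t ^ j * ‖kerD₁ j σ δ₁ δ₂ t (τ • η)‖ with hk1
      have hk0p : 0 ≤ k0 := by positivity
      have hk1p : 0 ≤ k1 := by positivity
      -- The `u₀` kernel needs no such weight, but inserting it (it is at most `1` here) gives both
      -- kernels the same majorant.
      have b0' : rad (τ • η) ^ (2 * δ₁) * k0 ≤ 400 * e :=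
        (mul_le_of_le_one_left hk0p hle).trans b0
      rw [indicator_of_mem (by exact h), norm_mul, norm_mul, Complex.norm_real, Complex.norm_real,
        Real.norm_of_nonneg (by positivity), Real.norm_of_nonneg (by positivity)]
      have hsum : ‖kerD₀ j σ δ₁ δ₂ t (τ • η) * V₀ (τ • η) + kerD₁ j σ δ₁ δ₂ t (τ • η) * V₁ (τ • η)‖
          ≤ ‖kerD₀ j σ δ₁ δ₂ t (τ • η)‖ * K + ‖kerD₁ j σ δ₁ δ₂ t (τ • η)‖ * K := by
        refine (norm_add_le _ _).trans ?_
        rw [norm_mul, norm_mul]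
        gcongr
        · exact hK₀ _
        · exact hK₁ _
      have hτr : τ ^ (2 * δ₁) = rad η ^ (-(2 * δ₁)) * rad (τ • η) ^ (2 * δ₁) := by
        rw [rad_smul hτ.le, Real.mul_rpow hτ.le hr.le, Real.rpow_neg hr.le]
        have : 0 < rad η ^ (2 * δ₁) := by positivity
        field_simp
      calc _ ≤ rad η ^ s * (τ ^ (2 * δ₁) * t ^ j * (‖kerD₀ j σ δ₁ δ₂ t (τ • η)‖ * K
            + ‖kerD₁ j σ δ₁ δ₂ t (τ • η)‖ * K)) := by gcongr
        _ = rad η ^ s * rad η ^ (-(2 * δ₁)) * K *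
            (rad (τ • η) ^ (2 * δ₁) * k0 + rad (τ • η) ^ (2 * δ₁) * k1) := by
            rw [hτr, hk0, hk1]; ring
        _ ≤ rad η ^ s * rad η ^ (-(2 * δ₁)) * K * (400 * e + 400 * e) := by gcongr
        _ = _ := by
            rw [← Real.rpow_add hr, Nat.cast_zero, mul_zero, add_zero, ← sub_eq_add_neg]; ring
    · rw [indicator_of_notMem (by exact h), mul_zero, norm_zero]; positivity
  have hsplit : scaledDiff j σ δ₁ δ₂ s V₀ V₁ t η = ((rad η ^ s : ℝ) : ℂ) *
      {η | rad η ≤ 1}.indicator (fun η =>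
      ((τ ^ (2 * δ₁) * t ^ j : ℝ) : ℂ) * (kerD₀ j σ δ₁ δ₂ t η * V₀ η +
      kerD₁ j σ δ₁ δ₂ t η * V₁ η)) (τ • η) - V₁ 0 * profS j σ δ₁ s 1 η := by
    rw [scaledDiff, profS]; push_cast; ring
  rw [hsplit]
  refine (norm_sub_le _ _).trans (add_le_add hsol ?_)
  rw [norm_mul]
  gcongr

/-- Every fixed frequency eventually enters the cut-off region. The `u₀` term keeps a factor
`τ^(2δ₁) → 0`, and continuity of `V₁` at the origin leaves `V₁ 0` times the limit kernel. -/
theorem tendsto_scaledDiff (hj : j = 0 ∨ j = 1) (h₁ : 0 < δ₁) (h₁σ : 2 * δ₁ < σ)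
    (hσ₂ : σ ≤ 2 * δ₂) (hV₁ : Continuous V₁) {K : ℝ} (hK₀ : ∀ η, ‖V₀ η‖ ≤ K)
    {η : EuclideanSpace ℝ (Fin n)} (hη : η ≠ 0) :
    Tendsto (fun t => scaledDiff j σ δ₁ δ₂ s V₀ V₁ t η) atTop (𝓝 0) := by
  have hlt : δ₁ < σ := by linarith
  have hτ0 : Tendsto (scale σ δ₁) atTop (𝓝 0) := tendsto_scale hlt
  have hlow : ∀ᶠ t in atTop, rad (scale σ δ₁ t • η) ≤ 1 := by
    have h1 : Tendsto (fun t => scale σ δ₁ t * rad η) atTop (𝓝 0) := by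
      simpa using hτ0.mul_const (rad η)
    filter_upwards [h1.eventually_le_const one_pos, eventually_gt_atTop 0] with t h2 ht
    rwa [rad_smul (scale_pos ht).le]
  have hV : Tendsto (fun t => V₁ (scale σ δ₁ t • η)) atTop (𝓝 (V₁ 0)) := by
    have h1 : Tendsto (fun t => scale σ δ₁ t • η) atTop (𝓝 0) := by
      simpa using hτ0.smul_const η
    exact (hV₁.tendsto 0).comp h1
  have hT1 := (tendsto_scale_mul_kerD₁ (δ₂ := δ₂) hj h₁ h₁σ hσ₂ hη).mul hV
  have hT0 : Tendsto (fun t => ((scale σ δ₁ t ^ (2 * δ₁) * t ^ j : ℝ) : ℂ) *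
      (kerD₀ j σ δ₁ δ₂ t (scale σ δ₁ t • η) * V₀ (scale σ δ₁ t • η))) atTop (𝓝 0) := by
    have h2 : Tendsto (fun t => scale σ δ₁ t ^ (2 * δ₁) * (400 * K)) atTop (𝓝 0) := by
      have := hτ0.rpow_const (p := 2 * δ₁) (Or.inr (by positivity))
      rw [Real.zero_rpow (by positivity)] at this
      simpa using this.mul_const (400 * K)
    refine squeeze_zero_norm' ?_ h2
    filter_upwards [hlow, eventually_gt_atTop 0] with t h ht
    have hτ := scale_pos (σ := σ) (δ₁ := δ₁) ht
    have b0 := low_frequency_kerD₀ hj h₁σ.le hσ₂ (smul_ne_zero hτ.ne' hη) h ht.le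
    have hexp : Real.exp (-(rad (scale σ δ₁ t • η) ^ (2 * (σ - δ₁)) * t / 16)) ≤ 1 := by
      have := rad_nonneg (scale σ δ₁ t • η)
      rw [Real.exp_le_one_iff, neg_nonpos]; positivity
    have b0' : t ^ j * ‖kerD₀ j σ δ₁ δ₂ t (scale σ δ₁ t • η)‖ ≤ 400 := by linarith
    rw [norm_mul, norm_mul, Complex.norm_real, Real.norm_of_nonneg (by positivity)]
    calc _ = scale σ δ₁ t ^ (2 * δ₁) * ((t ^ j * ‖kerD₀ j σ δ₁ δ₂ t (scale σ δ₁ t • η)‖) *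
          ‖V₀ (scale σ δ₁ t • η)‖) := by ring
      _ ≤ _ := by gcongr; exact hK₀ _
  have h3 := ((hT0.add hT1).sub_const (V₁ 0 * profD j σ δ₁ 1 η)).const_mul ((rad η ^ s : ℝ) : ℂ)
  rw [zero_add, mul_comm (profD j σ δ₁ 1 η : ℂ), sub_self, mul_zero] at h3
  refine h3.congr' ?_
  filter_upwards [hlow] with t h
  rw [scaledDiff, indicator_of_mem (by exact h)]
  ring

/-- The solution is asymptotic to `V₁ 0` times the profile. -/
theorem DataWeights.tendsto_diff (hV : DataWeights j δ₂ s V₀ V₁) (hn : 4 * δ₁ < n)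
    (hj : j = 0 ∨ j = 1) (hs : 0 ≤ s) (h₁ : 0 < δ₁) (h₁σ : 2 * δ₁ < σ) (hσ₂ : σ ≤ 2 * δ₂)
    (h₂σ : δ₂ ≤ σ) (hV₁ : Continuous V₁) {K : ℝ} (hK₀ : ∀ η, ‖V₀ η‖ ≤ K)
    (hK₁ : ∀ η, ‖V₁ η‖ ≤ K) :
    Tendsto (fun t : ℝ => t ^ (-rate n σ δ₁ s j) *
      ‖toL2 volume (solD j σ δ₁ δ₂ s V₀ V₁ t) - V₁ 0 • toL2 volume (profS j σ δ₁ s t)‖)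
      atTop (𝓝 0) := by
  have hlt : δ₁ < σ := by linarith
  have hn0 := pos_of_four_mul_lt hn h₁
  set D : Set (EuclideanSpace ℝ (Fin n)) := {η | rad η ≤ 1} with hD
  have hDm : MeasurableSet D := measurableSet_le measurable_rad measurable_const
  -- Only the solution is cut off. The whole profile stays in this part, since it scales exactly and
  -- needs no separate high frequency estimate.
  set L : ℝ → EuclideanSpace ℝ (Fin n) → ℂ := fun t η =>
    D.indicator (solD j σ δ₁ δ₂ s V₀ V₁ t) η - V₁ 0 * profS j σ δ₁ s t η with hL
  have hLm : ∀ t, Measurable (L t) := fun t =>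
    ((hV.measurable_solD t).indicator hDm).sub ((measurable_profS j σ δ₁ s t).const_mul _)
  have hsL : ∀ t, 0 < t → MemLp (solD j σ δ₁ δ₂ s V₀ V₁ t) 2 volume := fun t ht =>
    hV.memLp_solD hn0 hj hs h₁ h₁σ.le hσ₂ h₂σ ht.le
  have hLL : ∀ t, 0 < t → MemLp (L t) 2 volume := fun t ht =>
    ((hsL t ht).indicator hDm).sub ((memLp_profS hn hs h₁ hlt j ht).const_mul _)
  have hlow : Tendsto (fun t => toL2 volume (scaledDiff j σ δ₁ δ₂ s V₀ V₁ t)) atTop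
      (𝓝 (toL2 volume fun _ : EuclideanSpace ℝ (Fin n) => (0 : ℂ))) := by
    have hM := ((memLp_profS_bound hn hs h₁ hlt 0 (by norm_num : (0 : ℝ) < 1 / 16)).const_mul
      (800 * K)).add ((memLp_profS_bound hn hs h₁ hlt j one_pos).const_mul ‖V₁ 0‖)
    refine tendsto_toL2 hM (fun t => ?_) aestronglyMeasurable_const ?_ ?_ ?_
    · have h0 := hV.measurable₀
      have h1 := hV.measurable₁
      have k0 := measurable_kerD₀ (n := n) j σ δ₁ δ₂ t
      have k1 := measurable_kerD₁ (n := n) j σ δ₁ δ₂ t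
      have hi : Measurable (D.indicator (fun η : EuclideanSpace ℝ (Fin n) =>
          ((scale σ δ₁ t ^ (2 * δ₁) * t ^ j : ℝ) : ℂ) * (kerD₀ j σ δ₁ δ₂ t η * V₀ η +
          kerD₁ j σ δ₁ δ₂ t η * V₁ η))) := (by fun_prop : Measurable _).indicator hDm
      have hi' := hi.comp (by fun_prop : Measurable fun η : EuclideanSpace ℝ (Fin n) =>
        scale σ δ₁ t • η)
      simp only [Function.comp_def] at hi'
      unfold scaledDiff
      exact (by fun_prop : Measurable _).aestronglyMeasurable
    · filter_upwards [eventually_gt_atTop 0] with t ht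
      filter_upwards [ae_ne_zero hn0] with η hη
      exact norm_scaledDiff_le hj h₁ h₁σ hσ₂ hK₀ hK₁ ht hη
    · filter_upwards [ae_ne_zero hn0] with η hη
      rw [norm_zero]
      exact (norm_nonneg _).trans (norm_scaledDiff_le (V₀ := V₀) hj h₁ h₁σ hσ₂ hK₀ hK₁ one_pos hη)
    · filter_upwards [ae_ne_zero hn0] with η hη
      exact tendsto_scaledDiff hj h₁ h₁σ hσ₂ hV₁ hK₀ hη
  have h0 : toL2 volume (fun _ : EuclideanSpace ℝ (Fin n) => (0 : ℂ)) = 0 := by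
    rw [toL2_eq MemLp.zero']; exact MemLp.toLp_zero _
  rw [h0] at hlow
  have hsum := hlow.norm.add
    (hV.tendsto_high hn0 hj hs h₁ h₁σ.le hσ₂ h₂σ (-rate n σ δ₁ s j))
  rw [norm_zero, add_zero] at hsum
  refine squeeze_zero' ((eventually_gt_atTop 0).mono fun t ht => by positivity) ?_ hsum
  filter_upwards [eventually_gt_atTop 0] with t ht
  have hc : 0 ≤ t ^ (-rate n σ δ₁ s j) := by positivity
  have e1 := norm_scaled_toL2 (σ := σ) (δ₁ := δ₁) (hLm t) (hLL t ht) ht hc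
  simp only [hL, hD, scaledDiff_eq hlt ht] at e1
  have e2 : toL2 volume (solD j σ δ₁ δ₂ s V₀ V₁ t) - V₁ 0 • toL2 volume (profS j σ δ₁ s t) =
      toL2 volume (L t) + toL2 volume (Dᶜ.indicator (solD j σ δ₁ δ₂ s V₀ V₁ t)) := by
    rw [← toL2_add (hLL t ht) ((hsL t ht).indicator hDm.compl)]
    have hps := (memLp_profS hn hs h₁ hlt j ht).const_mul (V₁ 0)
    have e3 : V₁ 0 • toL2 volume (profS (n := n) j σ δ₁ s t) =
        toL2 volume fun η => V₁ 0 * profS j σ δ₁ s t η := by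
      rw [toL2_eq (memLp_profS hn hs h₁ hlt j ht), ← MemLp.toLp_const_smul]
      exact (toL2_eq hps).symm
    rw [e3, ← toL2_sub (hsL t ht) hps]
    congr 1
    funext η
    have := congrFun (indicator_self_add_compl D (solD j σ δ₁ δ₂ s V₀ V₁ t)) η
    simp only [Pi.add_apply] at this
    rw [← this, hL]
    ring
  rw [e2]
  calc _ ≤ t ^ (-rate n σ δ₁ s j) * (‖toL2 volume (L t)‖ +
        ‖toL2 volume (Dᶜ.indicator (solD j σ δ₁ δ₂ s V₀ V₁ t))‖) := by
        gcongr; exact norm_add_le _ _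
    _ = _ := by rw [mul_add, e1]

end Asymptotic

/-! ### Conclusion -/

section Conclusion

variable {n : ℕ}

theorem continuous_fourier_of_integrable {f : EuclideanSpace ℝ (Fin n) → ℂ} (hf : Integrable f) :
    Continuous (𝓕 f) :=
  VectorFourier.fourierIntegral_continuous Real.continuous_fourierChar continuous_inner hf

theorem norm_fourier_le_integral (f : EuclideanSpace ℝ (Fin n) → ℂ)
    (η : EuclideanSpace ℝ (Fin n)) : ‖𝓕 f η‖ ≤ ∫ x, ‖f x‖ :=
  VectorFourier.norm_fourierIntegral_le_integral_norm _ _ _ _ _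

theorem fourier_apply_zero (f : EuclideanSpace ℝ (Fin n) → ℂ) : 𝓕 f 0 = ∫ x, f x := by
  simp [Real.fourier_eq]

/-- Stated for `i ≤ j` because the case `j = 1` also needs the weights for the undifferentiated
curve. -/
theorem dataWeights_of_memSobolev {δ₂ s : ℝ} {i j : ℕ} (hij : i ≤ j) (hδ₂ : 0 ≤ δ₂) (hs : 0 ≤ s)
    {u₀ u₁ : L2 n} (hu₀ : Integrable u₀ volume) (hu₁ : Integrable u₁ volume)
    (hu₀' : TemperedDistribution.MemSobolev (s + 2 * j * δ₂) 2
      (u₀ : 𝓢'(EuclideanSpace ℝ (Fin n), ℂ)))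
    (hu₁' : TemperedDistribution.MemSobolev (max (s + 2 * ((j : ℝ) - 1) * δ₂) 0) 2
      (u₁ : 𝓢'(EuclideanSpace ℝ (Fin n), ℂ))) :
    DataWeights i δ₂ s (𝓕 (u₀ : EuclideanSpace ℝ (Fin n) → ℂ))
      (𝓕 (u₁ : EuclideanSpace ℝ (Fin n) → ℂ)) := by
  have hij' : (i : ℝ) ≤ j := by exact_mod_cast hij
  have key : ∀ {k l : ℝ} {f : L2 n}, 0 ≤ k → k ≤ l → Integrable f volume →
      TemperedDistribution.MemSobolev l 2 (f : 𝓢'(EuclideanSpace ℝ (Fin n), ℂ)) →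
      MemLp (fun η => (1 + rad η) ^ k * ‖𝓕 (f : EuclideanSpace ℝ (Fin n) → ℂ) η‖) 2 volume := by
    intro k l f hk hkl hf hfl
    refine (memLp_one_add_rad_rpow hk (hfl.mono hkl)).norm.ae_eq ?_
    filter_upwards [fourier_ae_eq_of_integrable hf] with η h
    have := rad_nonneg η
    rw [norm_mul, Complex.norm_real, Real.norm_of_nonneg (by positivity), h]
  refine ⟨(continuous_fourier_of_integrable hu₀).measurable,
    (continuous_fourier_of_integrable hu₁).measurable,
    key (by positivity) (by gcongr) hu₀ hu₀', key (le_max_right _ _) (by gcongr) hu₁ hu₁'⟩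

/-- A curve whose Fourier transform is a known `C^j` curve, `j ≤ 1`. -/
theorem contDiffOn_of_fourier {j : ℕ} (hj : j = 0 ∨ j = 1) {f : ℝ → L2 n} {g : ℕ → ℝ → L2 n}
    (hf : ∀ t, 0 < t → f t = 𝓕⁻ (g 0 t)) (hc : ContinuousOn (g j) (Ioi 0))
    (hd : j = 1 → ∀ t, 0 < t → HasDerivAt (g 0) (g 1 t) t) :
    ContDiffOn ℝ j f (Ioi 0) ∧ ∀ t, 0 < t → ‖iteratedDeriv j f t‖ = ‖g j t‖ := by
  set L := (Lp.fourierTransformₗᵢ (EuclideanSpace ℝ (Fin n)) ℂ).symm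
  have hf' : ∀ t, 0 < t → f t = L (g 0 t) := hf
  rcases hj with rfl | rfl
  · refine ⟨?_, fun t ht => ?_⟩
    · rw [Nat.cast_zero, contDiffOn_zero]
      exact (L.continuous.comp_continuousOn hc).congr hf'
    · rw [iteratedDeriv_zero, hf' t ht, L.norm_map]
  · have hder : ∀ t, 0 < t → HasDerivAt f (L (g 1 t)) t := fun t ht => by
      have h1 := ((L.toContinuousLinearEquiv : L2 n →L[ℂ] L2 n).restrictScalars
        ℝ).hasFDerivAt.comp_hasDerivAt t (hd rfl t ht)
      refine HasDerivAt.congr_of_eventuallyEq h1 ?_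
      filter_upwards [Ioi_mem_nhds ht] with τ hτ
      exact hf' τ hτ
    refine ⟨?_, fun t ht => ?_⟩
    · have h01 : ((1 : ℕ) : WithTop ℕ∞) = 0 + 1 := by norm_num
      rw [h01, contDiffOn_succ_iff_deriv_of_isOpen isOpen_Ioi]
      refine ⟨fun t ht => (hder t ht).differentiableAt.differentiableWithinAt, by simp, ?_⟩
      rw [contDiffOn_zero]
      exact (L.continuous.comp_continuousOn hc).congr fun t ht => (hder t ht).deriv
    · rw [iteratedDeriv_one, (hder t ht).deriv, L.norm_map]

theorem fourier_profile {σ δ₁ t : ℝ} :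
    𝓕 (profile n σ δ₁ t) = toL2 volume (profS 0 σ δ₁ 0 t) := by
  rw [profile, fourier_invFourier]
  congr 1
  funext η
  simp [profS, profD, rad]

end Conclusion

end DampedEvolution

end

/-! ### The theorem -/

open DampedEvolution in
theorem theorem1p3 (n : ℕ) (σ δ₁ δ₂ s : ℝ) (j : ℕ)
    (hσ : 1 ≤ σ) (hδ₁ : 0 < δ₁) (hδ₁σ : δ₁ < σ / 2) (hδ₂σ : σ / 2 < δ₂) (hδ₂ : δ₂ < σ)
    (hδ : σ < δ₁ + δ₂) (hn : 4 * δ₁ < n) (hs : 0 ≤ s) (hj : j = 0 ∨ j = 1)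
    (u₀ u₁ : L2 n)
    (hu₀ : Integrable u₀ volume) (hu₁ : Integrable u₁ volume)
    (hu₀' : TemperedDistribution.MemSobolev (s + 2 * j * δ₂) 2
      (u₀ : 𝓢'(EuclideanSpace ℝ (Fin n), ℂ)))
    (hu₁' : TemperedDistribution.MemSobolev (max (s + 2 * ((j : ℝ) - 1) * δ₂) 0) 2
      (u₁ : 𝓢'(EuclideanSpace ℝ (Fin n), ℂ)))
    (u : ℝ → L2 n) (hu : IsSolution σ δ₁ δ₂ u₀ u₁ u)
    (P₁ : ℂ) (hP₁ : P₁ = ∫ x, u₁ x) :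
    -- the quantities below are well defined: `|D|^s` can be applied and the
    -- resulting `L²`-valued curves are `j` times continuously differentiable for `t > 0`
    (∀ t > 0, MemDomAbsD s (u t)) ∧
    (∀ t > 0, MemDomAbsD s (u t - P₁ • profile n σ δ₁ t)) ∧
    ContDiffOn ℝ j (fun τ => absD s (u τ)) (Ioi 0) ∧
    ContDiffOn ℝ j (fun τ => absD s (u τ - P₁ • profile n σ δ₁ τ)) (Ioi 0) ∧
    -- the asymptotic profile
    (fun t : ℝ => ‖iteratedDeriv j (fun τ => absD s (u τ - P₁ • profile n σ δ₁ τ)) t‖)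
      =o[atTop] (fun t : ℝ => t ^ rate n σ δ₁ s j) ∧
    -- the optimal bounds
    (P₁ ≠ 0 → ∃ C₁ > 0, ∃ C₂ > 0, ∀ᶠ t : ℝ in atTop,
      C₁ * t ^ rate n σ δ₁ s j ≤ ‖iteratedDeriv j (fun τ => absD s (u τ)) t‖ ∧
      ‖iteratedDeriv j (fun τ => absD s (u τ)) t‖ ≤ C₂ * t ^ rate n σ δ₁ s j) := by
  have h₁σ : 2 * δ₁ < σ := by linarith
  have hσ₂ : σ ≤ 2 * δ₂ := by linarith
  have hlt : δ₁ < σ := by linarith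
  have hδ₂0 : 0 < δ₂ := by linarith
  have hn0 := pos_of_four_mul_lt hn hδ₁
  -- The Fourier integrals are used as representatives of the `L²` transforms: they are bounded and
  -- continuous, so that the value `V₁ 0` makes sense and equals `P₁`.
  set V₀ := 𝓕 (u₀ : EuclideanSpace ℝ (Fin n) → ℂ) with hV₀
  set V₁ := 𝓕 (u₁ : EuclideanSpace ℝ (Fin n) → ℂ) with hV₁
  have hP : V₁ 0 = P₁ := by rw [hV₁, fourier_apply_zero, hP₁]
  have hW0 : DataWeights 0 δ₂ s V₀ V₁ :=
    dataWeights_of_memSobolev (Nat.zero_le j) hδ₂0.le hs hu₀ hu₁ hu₀' hu₁'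
  have hWj : DataWeights j δ₂ s V₀ V₁ :=
    dataWeights_of_memSobolev le_rfl hδ₂0.le hs hu₀ hu₁ hu₀' hu₁'
  have hS : ∀ t, 0 < t → MemLp (solD 0 σ δ₁ δ₂ s V₀ V₁ t) 2 volume := fun t ht =>
    hW0.memLp_solD hn0 (.inl rfl) hs hδ₁ h₁σ.le hσ₂ hδ₂.le ht.le
  have hG : ∀ t, 0 < t → MemLp (fun η => P₁ * profS (n := n) 0 σ δ₁ s t η) 2 volume :=
    fun t ht => (memLp_profS hn hs hδ₁ hlt 0 ht).const_mul P₁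
  -- the Fourier transforms of the two curves
  have hfu : ∀ t, 0 < t → (fun η => ((rad η ^ s : ℝ) : ℂ) * (𝓕 (u t) : L2 n) η) =ᵐ[volume]
      solD 0 σ δ₁ δ₂ s V₀ V₁ t := fun t ht => by
    filter_upwards [fourier_solution hn0 (by linarith) hδ₁ hδ₂0 h₁σ.le hσ₂ hu ht.le,
      fourier_ae_eq_of_integrable hu₀, fourier_ae_eq_of_integrable hu₁] with η e1 e2 e3
    rw [e1, e2, e3]
    rfl
  have hfd : ∀ t, 0 < t →
      (fun η => ((rad η ^ s : ℝ) : ℂ) * (𝓕 (u t - P₁ • profile n σ δ₁ t) : L2 n) η) =ᵐ[volume]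
      fun η => solD 0 σ δ₁ δ₂ s V₀ V₁ t η - P₁ * profS 0 σ δ₁ s t η := fun t ht => by
    have e0 : (𝓕 (u t - P₁ • profile n σ δ₁ t) : L2 n) =
        𝓕 (u t) - P₁ • toL2 volume (profS 0 σ δ₁ 0 t) := by
      rw [← fourier_profile, ← FourierTransform.fourier_smul]
      exact (Lp.fourierTransformₗᵢ (EuclideanSpace ℝ (Fin n)) ℂ).map_sub _ _
    rw [e0]
    filter_upwards [hfu t ht, Lp.coeFn_sub (𝓕 (u t)) (P₁ • toL2 volume (profS 0 σ δ₁ 0 t) : L2 n),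
      Lp.coeFn_smul P₁ (toL2 volume (profS 0 σ δ₁ 0 t) : L2 n),
      coeFn_toL2 (memLp_profS (n := n) hn le_rfl hδ₁ hlt 0 ht)] with η e1 e2 e3 e4
    rw [e2, Pi.sub_apply, mul_sub, e1, e3, Pi.smul_apply, e4]
    simp only [profS, Real.rpow_zero, one_mul, smul_eq_mul]
    push_cast
    ring
  have hsub : ∀ t, 0 < t → toL2 volume (fun η => solD 0 σ δ₁ δ₂ s V₀ V₁ t η -
      P₁ * profS 0 σ δ₁ s t η) = toL2 volume (solD 0 σ δ₁ δ₂ s V₀ V₁ t) -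
      P₁ • toL2 volume (profS 0 σ δ₁ s t) := fun t ht => by
    rw [toL2_sub (hS t ht) (hG t ht), toL2_eq (memLp_profS hn hs hδ₁ hlt 0 ht),
      ← MemLp.toLp_const_smul]
    congr 1
    exact toL2_eq (hG t ht)
  have hcS := hWj.continuousOn_solD hn0 hj hs hδ₁ h₁σ.le hσ₂ hδ₂.le
  have hcP := continuousOn_profS hn hs hδ₁ hlt j
  have hdS : j = 1 → ∀ t, 0 < t → HasDerivAt
      (fun t => toL2 volume (solD 0 σ δ₁ δ₂ s V₀ V₁ t))
      (toL2 volume (solD 1 σ δ₁ δ₂ s V₀ V₁ t)) t := fun h t ht => by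
    subst h
    exact hW0.hasDerivAt_solD hWj hn0 hs hδ₁ h₁σ.le hσ₂ hδ₂.le ht
  obtain ⟨hC1, hN1⟩ := contDiffOn_of_fourier hj (f := fun τ => absD s (u τ))
    (g := fun i t => toL2 volume (solD i σ δ₁ δ₂ s V₀ V₁ t))
    (fun t ht => by rw [absD_eq, toL2_congr_ae (hfu t ht)]) hcS hdS
  obtain ⟨hC2, hN2⟩ := contDiffOn_of_fourier hj
    (f := fun τ => absD s (u τ - P₁ • profile n σ δ₁ τ))
    (g := fun i t => toL2 volume (solD i σ δ₁ δ₂ s V₀ V₁ t) - P₁ • toL2 volume (profS i σ δ₁ s t))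
    (fun t ht => by rw [absD_eq, toL2_congr_ae (hfd t ht), hsub t ht])
    (hcS.sub (hcP.const_smul P₁))
    (fun h t ht => (hdS h t ht).sub ((hasDerivAt_profS hn hs hδ₁ hlt ht).const_smul P₁))
  have hmain := hWj.tendsto_diff hn hj hs hδ₁ h₁σ hσ₂ hδ₂.le
    (continuous_fourier_of_integrable hu₁) (K := max (∫ x, ‖u₀ x‖) (∫ x, ‖u₁ x‖))
    (fun η => (norm_fourier_le_integral _ η).trans (le_max_left _ _))
    (fun η => (norm_fourier_le_integral _ η).trans (le_max_right _ _))
  rw [hP] at hmain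
  refine ⟨fun t ht => (hS t ht).ae_eq (hfu t ht).symm,
    fun t ht => ((hS t ht).sub (hG t ht)).ae_eq (hfd t ht).symm, hC1, hC2, ?_, fun hP0 => ?_⟩
  · rw [isLittleO_iff_tendsto' ((eventually_gt_atTop 0).mono fun t ht h =>
      absurd h (Real.rpow_pos_of_pos ht _).ne')]
    refine hmain.congr' ?_
    filter_upwards [eventually_gt_atTop 0] with t ht
    rw [hN2 t ht, Real.rpow_neg ht.le, div_eq_inv_mul]
  · set c := ‖P₁‖ * ‖toL2 volume (profS (n := n) j σ δ₁ s 1)‖ with hc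
    have hc0 : 0 < c := mul_pos (norm_pos_iff.2 hP0) (norm_profS_one_pos hn hs hδ₁ hlt j)
    -- The profile has norm exactly `c t^ρ` and the error is eventually at most `(c / 2) t^ρ`, so
    -- the norm lies between `c / 2` and `3 c / 2` times `t^ρ`.
    refine ⟨c / 2, half_pos hc0, 2 * c, by positivity, ?_⟩
    filter_upwards [hmain.eventually_le_const (half_pos hc0), eventually_gt_atTop 0] with t h ht
    have hr : 0 < t ^ rate n σ δ₁ s j := Real.rpow_pos_of_pos ht _
    rw [Real.rpow_neg ht.le, inv_mul_le_iff₀ hr] at h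
    have hprof : ‖P₁ • toL2 volume (profS (n := n) j σ δ₁ s t)‖ = c * t ^ rate n σ δ₁ s j := by
      rw [norm_smul, norm_profS hn hs hδ₁ hlt j ht, hc, mul_assoc]
    rw [hN1 t ht]
    have e1 := norm_sub_norm_le (P₁ • toL2 volume (profS (n := n) j σ δ₁ s t))
      (toL2 volume (solD j σ δ₁ δ₂ s V₀ V₁ t))
    have e2 := norm_sub_norm_le (toL2 volume (solD j σ δ₁ δ₂ s V₀ V₁ t))
      (P₁ • toL2 volume (profS (n := n) j σ δ₁ s t))
    rw [norm_sub_rev] at e1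
    rw [hprof] at e1 e2
    constructor <;> nlinarith
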